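/- Distributions are probability measures on $\overline{\mathbb R}=\mathbb R\cup\{\infty\}$ (the one-point compactification; ordinary distributions on $\mathbb R$ are those without mass at $\infty$), and $X^{-1}$ is formed with $1/0=\infty$, $1/\infty=0$. For $X$ with distribution $P_X$ let $$m_X(s)=\int\frac{dP_X(x)}{x-s},\qquad s\in\mathbb C\setminus\operatorname{supp}P_X,$$ where the integrand is $0$ at $x=\infty$. If $m_X$ is injective on a set $U\subseteq\mathbb C\setminus\operatorname{supp}P_X$, the R-transform of $X$ on $U$ is $R_{X,U}(w)=(m_X|_U)^{-1}(-w)-\frac1w$ for $0\neq w\in -m_X(U)$. When $U$ is all of $\mathbb C\setminus\operatorname{supp}P_X$ we write $R_X$. (a) Let $m_X$ be injective on $U\subseteq\mathbb C\setminus\operatorname{supp}P_X$ and $m_{X^{-1}}$ injective on $V\subseteq\mathbb C\setminus\operatorname{supp}P_{X^{-1}}$. Let $0\ne w\in -m_X(U)$ be such that $R:=R_{X,U}(w)\neq0$, $1+wR\ne0$ and $(R+\frac1w)^{-1}\in V$ (that is, $s=(m_X|_U)^{-1}(-w)\neq0$ satisfies $1/s\in V$). Then $$\frac1{R_{X,U}(w)}=R_{X^{-1},V}\bigl(-R_{X,U}(w)\,(1+w\,R_{X,U}(w))\bigr).$$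 Moreover, if $P_X\neq\delta_0$ and $P_X\ne\delta_\infty$, there is a nonempty open set $U$ in the upper half-plane such that $m_X$ is injective on $U$, $m_{X^{-1}}$ is injective on $V=\{1/s:s\in U\}$, and all the conditions above hold for every $w\in -m_X(U)$. (b) Let $\alpha>0$. There is a probability measure $\nu$ on $\mathbb R$ with the following properties. For every $N$ let $H=H_N$ be a $K_N\times N$ random matrix whose entries are independent circularly symmetric complex Gaussian variables with mean $0$ and variance $1/N$ (all $H_N$ on one probability space, with no assumption on their joint distribution for different $N$), and let $K_N/N\to\alpha$. Then, almost surely, the empirical eigenvalue distribution of $HH^\dagger$ converges weakly to $\nu$, and the empirical eigenvalue distribution of $(HH^\dagger)^{-1}$, in which a zero eigenvalue of $HH^\dagger$ counts as an eigenvalue $\infty$, converges weakly on $\overline{\mathbb R}$ to the distribution $\nu^{-1}$ of $X=Y^{-1}$, $Y\sim\nu$. Furthermore: (i) $m_Y$ is injective on $\mathbb C\setminus\operatorname{supp}\nu$, and for every $w\in -m_Y(\mathbb C\setminus\operatorname{supp}\nu)$ we have $w\ne0$, $\alpha w\neq1$ and $R_Y(w)=\dfrac1{1-\alpha w}$. (ii)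 $m_X$ is injective on $\mathbb C\setminus\operatorname{supp}\nu^{-1}$, and for every $w\in -m_X(\mathbb C\setminus\operatorname{supp}\nu^{-1})$ we have $w\neq0$, $(1-\alpha)^2-4\alpha w\notin(-\infty,0]$ and, with the principal square root, $$R_X(w)=1+\alpha R_X(w)\bigl(1+wR_X(w)\bigr),\qquad R_X(w)=\frac{1-\alpha-\sqrt{(1-\alpha)^2-4\alpha w}}{2\alpha w},$$ $$R_X'(w)=\frac{\bigl(1-\alpha-\sqrt{(1-\alpha)^2-4\alpha w}\bigr)^2}{4\alpha w^2\sqrt{(1-\alpha)^2-4\alpha w}}.$$ -/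

import Mathlib

open MeasureTheory ProbabilityTheory Filter Topology
open scoped OnePoint

noncomputable section

namespace RInv

/-- The extended real line `ℝ ∪ {∞}` with its Borel σ-algebra. -/
instance instMeasurableSpaceOnePointReal : MeasurableSpace (OnePoint ℝ) := borel _

instance instBorelSpaceOnePointReal : BorelSpace (OnePoint ℝ) := ⟨rfl⟩

/-- Inversion `x ↦ 1/x` on `ℝ ∪ {∞}`, with `1/0 = ∞` and `1/∞ = 0`. -/
def invPt : OnePoint ℝ → OnePoint ℝ
  | ∞ => ((0 : ℝ) : OnePoint ℝ)
  | (x : ℝ) => if x = 0 then ∞ else ((x⁻¹ : ℝ) : OnePoint ℝ)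

/-- A distribution on `ℝ`, seen as a distribution on `ℝ ∪ {∞}`. -/
def toExt (ν : Measure ℝ) : Measure (OnePoint ℝ) := ν.map (fun x : ℝ => (x : OnePoint ℝ))

/-- The distribution of `X⁻¹` when `X` has distribution `μ`. -/
def invLaw (μ : Measure (OnePoint ℝ)) : Measure (OnePoint ℝ) := μ.map invPt

/-- The integrand `1 / (x - s)` of the Stieltjes transform, equal to `0` at `x = ∞`. -/
def stieltjesKernel (s : ℂ) : OnePoint ℝ → ℂ
  | ∞ => 0
  | (x : ℝ) => 1 / ((x : ℂ) - s)

/-- The Stieltjes transform `m(s) = ∫ dP(x) / (x - s)`. -/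
def stieltjes (μ : Measure (OnePoint ℝ)) (s : ℂ) : ℂ := ∫ x, stieltjesKernel s x ∂μ

/-- The natural domain of the Stieltjes transform: the complex numbers off the support of `μ`. -/
def stieltjesDomain (μ : Measure (OnePoint ℝ)) : Set ℂ :=
  {s | ∀ x : ℝ, (x : ℂ) = s → (x : OnePoint ℝ) ∉ μ.support}

/-- `U` is a set on which the Stieltjes transform exists and has an inverse with respect to
composition. -/
def IsBranch (μ : Measure (OnePoint ℝ)) (U : Set ℂ) : Prop :=
  U ⊆ stieltjesDomain μ ∧ Set.InjOn (stieltjes μ) U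

/-- The set of all `w` such that `-w` is a value of the Stieltjes transform on `U`. -/
def rDomain (μ : Measure (OnePoint ℝ)) (U : Set ℂ) : Set ℂ :=
  {w | -w ∈ stieltjes μ '' U}

/-- The R-transform `R(w) = m⁻¹(-w) - 1/w`, where `m⁻¹` is the inverse of the Stieltjes
transform on the set `U`. It is meaningful for `IsBranch μ U` and `w ∈ rDomain μ U`, `w ≠ 0`. -/
def rTransform (μ : Measure (OnePoint ℝ)) (U : Set ℂ) (w : ℂ) : ℂ :=
  Function.invFunOn (stieltjes μ) U (-w) - 1 / w

/-- The R-transform formed with the inverse of the Stieltjes transform on its whole natural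
domain; it is used only where the Stieltjes transform is injective there. -/
def fullRTransform (μ : Measure (OnePoint ℝ)) (w : ℂ) : ℂ :=
  rTransform μ (stieltjesDomain μ) w

/-- The principal branch of the complex square root. -/
def csqrt (z : ℂ) : ℂ := z ^ (1 / 2 : ℂ)

/-- The circularly symmetric complex Gaussian distribution with mean zero and variance `v`:
real and imaginary part are independent real Gaussians of variance `v / 2`. -/
def complexGaussian (v : NNReal) : Measure ℂ :=
  ((gaussianReal 0 (v / 2)).prod (gaussianReal 0 (v / 2))).map
    (fun p : ℝ × ℝ => (p.1 : ℂ) + (p.2 : ℂ) * Complex.I)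

/-- The empirical distribution of the eigenvalues of a Hermitian matrix. -/
def spectralDist {k : ℕ} {A : Matrix (Fin k) (Fin k) ℂ} (hA : A.IsHermitian) : Measure ℝ :=
  (k : ENNReal)⁻¹ • ∑ i, Measure.dirac (hA.eigenvalues i)

/-- The empirical distribution of the eigenvalues of the inverse of a Hermitian matrix `A`:
the eigenvalues of `A` are inverted, and a zero eigenvalue of `A` contributes a point mass
at `∞`. For invertible `A` it is the spectral distribution of `A⁻¹`, see
`invSpectralDist_eq_of_isUnit`. -/
def invSpectralDist {k : ℕ} {A : Matrix (Fin k) (Fin k) ℂ} (hA : A.IsHermitian) :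
    Measure (OnePoint ℝ) :=
  (k : ENNReal)⁻¹ • ∑ i, Measure.dirac (invPt (hA.eigenvalues i : OnePoint ℝ))

/-- Weak convergence of a sequence of measures. -/
def WeaklyTendsto {E : Type*} [TopologicalSpace E] [MeasurableSpace E]
    (μ : ℕ → Measure E) (ν : Measure E) : Prop :=
  ∀ f : BoundedContinuousFunction E ℝ,
    Tendsto (fun n => ∫ x, f x ∂(μ n)) atTop (𝓝 (∫ x, f x ∂ν))

/-- For every `N`, the matrix `H N` is a `K N × N` random matrix whose entries are independent
complex Gaussians with mean zero and variance `1 / N`. -/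
def IsGaussianEnsemble {Ω : Type*} [MeasurableSpace Ω] (P : Measure Ω) (K : ℕ → ℕ)
    (H : ∀ N : ℕ, Ω → Matrix (Fin (K N)) (Fin N) ℂ) : Prop :=
  ∀ N : ℕ,
    (∀ i j, HasLaw (fun ω => H N ω i j) (complexGaussian ((N : NNReal)⁻¹)) P) ∧
    iIndepFun (fun (p : Fin (K N) × Fin N) (ω : Ω) => H N ω p.1 p.2) P

lemma invPt_infty : invPt OnePoint.infty = ((0 : ℝ) : OnePoint ℝ) := rfl

lemma invPt_zero : invPt ((0 : ℝ) : OnePoint ℝ) = OnePoint.infty := if_pos rfl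

lemma invPt_coe {x : ℝ} (hx : x ≠ 0) :
    invPt (x : OnePoint ℝ) = ((x⁻¹ : ℝ) : OnePoint ℝ) := if_neg hx

/-- Inversion is continuous, hence measurable, so that `invLaw` is a genuine image measure. -/
lemma continuous_invPt : Continuous invPt := by
  rw [OnePoint.continuous_iff]
  constructor
  · rw [coclosedCompact_eq_cocompact, ← Metric.cobounded_eq_cocompact, invPt_infty]
    have h : Tendsto (fun x : ℝ => ((x⁻¹ : ℝ) : OnePoint ℝ)) (Bornology.cobounded ℝ)
        (𝓝 ((0 : ℝ) : OnePoint ℝ)) :=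
      (OnePoint.continuous_coe.tendsto 0).comp tendsto_inv₀_cobounded
    refine h.congr' ?_
    filter_upwards [Metric.hasBasis_cobounded_compl_closedBall (0 : ℝ) |>.mem_of_mem
      (i := 0) trivial] with x hx
    exact (invPt_coe (by simpa using hx)).symm
  · rw [continuous_iff_continuousAt]
    intro x
    by_cases hx : x = 0
    · subst hx
      rw [continuousAt_iff_punctured_nhds, invPt_zero]
      have h : Tendsto (fun x : ℝ => ((x⁻¹ : ℝ) : OnePoint ℝ)) (𝓝[≠] 0)
          (𝓝 OnePoint.infty) := by
        refine Tendsto.comp (y := Bornology.cobounded ℝ) ?_ tendsto_inv₀_nhdsNE_zero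
        rw [Metric.cobounded_eq_cocompact, ← coclosedCompact_eq_cocompact]
        exact OnePoint.tendsto_coe_infty
      refine h.congr' ?_
      filter_upwards [self_mem_nhdsWithin] with y hy
      exact (invPt_coe hy).symm
    · have h : ContinuousAt (fun x : ℝ => ((x⁻¹ : ℝ) : OnePoint ℝ)) x :=
        OnePoint.continuous_coe.continuousAt.comp (continuousAt_inv₀ hx)
      refine h.congr ?_
      filter_upwards [isOpen_ne.mem_nhds hx] with y hy
      exact (invPt_coe hy).symm

lemma eigenvalues_ne_zero {k : ℕ} {A : Matrix (Fin k) (Fin k) ℂ} (hA : A.IsHermitian)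
    (hu : IsUnit A) (i : Fin k) : hA.eigenvalues i ≠ 0 := by
  have hd : A.det ≠ 0 := ((Matrix.isUnit_iff_isUnit_det A).1 hu).ne_zero
  rw [hA.det_eq_prod_eigenvalues, Finset.prod_ne_zero_iff] at hd
  intro h
  exact hd i (Finset.mem_univ i) (by simp [h])

lemma map_eigenvalues_inv {k : ℕ} {A : Matrix (Fin k) (Fin k) ℂ} (hA : A.IsHermitian)
    (hu : IsUnit A) :
    Multiset.map hA.inv.eigenvalues Finset.univ.val =
      Multiset.map (fun i => (hA.eigenvalues i)⁻¹) Finset.univ.val := by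
  have hne := eigenvalues_ne_zero hA hu
  set D : Matrix (Fin k) (Fin k) ℂ :=
    Matrix.diagonal (fun i => (((hA.eigenvalues i)⁻¹ : ℝ) : ℂ)) with hD
  have hB : A⁻¹ = Unitary.conjStarAlgAut ℂ _ hA.eigenvectorUnitary D := by
    apply Matrix.inv_eq_right_inv
    refine (congrArg (· * _) hA.spectral_theorem).trans ?_
    rw [← map_mul, hD, Matrix.diagonal_mul_diagonal]
    have : (fun i => (RCLike.ofReal ∘ hA.eigenvalues) i * (((hA.eigenvalues i)⁻¹ : ℝ) : ℂ))
        = fun _ => (1 : ℂ) := by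
      funext i
      have : ((hA.eigenvalues i : ℝ) : ℂ) ≠ 0 := by exact_mod_cast hne i
      simp [this]
    rw [this, Matrix.diagonal_one, map_one]
  have hc : (A⁻¹).charpoly =
      ∏ i, (Polynomial.X - Polynomial.C (((hA.eigenvalues i)⁻¹ : ℝ) : ℂ)) := by
    rw [hB, Unitary.conjStarAlgAut_apply, Matrix.charpoly_mul_comm, ← mul_assoc]
    simp [hD, Matrix.charpoly_diagonal]
  have hr := hA.inv.roots_charpoly_eq_eigenvalues
  rw [hc, Polynomial.roots_prod _ _ (by
    simp [Finset.prod_ne_zero_iff, Polynomial.X_sub_C_ne_zero, -Complex.ofReal_inv])] at hr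
  have h := congrArg (Multiset.map Complex.re) hr
  simpa [Multiset.map_map, Function.comp_def, -Complex.ofReal_inv] using h.symm

/-- For an invertible matrix, `invSpectralDist` is the spectral distribution of the inverse. -/
lemma invSpectralDist_eq_of_isUnit {k : ℕ} {A : Matrix (Fin k) (Fin k) ℂ} (hA : A.IsHermitian)
    (hu : IsUnit A) : invSpectralDist hA = toExt (spectralDist hA.inv) := by
  have hne := eigenvalues_ne_zero hA hu
  have hm : Measurable (fun x : ℝ => (x : OnePoint ℝ)) := OnePoint.continuous_coe.measurable
  have e := congrArg (fun m : Multiset ℝ => (m.map fun x : ℝ =>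
    Measure.dirac (x : OnePoint ℝ)).sum) (map_eigenvalues_inv hA hu)
  simp only [Multiset.map_map, Function.comp_def] at e
  have h2 : toExt (spectralDist hA.inv) = (k : ENNReal)⁻¹ •
      ∑ i, Measure.dirac ((hA.inv.eigenvalues i : ℝ) : OnePoint ℝ) := by
    rw [toExt, spectralDist, Measure.map_smul, ← Measure.mapₗ_apply_of_measurable hm, map_sum]
    simp only [Measure.mapₗ_apply_of_measurable hm, Measure.map_dirac]
  rw [h2, invSpectralDist]
  congr 1
  simp only [invPt_coe (hne _)]
  exact e.symm

end RInv

end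

noncomputable section

namespace RInv

/-! Part (a) is algebra. Since `1/(1/x - 1/s) = -s - s²/(x - s)`, integration gives `m_{X⁻¹}(1/s) =
-s - s² m_X(s)` (`stieltjes_invLaw_inv`). With `w = -m_X(s)` one has `R = s - 1/w` and `1 + wR =
ws`, so `-R(1 + wR)` is exactly `-m_{X⁻¹}(1/s)`, and the R-transform of `X⁻¹` there is `1/s +
1/m_{X⁻¹}(1/s) = 1/R`. For the existence of branches, a Stieltjes transform with zero derivative on
a half-plane would be constant, hence zero by its decay at infinity; this happens only for `δ_∞`. So
both derivatives are nonzero at a common point, and both maps are locally injective there.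

For (b), the resolvent method gives the limit law. The trace of `(W - t)G = 1`, together with rank
one updates, expresses the normalized trace `m` of the resolvent through quadratic forms `q_j = x_j†
G_j x_j`, where `x_j` is independent of `G_j`. These forms concentrate at `c m` with `c = K_N/N`, so
`m` nearly satisfies `c t m² + (t + c - 1) m + 1 = 0` in mean
(`integral_norm_quadratic_normTrace_le`). Bounded differences give exponential concentration of `m`,
hence almost sure convergence by Borel–Cantelli. Of the roots of the limiting quadratic only one
satisfies `Im m ≥ 0` and `Im (t m) ≥ 0` (`IsLimitRoot.unique`), so it is the limit of the
transforms.

The law `ν` is a limit point of sampled spectral distributions in the compact space of probability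
measures on `ℝ ∪ {∞}`; the quadratic forces `t m → -1` at infinity, so no mass escapes
(`exists_limit_law`). Stieltjes kernels and constants span a dense subspace of `C(ℝ ∪ {∞})`, so
convergence of transforms is weak convergence, and inversion, being continuous, transports it to the
inverse spectra.

The R-transforms come from solving the quadratic for `t`. For `ν` it is linear in `t`. For `ν⁻¹` the
discriminant in `w` is the square of `invDiscrRoot`, an expression in `s` and `m_{X⁻¹}(s)`; its real
part is positive on the whole domain (`invDiscrRoot_re_pos`), which identifies it with the principal
square root and yields injectivity, the formula and its derivative. -/

/-! ### Stieltjes transforms on the extended line: domain and analyticity. -/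

lemma stieltjesKernel_infty (s : ℂ) : stieltjesKernel s OnePoint.infty = 0 := rfl

lemma stieltjesKernel_coe (s : ℂ) (x : ℝ) :
    stieltjesKernel s (x : OnePoint ℝ) = 1 / ((x : ℂ) - s) := rfl

/-- The point `∞` is a measurable singleton, so it imposes no condition. -/
lemma measurable_of_measurable_comp_coe {β : Type*} [MeasurableSpace β] {f : OnePoint ℝ → β}
    (hf : Measurable fun x : ℝ => f (x : OnePoint ℝ)) : Measurable f := by
  have he : MeasurableEmbedding (fun x : ℝ => (x : OnePoint ℝ)) :=
    OnePoint.isOpenEmbedding_coe.measurableEmbedding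
  intro T hT
  have h : f ⁻¹' T = (fun x : ℝ => (x : OnePoint ℝ)) '' ((fun x : ℝ => f (x : OnePoint ℝ)) ⁻¹' T) ∪
      ({OnePoint.infty} ∩ f ⁻¹' T) := by
    ext x
    induction x using OnePoint.rec <;> simp
  rw [h]
  refine (he.measurableSet_image.2 (hf hT)).union ?_
  by_cases hi : OnePoint.infty ∈ f ⁻¹' T
  · rw [Set.inter_eq_left.2 (by simpa using hi)]
    exact measurableSet_singleton _
  · rw [Set.singleton_inter_eq_empty.2 hi]
    exact MeasurableSet.empty

lemma measurable_stieltjesKernel (s : ℂ) : Measurable (stieltjesKernel s) := by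
  refine measurable_of_measurable_comp_coe ?_
  simp only [stieltjesKernel_coe]
  fun_prop

/-- Off the support, the points of `ℝ` charged by `μ` stay at a positive distance. -/
lemma mem_stieltjesDomain_iff_gap {μ : Measure (OnePoint ℝ)} {s : ℂ} :
    s ∈ stieltjesDomain μ ↔
      ∃ δ : ℝ, 0 < δ ∧ ∀ᵐ x ∂μ, ∀ y : ℝ, x = (y : OnePoint ℝ) → δ ≤ ‖(y : ℂ) - s‖ := by
  constructor
  · intro hs
    by_cases him : s.im = 0
    · have hsr : ((s.re : ℝ) : ℂ) = s := Complex.ext rfl (by simp [him])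
      have h := hs s.re hsr
      rw [Measure.notMem_support_iff_exists] at h
      obtain ⟨U, hU, hμ⟩ := h
      have hU' := (OnePoint.continuous_coe.tendsto s.re) hU
      obtain ⟨δ, hδ, hb⟩ := Metric.mem_nhds_iff.1 hU'
      refine ⟨δ, hδ, ?_⟩
      filter_upwards [measure_eq_zero_iff_ae_notMem.1 hμ] with x hx y hxy
      by_contra hlt
      refine hx (hxy ▸ hb ?_)
      rw [Metric.mem_ball, Real.dist_eq, ← Real.norm_eq_abs, ← Complex.norm_real]
      rw [← hsr] at hlt
      push_cast
      exact not_le.1 hlt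
    · refine ⟨|s.im|, abs_pos.2 him, Eventually.of_forall fun x y _ => ?_⟩
      simpa using Complex.abs_im_le_norm ((y : ℂ) - s)
  · rintro ⟨δ, hδ, h⟩ x rfl
    rw [Measure.notMem_support_iff_exists]
    refine ⟨(fun x : ℝ => (x : OnePoint ℝ)) '' Metric.ball x δ,
      OnePoint.isOpenEmbedding_coe.isOpenMap.image_mem_nhds (Metric.ball_mem_nhds x hδ), ?_⟩
    rw [measure_eq_zero_iff_ae_notMem]
    filter_upwards [h] with z hz
    rintro ⟨y, hy, rfl⟩
    have := hz y rfl
    rw [Metric.mem_ball, Real.dist_eq, ← Real.norm_eq_abs, ← Complex.norm_real] at hy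
    push_cast at hy
    linarith

lemma gap_of_dist {μ : Measure (OnePoint ℝ)} {s s' : ℂ} {δ : ℝ}
    (h : ∀ᵐ x ∂μ, ∀ y : ℝ, x = (y : OnePoint ℝ) → δ ≤ ‖(y : ℂ) - s‖) (hs : ‖s' - s‖ ≤ δ / 2) :
    ∀ᵐ x ∂μ, ∀ y : ℝ, x = (y : OnePoint ℝ) → δ / 2 ≤ ‖(y : ℂ) - s'‖ := by
  filter_upwards [h] with x hx y hy
  have h1 := hx y hy
  have h2 : ‖(y : ℂ) - s‖ ≤ ‖(y : ℂ) - s'‖ + ‖s' - s‖ := by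
    simpa using norm_add_le ((y : ℂ) - s') (s' - s)
  linarith

lemma isOpen_stieltjesDomain (μ : Measure (OnePoint ℝ)) : IsOpen (stieltjesDomain μ) := by
  rw [Metric.isOpen_iff]
  intro s hs
  obtain ⟨δ, hδ, h⟩ := mem_stieltjesDomain_iff_gap.1 hs
  refine ⟨δ / 2, by positivity, fun s' hs' => ?_⟩
  rw [mem_ball_iff_norm] at hs'
  exact mem_stieltjesDomain_iff_gap.2 ⟨δ / 2, by positivity, gap_of_dist h hs'.le⟩

lemma mem_stieltjesDomain_of_im_ne_zero (μ : Measure (OnePoint ℝ)) {s : ℂ} (hs : s.im ≠ 0) :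
    s ∈ stieltjesDomain μ := by
  rintro x rfl
  simp at hs

lemma norm_stieltjesKernel_le {s : ℂ} {δ : ℝ} (hδ : 0 < δ) {x : OnePoint ℝ}
    (hx : ∀ y : ℝ, x = (y : OnePoint ℝ) → δ ≤ ‖(y : ℂ) - s‖) : ‖stieltjesKernel s x‖ ≤ 1 / δ := by
  induction x using OnePoint.rec with
  | infty => rw [stieltjesKernel_infty, norm_zero]; positivity
  | coe x =>
    rw [stieltjesKernel_coe, norm_div, norm_one]
    exact one_div_le_one_div_of_le hδ (hx x rfl)

lemma integrable_stieltjesKernel {μ : Measure (OnePoint ℝ)} [IsFiniteMeasure μ] {s : ℂ}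
    (hs : s ∈ stieltjesDomain μ) : Integrable (stieltjesKernel s) μ := by
  obtain ⟨δ, hδ, h⟩ := mem_stieltjesDomain_iff_gap.1 hs
  refine Integrable.of_bound (measurable_stieltjesKernel s).aestronglyMeasurable (1 / δ) ?_
  filter_upwards [h] with x hx using norm_stieltjesKernel_le hδ hx

lemma hasDerivAt_stieltjesKernel {s : ℂ} {x : OnePoint ℝ}
    (hx : ∀ y : ℝ, x = (y : OnePoint ℝ) → (y : ℂ) - s ≠ 0) :
    HasDerivAt (fun s => stieltjesKernel s x) (stieltjesKernel s x ^ 2) s := by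
  induction x using OnePoint.rec with
  | infty => simpa [stieltjesKernel_infty] using hasDerivAt_const s (0 : ℂ)
  | coe x =>
    simp only [stieltjesKernel_coe, one_div]
    have := ((hasDerivAt_id s).const_sub (x : ℂ)).fun_inv (hx x rfl)
    convert! this using 1
    field_simp
    simp

/-- Differentiation under the integral: on the ball of radius `δ/2` around `s` half of the gap `δ`
survives, so the derivative of the kernel is dominated by a constant. -/
lemma hasDerivAt_stieltjes {μ : Measure (OnePoint ℝ)} [IsFiniteMeasure μ] {s : ℂ}
    (hs : s ∈ stieltjesDomain μ) :
    HasDerivAt (stieltjes μ) (∫ x, stieltjesKernel s x ^ 2 ∂μ) s := by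
  obtain ⟨δ, hδ, h⟩ := mem_stieltjesDomain_iff_gap.1 hs
  refine (hasDerivAt_integral_of_dominated_loc_of_deriv_le
    (F' := fun s x => stieltjesKernel s x ^ 2) (bound := fun _ => (1 / (δ / 2)) ^ 2)
    (Metric.ball_mem_nhds s (half_pos hδ)) ?_ (integrable_stieltjesKernel hs) ?_ ?_ ?_ ?_).2
  · exact Eventually.of_forall fun s => (measurable_stieltjesKernel s).aestronglyMeasurable
  · exact ((measurable_stieltjesKernel s).pow_const 2).aestronglyMeasurable
  · filter_upwards [h] with x hx s' hs'
    rw [norm_pow]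
    refine pow_le_pow_left₀ (norm_nonneg _) (norm_stieltjesKernel_le (half_pos hδ) ?_) 2
    intro y hy
    rw [mem_ball_iff_norm] at hs'
    have h1 := hx y hy
    have h2 : ‖(y : ℂ) - s‖ ≤ ‖(y : ℂ) - s'‖ + ‖s' - s‖ := by
      simpa using norm_add_le ((y : ℂ) - s') (s' - s)
    linarith
  · exact integrable_const _
  · filter_upwards [h] with x hx s' hs'
    refine hasDerivAt_stieltjesKernel fun y hy h0 => ?_
    rw [mem_ball_iff_norm] at hs'
    have h1 := hx y hy
    have h2 : ‖(y : ℂ) - s‖ ≤ ‖(y : ℂ) - s'‖ + ‖s' - s‖ := by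
      simpa using norm_add_le ((y : ℂ) - s') (s' - s)
    rw [h0, norm_zero] at h2
    linarith

lemma analyticOnNhd_stieltjes (μ : Measure (OnePoint ℝ)) [IsFiniteMeasure μ] :
    AnalyticOnNhd ℂ (stieltjes μ) (stieltjesDomain μ) :=
  DifferentiableOn.analyticOnNhd
    (fun _ hs => (hasDerivAt_stieltjes hs).differentiableAt.differentiableWithinAt)
    (isOpen_stieltjesDomain μ)

/-! ### Inversion of a law and its effect on the R-transform. -/

instance isProbabilityMeasure_invLaw (μ : Measure (OnePoint ℝ)) [IsProbabilityMeasure μ] :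
    IsProbabilityMeasure (invLaw μ) :=
  Measure.isProbabilityMeasure_map continuous_invPt.measurable.aemeasurable

lemma invPt_invPt (x : OnePoint ℝ) : invPt (invPt x) = x := by
  induction x using OnePoint.rec with
  | infty => rw [invPt_infty, invPt_zero]
  | coe x =>
    by_cases hx : x = 0
    · rw [hx, invPt_zero, invPt_infty]
    · rw [invPt_coe hx, invPt_coe (inv_ne_zero hx), inv_inv]

lemma invLaw_invLaw (μ : Measure (OnePoint ℝ)) : invLaw (invLaw μ) = μ := by
  rw [invLaw, invLaw, Measure.map_map continuous_invPt.measurable continuous_invPt.measurable,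
    show invPt ∘ invPt = id from funext invPt_invPt, Measure.map_id]

/-- Partial fractions for `1/(1/x - 1/s)`. The conventions at `0` and `∞` are those for which the
identity persists: both sides are `-s` at `x = ∞` and `0` at `x = 0`. -/
lemma stieltjesKernel_inv_invPt {s : ℂ} (hs : s ≠ 0) {x : OnePoint ℝ}
    (hx : ∀ y : ℝ, x = (y : OnePoint ℝ) → (y : ℂ) - s ≠ 0) :
    stieltjesKernel s⁻¹ (invPt x) = -s - s ^ 2 * stieltjesKernel s x := by
  induction x using OnePoint.rec with
  | infty =>
    rw [invPt_infty, stieltjesKernel_infty, stieltjesKernel_coe]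
    simp
  | coe x =>
    by_cases h0 : x = 0
    · rw [h0, invPt_zero, stieltjesKernel_infty, stieltjesKernel_coe, Complex.ofReal_zero,
        zero_sub, div_neg, one_div]
      field_simp
      ring
    · have h0' : (x : ℂ) ≠ 0 := by exact_mod_cast h0
      have hxs := hx x rfl
      have hxs' : s - (x : ℂ) ≠ 0 := fun h => hxs (by linear_combination -h)
      rw [invPt_coe h0, stieltjesKernel_coe, stieltjesKernel_coe]
      push_cast
      have : (x : ℂ)⁻¹ - s⁻¹ = (s - x) / (x * s) := by field_simp
      rw [this]
      field_simp
      ring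

/-- The Stieltjes transform of `X⁻¹` at `1 / s` in terms of that of `X` at `s`. -/
lemma stieltjes_invLaw_inv (μ : Measure (OnePoint ℝ)) [IsProbabilityMeasure μ] {s : ℂ} (h0 : s ≠ 0)
    (hs : s ∈ stieltjesDomain μ) :
    stieltjes (invLaw μ) s⁻¹ = -s - s ^ 2 * stieltjes μ s := by
  rw [stieltjes, invLaw, integral_map continuous_invPt.measurable.aemeasurable
    (measurable_stieltjesKernel _).aestronglyMeasurable]
  obtain ⟨δ, hδ, h⟩ := mem_stieltjesDomain_iff_gap.1 hs
  have : (fun x => stieltjesKernel s⁻¹ (invPt x)) =ᵐ[μ]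
      fun x => -s - s ^ 2 * stieltjesKernel s x := by
    filter_upwards [h] with x hx
    refine stieltjesKernel_inv_invPt h0 fun y hy h0 => ?_
    have := hx y hy
    rw [h0, norm_zero] at this
    linarith
  rw [integral_congr_ae this, integral_sub (integrable_const _)
    ((integrable_stieltjesKernel hs).const_mul _), integral_const, integral_const_mul, stieltjes]
  simp

/-- Inversion is a homeomorphic involution, so null neighbourhoods pull back to null neighbourhoods.
-/
lemma inv_mem_stieltjesDomain_invLaw {μ : Measure (OnePoint ℝ)} {s : ℂ} (h0 : s ≠ 0)
    (hs : s ∈ stieltjesDomain μ) : s⁻¹ ∈ stieltjesDomain (invLaw μ) := by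
  intro x hx
  have hx0 : x ≠ 0 := by
    rintro rfl
    exact inv_ne_zero h0 (by simpa using hx.symm)
  have h := hs x⁻¹ (by push_cast; rw [hx, inv_inv])
  rw [Measure.notMem_support_iff_exists] at h ⊢
  obtain ⟨U, hU, hμ⟩ := h
  refine ⟨invPt ⁻¹' U, continuous_invPt.continuousAt.preimage_mem_nhds
    (by rwa [invPt_coe hx0]), ?_⟩
  have he : MeasurableEmbedding invPt :=
    (MeasurableEquiv.mk (Equiv.mk invPt invPt invPt_invPt invPt_invPt)
      continuous_invPt.measurable continuous_invPt.measurable).measurableEmbedding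
  rw [invLaw, he.map_apply, ← Set.preimage_comp,
    show invPt ∘ invPt = id from funext invPt_invPt, Set.preimage_id, hμ]

lemma rTransform_of_mem {μ : Measure (OnePoint ℝ)} {U : Set ℂ} (hU : IsBranch μ U) {s : ℂ}
    (hs : s ∈ U) : rTransform μ U (-stieltjes μ s) = s + 1 / stieltjes μ s := by
  rw [rTransform, neg_neg, hU.2.leftInvOn_invFunOn hs, div_neg, sub_neg_eq_add]

/-- The R-transform of the inverse of a random variable. -/
theorem one_div_rTransform (μ : Measure (OnePoint ℝ)) [IsProbabilityMeasure μ] {U V : Set ℂ}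
    (hU : IsBranch μ U) (hV : IsBranch (invLaw μ) V) {w : ℂ} (hw : w ∈ rDomain μ U) (hw0 : w ≠ 0)
    (hR : rTransform μ U w ≠ 0) (hR1 : 1 + w * rTransform μ U w ≠ 0)
    (hmem : (rTransform μ U w + 1 / w)⁻¹ ∈ V) :
    1 / rTransform μ U w =
      rTransform (invLaw μ) V (-rTransform μ U w * (1 + w * rTransform μ U w)) := by
  obtain ⟨s, hs, hsw⟩ := hw
  have hw' : w = -stieltjes μ s := by rw [hsw, neg_neg]
  have hRs : rTransform μ U w = s - 1 / w := by
    rw [hw', rTransform_of_mem hU hs]; rw [div_neg, sub_neg_eq_add]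
  rw [hRs] at hR hR1 hmem ⊢
  -- The hypothesis `1 + wR ≠ 0` says precisely that `s ≠ 0`.
  have e1 : 1 + w * (s - 1 / w) = w * s := by field_simp; ring
  rw [e1] at hR1 ⊢
  have hs0 : s ≠ 0 := right_ne_zero_of_mul hR1
  rw [sub_add_cancel] at hmem
  -- The argument of the second R-transform is minus a value of the transform of `X⁻¹` at `1/s ∈ V`,
  -- so the inverse function can be evaluated.
  have e2 : -(s - 1 / w) * (w * s) = -stieltjes (invLaw μ) s⁻¹ := by
    rw [stieltjes_invLaw_inv μ hs0 (hU.1 hs), hsw]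
    field_simp
    ring
  have e3 : -(s - 1 / w) * (w * s) ≠ 0 := mul_ne_zero (neg_ne_zero.2 hR) hR1
  rw [e2, rTransform_of_mem hV hmem, ← neg_neg (stieltjes (invLaw μ) s⁻¹), ← e2]
  have e4 : s - 1 / w = (s * w - 1) / w := by field_simp
  rw [e4] at hR ⊢
  have : s * w - 1 ≠ 0 := fun h => hR (by rw [h, zero_div])
  field_simp
  ring

/-! ### Nondegeneracy of Stieltjes transforms and existence of branches. -/

lemma im_stieltjesKernel (s : ℂ) (x : OnePoint ℝ) :
    (stieltjesKernel s x).im = s.im * ‖stieltjesKernel s x‖ ^ 2 := by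
  induction x using OnePoint.rec with
  | infty => simp [stieltjesKernel_infty]
  | coe x =>
    rw [stieltjesKernel_coe, one_div, Complex.inv_im, norm_inv, inv_pow, ← Complex.normSq_eq_norm_sq]
    simp [div_eq_mul_inv]

lemma im_stieltjes {μ : Measure (OnePoint ℝ)} [IsFiniteMeasure μ] {s : ℂ}
    (hs : s ∈ stieltjesDomain μ) :
    (stieltjes μ s).im = s.im * ∫ x, ‖stieltjesKernel s x‖ ^ 2 ∂μ := by
  have := integral_im (integrable_stieltjesKernel hs)
  simp only [RCLike.im_to_complex] at this
  rw [stieltjes, ← this, ← integral_const_mul]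
  simp only [im_stieltjesKernel]

/-- The kernel vanishes only at `∞`, so a zero integral would put all the mass there. -/
lemma integral_norm_sq_stieltjesKernel_pos {μ : Measure (OnePoint ℝ)} [IsProbabilityMeasure μ]
    (hμ : μ ≠ Measure.dirac OnePoint.infty) {s : ℂ} (hs : s ∈ stieltjesDomain μ) :
    0 < ∫ x, ‖stieltjesKernel s x‖ ^ 2 ∂μ := by
  obtain ⟨δ, hδ, hgap⟩ := mem_stieltjesDomain_iff_gap.1 hs
  have hintg : Integrable (fun x => ‖stieltjesKernel s x‖ ^ 2) μ := by
    refine Integrable.of_bound ((measurable_stieltjesKernel s).norm.pow_const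
      2).aestronglyMeasurable ((1 / δ) ^ 2) ?_
    filter_upwards [hgap] with x hx
    rw [norm_pow, norm_norm]
    exact pow_le_pow_left₀ (norm_nonneg _) (norm_stieltjesKernel_le hδ hx) 2
  refine lt_of_le_of_ne (integral_nonneg fun x => by positivity) fun h0 => hμ ?_
  rw [eq_comm, integral_eq_zero_iff_of_nonneg (fun x => by positivity) hintg] at h0
  have hinf : ∀ᵐ x ∂μ, x = OnePoint.infty := by
    filter_upwards [h0, hgap] with x hx hx'
    induction x using OnePoint.rec with
    | infty => rfl
    | coe x =>
      exfalso
      simp only [stieltjesKernel_coe, Pi.zero_apply, ne_eq, OfNat.ofNat_ne_zero, not_false_eq_true,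
        pow_eq_zero_iff, norm_eq_zero, one_div, inv_eq_zero] at hx
      have h2 := hx' x rfl
      rw [hx, norm_zero] at h2
      exact h2.not_gt hδ
  have h1 : μ.map id = μ.map (fun _ => OnePoint.infty) := Measure.map_congr hinf
  rwa [Measure.map_id, Measure.map_const, measure_univ, one_smul] at h1

lemma stieltjes_ne_zero {μ : Measure (OnePoint ℝ)} [IsProbabilityMeasure μ]
    (hμ : μ ≠ Measure.dirac OnePoint.infty) {s : ℂ} (hs : s.im ≠ 0) : stieltjes μ s ≠ 0 := by
  intro h
  have hs' := mem_stieltjesDomain_of_im_ne_zero μ hs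
  have := im_stieltjes hs'
  rw [h, Complex.zero_im, zero_eq_mul] at this
  exact this.elim hs (integral_norm_sq_stieltjesKernel_pos hμ hs').ne'

lemma norm_stieltjes_le (μ : Measure (OnePoint ℝ)) [IsProbabilityMeasure μ] {s : ℂ}
    (hs : s.im ≠ 0) : ‖stieltjes μ s‖ ≤ 1 / |s.im| := by
  refine (norm_integral_le_of_norm_le_const (C := 1 / |s.im|)
    (Eventually.of_forall fun x => norm_stieltjesKernel_le (abs_pos.2 hs) fun y _ => ?_)).trans ?_
  · simpa using Complex.abs_im_le_norm ((y : ℂ) - s)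
  · simp

/-- Otherwise the transform is constant on a half-plane, and the bound `1/|Im s|` makes the constant
zero. The sign of `σ` selects the half-plane; both are needed because inversion exchanges them. -/
lemma exists_deriv_stieltjes_ne_zero {μ : Measure (OnePoint ℝ)} [IsProbabilityMeasure μ]
    (hμ : μ ≠ Measure.dirac OnePoint.infty) {σ : ℝ} (hσ : σ ≠ 0) :
    ∃ s : ℂ, 0 < σ * s.im ∧ deriv (stieltjes μ) s ≠ 0 := by
  by_contra! h
  have him : ∀ {s : ℂ}, 0 < σ * s.im → s.im ≠ 0 := fun hs h0 => by simp [h0] at hs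
  have hconv : Convex ℝ {s : ℂ | 0 < σ * s.im} :=
    convex_halfSpace_gt (f := fun s : ℂ => σ * s.im)
      ⟨fun x y => by simp [mul_add], fun c x => by simp; ring⟩ 0
  have hopen : IsOpen {s : ℂ | 0 < σ * s.im} :=
    isOpen_lt continuous_const (continuous_const.mul Complex.continuous_im)
  have hconst : ∀ y : ℝ, 1 ≤ y → stieltjes μ (σ * y * Complex.I) = stieltjes μ (σ * Complex.I) := by
    intro y hy
    refine hopen.is_const_of_deriv_eq_zero hconv.isPreconnected
      (fun s hs => (hasDerivAt_stieltjes (mem_stieltjesDomain_of_im_ne_zero μ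
        (him hs))).differentiableAt.differentiableWithinAt) (fun s hs => h s hs) ?_ ?_
    · have : 0 < σ * σ * y := mul_pos (mul_self_pos.2 hσ) (by linarith)
      simpa [← mul_assoc] using this
    · simpa using mul_self_pos.2 hσ
  have hne := stieltjes_ne_zero hμ (s := σ * Complex.I) (by simpa using hσ)
  have hlim : Tendsto (fun y : ℝ => 1 / (|σ| * y)) atTop (𝓝 0) :=
    tendsto_const_nhds.div_atTop (tendsto_id.const_mul_atTop (abs_pos.2 hσ))
  refine hne (norm_le_zero_iff.1 (ge_of_tendsto hlim ?_))
  filter_upwards [eventually_ge_atTop 1] with y hy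
  rw [← hconst y hy]
  have hy0 : 0 < y := by linarith
  refine (norm_stieltjes_le μ ?_).trans_eq ?_
  · simpa using ⟨hσ, hy0.ne'⟩
  · simp [abs_mul, abs_of_pos hy0]

lemma exists_injOn_of_deriv_ne_zero {f : ℂ → ℂ} {s : ℂ} (hf : AnalyticAt ℂ f s)
    (h : deriv f s ≠ 0) : ∃ U ∈ 𝓝 s, Set.InjOn f U := by
  have hs := hf.hasStrictDerivAt
  refine ⟨_, hs.eventually_left_inverse h, fun x hx y hy hxy => ?_⟩
  rw [← show _ = x from hx, ← show _ = y from hy, hxy]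

lemma invLaw_ne_dirac_infty {μ : Measure (OnePoint ℝ)}
    (hμ : μ ≠ Measure.dirac ((0 : ℝ) : OnePoint ℝ)) :
    invLaw μ ≠ Measure.dirac OnePoint.infty := by
  intro h
  apply hμ
  rw [← invLaw_invLaw μ, h, invLaw, Measure.map_dirac' continuous_invPt.measurable, invPt_infty]

/-- Both R-transforms in `one_div_rTransform` exist on a common open set. -/
theorem exists_isBranch (μ : Measure (OnePoint ℝ)) [IsProbabilityMeasure μ]
    (h0 : μ ≠ Measure.dirac ((0 : ℝ) : OnePoint ℝ)) (hinf : μ ≠ Measure.dirac OnePoint.infty) :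
    ∃ U : Set ℂ, IsOpen U ∧ U.Nonempty ∧ U ⊆ {s : ℂ | 0 < s.im} ∧
      IsBranch μ U ∧ IsBranch (invLaw μ) ((fun s : ℂ => s⁻¹) '' U) ∧
      ∀ w ∈ rDomain μ U, w ≠ 0 ∧ rTransform μ U w ≠ 0 ∧ 1 + w * rTransform μ U w ≠ 0 ∧
        (rTransform μ U w + 1 / w)⁻¹ ∈ (fun s : ℂ => s⁻¹) '' U := by
  have hinf' := invLaw_ne_dirac_infty h0
  have hne : ∀ {s : ℂ}, 0 < s.im → s ≠ 0 := by rintro s hs rfl; simp at hs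
  have hinv : ∀ {s : ℂ}, 0 < s.im → (s⁻¹).im < 0 := fun {s} hs => by
    rw [Complex.inv_im]
    exact div_neg_of_neg_of_pos (neg_neg_of_pos hs) (Complex.normSq_pos.2 (hne hs))
  have hopen : IsOpen {s : ℂ | 0 < s.im} := isOpen_lt continuous_const Complex.continuous_im
  have han1 : ∀ {s : ℂ}, 0 < s.im → AnalyticAt ℂ (stieltjes μ) s := fun hs =>
    analyticOnNhd_stieltjes μ _ (mem_stieltjesDomain_of_im_ne_zero μ hs.ne')
  have han2 : ∀ {s : ℂ}, 0 < s.im → AnalyticAt ℂ (stieltjes (invLaw μ)) s⁻¹ := fun hs =>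
    analyticOnNhd_stieltjes _ _ (mem_stieltjesDomain_of_im_ne_zero _ (hinv hs).ne)
  obtain ⟨s, hs, hs1, hs2⟩ : ∃ s : ℂ, 0 < s.im ∧ deriv (stieltjes μ) s ≠ 0 ∧
      deriv (stieltjes (invLaw μ)) s⁻¹ ≠ 0 := by
    by_contra! hcon
    have hpre : IsPreconnected {s : ℂ | 0 < s.im} := (convex_halfSpace_im_gt 0).isPreconnected
    -- If the two derivatives had no common point of nonvanishing, their product would vanish on a
    -- connected set, so one factor would vanish identically.
    rcases AnalyticOnNhd.eq_zero_or_eq_zero_of_mul_eq_zero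
      (f := deriv (stieltjes μ)) (g := fun s => deriv (stieltjes (invLaw μ)) s⁻¹)
      (U := {s : ℂ | 0 < s.im}) (fun s hs => (han1 hs).deriv)
      (fun s hs => ((han2 hs).deriv).comp_of_eq (analyticAt_id.inv (hne hs)) rfl)
      (fun s hs => by
        by_cases h : deriv (stieltjes μ) s = 0
        · rw [h, zero_mul]
        · rw [hcon s hs h, mul_zero]) hpre with h | h
    · obtain ⟨s, hs, hs'⟩ := exists_deriv_stieltjes_ne_zero hinf (σ := 1) one_ne_zero
      exact hs' (h s (by simpa using hs))
    · obtain ⟨s, hs, hs'⟩ := exists_deriv_stieltjes_ne_zero hinf' (σ := -1) (by norm_num)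
      have hs0 : s ≠ 0 := by rintro rfl; simp at hs
      have hmem : 0 < (s⁻¹).im := by
        rw [Complex.inv_im]
        exact div_pos (by linarith) (Complex.normSq_pos.2 hs0)
      exact hs' (by simpa using h s⁻¹ hmem)
  obtain ⟨U₁, hU₁, hi₁⟩ := exists_injOn_of_deriv_ne_zero (han1 hs) hs1
  obtain ⟨U₂, hU₂, hi₂⟩ := exists_injOn_of_deriv_ne_zero (han2 hs) hs2
  have hU₂' : (fun s : ℂ => s⁻¹) ⁻¹' U₂ ∈ 𝓝 s := (continuousAt_inv₀ (hne hs)) hU₂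
  obtain ⟨U, hU, hUo, hsU⟩ := mem_nhds_iff.1
    (inter_mem (inter_mem hU₁ hU₂') (hopen.mem_nhds hs))
  have hb : IsBranch μ U := ⟨fun s hs => mem_stieltjesDomain_of_im_ne_zero μ (hU hs).2.ne',
    hi₁.mono fun s hs => (hU hs).1.1⟩
  refine ⟨U, hUo, ⟨s, hsU⟩, fun s hs => (hU hs).2, hb, ⟨?_, ?_⟩, ?_⟩
  · rintro _ ⟨s, hs, rfl⟩
    exact mem_stieltjesDomain_of_im_ne_zero _ (hinv (hU hs).2).ne
  · refine hi₂.mono ?_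
    rintro _ ⟨s, hs, rfl⟩
    exact (hU hs).1.2
  · rintro w ⟨s, hs, hsw⟩
    have hs' : 0 < s.im := (hU hs).2
    have hw : w = -stieltjes μ s := by rw [hsw, neg_neg]
    have hm := stieltjes_ne_zero hinf hs'.ne'
    have hm' := stieltjes_ne_zero hinf' (hinv hs').ne
    rw [stieltjes_invLaw_inv μ (hne hs') (hb.1 hs)] at hm'
    have hR : rTransform μ U w = s + 1 / stieltjes μ s := by rw [hw, rTransform_of_mem hb hs]
    rw [hR, hw]
    refine ⟨neg_ne_zero.2 hm, fun h => hm' ?_, ?_, s, hs, ?_⟩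
    -- `R = 0` would force `m_{X⁻¹}(1/s) = -s (1 + s m_X(s)) = 0`, impossible off the real axis.
    · have : s * stieltjes μ s + 1 = 0 := by
        field_simp at h
        linear_combination h
      linear_combination (-s) * this
    · have : 1 + -stieltjes μ s * (s + 1 / stieltjes μ s) = -(stieltjes μ s * s) := by
        field_simp
        ring
      rw [this]
      exact neg_ne_zero.2 (mul_ne_zero hm (hne hs'))
    · simp [div_neg]

/-! ### Resolvents of positive semidefinite matrices and rank one perturbations. -/

section MatrixResolvent

open Matrix
open scoped ComplexOrder

variable {k : ℕ}

/-- The quadratic form `h† A h`. -/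
def quadForm (A : Matrix (Fin k) (Fin k) ℂ) (h : Fin k → ℂ) : ℂ := star h ⬝ᵥ (A *ᵥ h)

/-- The squared Euclidean norm. -/
def normSqVec (y : Fin k → ℂ) : ℝ := ∑ i, ‖y i‖ ^ 2

/-- The resolvent `(W - t)⁻¹`. -/
def green (W : Matrix (Fin k) (Fin k) ℂ) (t : ℂ) : Matrix (Fin k) (Fin k) ℂ := (W - t • 1)⁻¹

lemma normSqVec_nonneg (y : Fin k → ℂ) : 0 ≤ normSqVec y :=
  Finset.sum_nonneg fun _ _ => by positivity

lemma star_dotProduct_self_eq_normSqVec (y : Fin k → ℂ) : star y ⬝ᵥ y = (normSqVec y : ℂ) := by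
  simp [dotProduct, normSqVec, Complex.conj_mul']

/-- The arithmetic-mean form of Cauchy–Schwarz loses nothing in its application, where both vectors
have the same norm. -/
lemma norm_star_dotProduct_le (a b : Fin k → ℂ) :
    ‖star a ⬝ᵥ b‖ ≤ (normSqVec a + normSqVec b) / 2 := by
  refine (norm_sum_le _ _).trans ?_
  rw [normSqVec, normSqVec, ← Finset.sum_add_distrib, Finset.sum_div]
  refine Finset.sum_le_sum fun i _ => ?_
  rw [Pi.star_apply, norm_mul, norm_star]
  nlinarith [sq_nonneg (‖a i‖ - ‖b i‖)]

lemma star_mulVec_dotProduct (A : Matrix (Fin k) (Fin k) ℂ) (a b : Fin k → ℂ) :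
    star (A *ᵥ a) ⬝ᵥ b = star a ⬝ᵥ (Aᴴ *ᵥ b) := by
  rw [star_mulVec, dotProduct_mulVec]

/-- A kernel vector `v` would satisfy `v†Wv = t v†v` with `v†Wv` real. -/
lemma isUnit_det_sub_smul_one {W : Matrix (Fin k) (Fin k) ℂ} (hW : W.IsHermitian) {t : ℂ}
    (ht : t.im ≠ 0) : IsUnit (W - t • (1 : Matrix (Fin k) (Fin k) ℂ)).det := by
  rw [isUnit_iff_ne_zero]
  intro h
  obtain ⟨v, hv, h0⟩ := Matrix.exists_mulVec_eq_zero_iff.2 h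
  rw [sub_mulVec, smul_mulVec, one_mulVec, sub_eq_zero] at h0
  have h1 := hW.im_star_dotProduct_mulVec_self v
  rw [h0, dotProduct_smul, star_dotProduct_self_eq_normSqVec] at h1
  simp only [smul_eq_mul, RCLike.im_to_complex, Complex.mul_im, Complex.ofReal_im, mul_zero,
    Complex.ofReal_re, zero_add, mul_eq_zero, ht, false_or] at h1
  rw [normSqVec, Finset.sum_eq_zero_iff_of_nonneg fun _ _ => by positivity] at h1
  exact hv (funext fun i => by simpa using h1 i (Finset.mem_univ i))

lemma sub_mul_green {W : Matrix (Fin k) (Fin k) ℂ} (hW : W.IsHermitian) {t : ℂ}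
    (ht : t.im ≠ 0) : (W - t • 1) * green W t = 1 :=
  Matrix.mul_nonsing_inv _ (isUnit_det_sub_smul_one hW ht)

lemma green_mul_sub {W : Matrix (Fin k) (Fin k) ℂ} (hW : W.IsHermitian) {t : ℂ}
    (ht : t.im ≠ 0) : green W t * (W - t • 1) = 1 :=
  Matrix.nonsing_inv_mul _ (isUnit_det_sub_smul_one hW ht)

lemma conjTranspose_green {W : Matrix (Fin k) (Fin k) ℂ} (hW : W.IsHermitian) (t : ℂ) :
    (green W t)ᴴ = green W (star t) := by
  rw [green, conjTranspose_nonsing_inv, conjTranspose_sub, hW.eq, conjTranspose_smul,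
    conjTranspose_one, green]

/-- With `y = G h` one has `h = (W - t) y`, hence `h†Gh = y†(W - t̄)y`; the sign information on
`h†Gh` is read off from this form. -/
lemma quadForm_green {W : Matrix (Fin k) (Fin k) ℂ} (hW : W.IsHermitian) {t : ℂ}
    (ht : t.im ≠ 0) (h : Fin k → ℂ) :
    quadForm (green W t) h =
      quadForm W (green W t *ᵥ h) - star t * (normSqVec (green W t *ᵥ h) : ℂ) := by
  set y := green W t *ᵥ h with hy
  have h1 : h = (W - t • 1) *ᵥ y := by rw [hy, mulVec_mulVec, sub_mul_green hW ht, one_mulVec]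
  rw [quadForm, ← hy]
  nth_rw 1 [h1]
  rw [star_mulVec_dotProduct, conjTranspose_sub, hW.eq, conjTranspose_smul, conjTranspose_one,
    sub_mulVec, smul_mulVec, one_mulVec, dotProduct_sub, dotProduct_smul,
    star_dotProduct_self_eq_normSqVec, smul_eq_mul, quadForm]

lemma im_quadForm_green {W : Matrix (Fin k) (Fin k) ℂ} (hW : W.IsHermitian) {t : ℂ}
    (ht : t.im ≠ 0) (h : Fin k → ℂ) :
    (quadForm (green W t) h).im = t.im * normSqVec (green W t *ᵥ h) := by
  have h1 := hW.im_star_dotProduct_mulVec_self (green W t *ᵥ h)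
  rw [RCLike.im_to_complex] at h1
  rw [quadForm_green hW ht, Complex.sub_im, quadForm, h1]
  simp

/-- Here `t h†Gh = t y†Wy - |t|²‖y‖²` with `y = G h`, and `y†Wy ≥ 0`. This is the place where
positivity, beyond self-adjointness, enters. -/
lemma im_mul_quadForm_green_nonneg {W : Matrix (Fin k) (Fin k) ℂ} (hW : W.PosSemidef) {t : ℂ}
    (ht : 0 < t.im) (h : Fin k → ℂ) : 0 ≤ (t * quadForm (green W t) h).im := by
  have h1 := hW.isHermitian.im_star_dotProduct_mulVec_self (green W t *ᵥ h)
  have h2 := hW.re_dotProduct_nonneg (green W t *ᵥ h)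
  rw [RCLike.im_to_complex] at h1
  rw [RCLike.re_to_complex] at h2
  have h3 : t * quadForm (green W t) h = t * quadForm W (green W t *ᵥ h) -
      ((Complex.normSq t * normSqVec (green W t *ᵥ h) : ℝ) : ℂ) := by
    rw [quadForm_green hW.isHermitian ht.ne']
    push_cast
    rw [← Complex.mul_conj]
    simp only [Complex.star_def]
    ring
  rw [h3, Complex.sub_im, Complex.ofReal_im, Complex.mul_im, quadForm, h1]
  simpa using mul_nonneg ht.le h2

/-- Both norms are determined by `Im h†Gh`, and passing to `t̄` conjugates `h†Gh`. -/
lemma normSqVec_green_star {W : Matrix (Fin k) (Fin k) ℂ} (hW : W.IsHermitian) {t : ℂ}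
    (ht : t.im ≠ 0) (h : Fin k → ℂ) :
    normSqVec (green W (star t) *ᵥ h) = normSqVec (green W t *ᵥ h) := by
  have h1 := im_quadForm_green hW ht h
  have h2 := im_quadForm_green hW (t := star t) (by simpa using ht) h
  have h3 : quadForm (green W (star t)) h = star (quadForm (green W t) h) := by
    rw [quadForm, quadForm, ← conjTranspose_green hW, ← star_mulVec_dotProduct, star_dotProduct]
  rw [h3] at h2
  rw [Complex.star_def, Complex.conj_im, Complex.conj_im, h1, neg_mul, neg_inj] at h2
  exact (mul_left_cancel₀ ht h2).symm

lemma norm_quadForm_green_mul_green_le {W : Matrix (Fin k) (Fin k) ℂ} (hW : W.IsHermitian) {t : ℂ}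
    (ht : t.im ≠ 0) (h : Fin k → ℂ) :
    ‖quadForm (green W t * green W t) h‖ ≤ normSqVec (green W t *ᵥ h) := by
  have : quadForm (green W t * green W t) h =
      star (green W (star t) *ᵥ h) ⬝ᵥ (green W t *ᵥ h) := by
    rw [star_mulVec_dotProduct, conjTranspose_green hW, star_star, mulVec_mulVec, quadForm]
  rw [this]
  refine (norm_star_dotProduct_le _ _).trans_eq ?_
  rw [normSqVec_green_star hW ht]
  ring

/-- Since `Im (t q) ≥ 0`, the imaginary part of `t (1 + q)` is at least `Im t`. This keeps the
denominators `1 + q` uniformly away from zero. -/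
lemma im_le_im_mul_one_add_quadForm {W : Matrix (Fin k) (Fin k) ℂ} (hW : W.PosSemidef) {t : ℂ}
    (ht : 0 < t.im) (h : Fin k → ℂ) : t.im ≤ ‖t‖ * ‖1 + quadForm (green W t) h‖ := by
  rw [← norm_mul]
  refine le_trans ?_ ((le_abs_self _).trans (Complex.abs_im_le_norm _))
  rw [mul_add, mul_one, Complex.add_im]
  linarith [im_mul_quadForm_green_nonneg hW ht h]

lemma one_add_quadForm_green_ne_zero {W : Matrix (Fin k) (Fin k) ℂ} (hW : W.PosSemidef) {t : ℂ}
    (ht : 0 < t.im) (h : Fin k → ℂ) : 1 + quadForm (green W t) h ≠ 0 := by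
  intro h0
  have := im_le_im_mul_one_add_quadForm hW ht h
  rw [h0, norm_zero, mul_zero] at this
  linarith

/-- The rank one perturbation `W + h h†`. -/
lemma posSemidef_add_vecMulVec {W : Matrix (Fin k) (Fin k) ℂ} (hW : W.PosSemidef)
    (h : Fin k → ℂ) : (W + vecMulVec h (star h)).PosSemidef :=
  hW.add (posSemidef_vecMulVec_self_star h)

/-- The Sherman–Morrison formula applied to `h`: `(W + hh† - t) G h = (1 + h†Gh) h`. -/
lemma green_add_vecMulVec_mulVec {W : Matrix (Fin k) (Fin k) ℂ} (hW : W.PosSemidef) {t : ℂ}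
    (ht : 0 < t.im) (h : Fin k → ℂ) :
    green (W + vecMulVec h (star h)) t *ᵥ h =
      (1 + quadForm (green W t) h)⁻¹ • (green W t *ᵥ h) := by
  have h1 : (W + vecMulVec h (star h) - t • 1) *ᵥ (green W t *ᵥ h) =
      (1 + quadForm (green W t) h) • h := by
    rw [add_sub_right_comm, add_mulVec, mulVec_mulVec, sub_mul_green hW.isHermitian ht.ne',
      one_mulVec, vecMulVec_mulVec, add_smul, one_smul, quadForm]
    simp
  have h2 := congrArg (green (W + vecMulVec h (star h)) t *ᵥ ·) h1
  beta_reduce at h2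
  rw [mulVec_mulVec, green_mul_sub (posSemidef_add_vecMulVec hW h).isHermitian ht.ne', one_mulVec,
    mulVec_smul] at h2
  rw [h2, smul_smul, inv_mul_cancel₀ (one_add_quadForm_green_ne_zero hW ht h), one_smul]

lemma quadForm_green_add_vecMulVec {W : Matrix (Fin k) (Fin k) ℂ} (hW : W.PosSemidef) {t : ℂ}
    (ht : 0 < t.im) (h : Fin k → ℂ) :
    quadForm (green (W + vecMulVec h (star h)) t) h =
      quadForm (green W t) h / (1 + quadForm (green W t) h) := by
  rw [quadForm, green_add_vecMulVec_mulVec hW ht, dotProduct_smul, smul_eq_mul, div_eq_inv_mul,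
    quadForm]

lemma trace_vecMulVec_star_mul (A : Matrix (Fin k) (Fin k) ℂ) (h : Fin k → ℂ) :
    (vecMulVec h (star h) * A).trace = quadForm A h := by
  rw [vecMulVec_mul, trace_vecMulVec, dotProduct_comm, quadForm, dotProduct_mulVec]

/-- The resolvent identity `G' - G = -G' h h† G`, with `G'h` taken from the previous formula. -/
lemma trace_green_add_vecMulVec_sub {W : Matrix (Fin k) (Fin k) ℂ} (hW : W.PosSemidef) {t : ℂ}
    (ht : 0 < t.im) (h : Fin k → ℂ) :
    (green (W + vecMulVec h (star h)) t).trace - (green W t).trace =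
      -(quadForm (green W t * green W t) h / (1 + quadForm (green W t) h)) := by
  have hW' := posSemidef_add_vecMulVec hW h
  have h1 : green (W + vecMulVec h (star h)) t - green W t =
      -(green (W + vecMulVec h (star h)) t * vecMulVec h (star h) * green W t) := by
    have e : vecMulVec h (star h) = (W + vecMulVec h (star h) - t • 1) - (W - t • 1) := by abel
    nth_rw 3 [e]
    rw [mul_sub, green_mul_sub hW'.isHermitian ht.ne', sub_mul, one_mul, mul_assoc,
      sub_mul_green hW.isHermitian ht.ne', mul_one, neg_sub]
  rw [← trace_sub, h1, trace_neg, mul_vecMulVec, green_add_vecMulVec_mulVec hW ht, vecMulVec_mul,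
    trace_vecMulVec, smul_dotProduct, dotProduct_comm, ← dotProduct_mulVec, mulVec_mulVec,
    smul_eq_mul, div_eq_inv_mul]
  rfl

/-- A rank one perturbation changes the trace of the resolvent by at most `1 / Im t`. -/
lemma norm_trace_green_add_vecMulVec_sub_le {W : Matrix (Fin k) (Fin k) ℂ} (hW : W.PosSemidef)
    {t : ℂ} (ht : 0 < t.im) (h : Fin k → ℂ) :
    ‖(green (W + vecMulVec h (star h)) t).trace - (green W t).trace‖ ≤ 1 / t.im := by
  rw [trace_green_add_vecMulVec_sub hW ht, norm_neg, norm_div]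
  have h0 := norm_pos_iff.2 (one_add_quadForm_green_ne_zero hW ht h)
  rw [div_le_div_iff₀ h0 ht, one_mul]
  have h1 := norm_quadForm_green_mul_green_le hW.isHermitian ht.ne' h
  have h2 := im_quadForm_green hW.isHermitian ht.ne' h
  have h3 : (quadForm (green W t) h).im ≤ ‖1 + quadForm (green W t) h‖ := by
    refine le_trans ?_ ((le_abs_self _).trans (Complex.abs_im_le_norm _))
    simp
  -- The chain is `Im t · |h†G²h| ≤ Im t · ‖Gh‖² = Im h†Gh ≤ |1 + h†Gh|`.
  nlinarith

lemma quadForm_single (A : Matrix (Fin k) (Fin k) ℂ) (j : Fin k) :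
    quadForm A (Pi.single j 1) = A j j := by
  rw [quadForm, mulVec_single_one, ← Pi.single_star, star_one, single_dotProduct]
  simp

lemma le_one_div_sq_of_mul_le {v S g : ℝ} (hv : 0 < v) (h1 : v * S ≤ g) (h2 : g ^ 2 ≤ S) :
    S ≤ 1 / v ^ 2 := by
  have hS : 0 ≤ S := (sq_nonneg g).trans h2
  rw [le_div_iff₀ (by positivity)]
  have h3 : (v * S) ^ 2 ≤ S := (pow_le_pow_left₀ (by positivity) h1 2).trans h2
  by_contra! h
  nlinarith

/-- A self-improving bound on `S = ‖G e_j‖²`: `Im t · S = Im G_jj ≤ |G_jj|`, while `|G_jj|² ≤ S`. No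
operator norm is needed. -/
lemma normSqVec_green_single_le {W : Matrix (Fin k) (Fin k) ℂ} (hW : W.IsHermitian) {t : ℂ}
    (ht : 0 < t.im) (j : Fin k) : ∑ i, ‖green W t i j‖ ^ 2 ≤ 1 / t.im ^ 2 := by
  have h1 := im_quadForm_green hW ht.ne' (Pi.single j 1)
  rw [quadForm_single, mulVec_single_one] at h1
  have h2 : normSqVec ((green W t).col j) = ∑ i, ‖green W t i j‖ ^ 2 := rfl
  rw [h2] at h1
  have h3 : ‖green W t j j‖ ^ 2 ≤ ∑ i, ‖green W t i j‖ ^ 2 :=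
    Finset.single_le_sum (f := fun i => ‖green W t i j‖ ^ 2) (fun i _ => by positivity)
      (Finset.mem_univ j)
  have h4 : (green W t j j).im ≤ ‖green W t j j‖ := (le_abs_self _).trans (Complex.abs_im_le_norm _)
  exact le_one_div_sq_of_mul_le ht (h1 ▸ h4) h3

lemma norm_green_diag_le {W : Matrix (Fin k) (Fin k) ℂ} (hW : W.IsHermitian) {t : ℂ}
    (ht : 0 < t.im) (j : Fin k) : ‖green W t j j‖ ≤ 1 / t.im := by
  refine (pow_le_pow_iff_left₀ (norm_nonneg _) (by positivity) two_ne_zero).1 ?_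
  rw [div_pow, one_pow]
  exact (Finset.single_le_sum (f := fun i => ‖green W t i j‖ ^ 2) (fun i _ => by positivity)
      (Finset.mem_univ j)).trans (normSqVec_green_single_le hW ht j)

lemma sum_norm_sq_green_le {W : Matrix (Fin k) (Fin k) ℂ} (hW : W.IsHermitian) {t : ℂ}
    (ht : 0 < t.im) : ∑ i, ∑ j, ‖green W t i j‖ ^ 2 ≤ k / t.im ^ 2 := by
  rw [Finset.sum_comm]
  refine (Finset.sum_le_sum fun j _ => normSqVec_green_single_le hW ht j).trans_eq ?_
  simp [div_eq_mul_inv]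

lemma norm_trace_green_le {W : Matrix (Fin k) (Fin k) ℂ} (hW : W.IsHermitian) {t : ℂ}
    (ht : 0 < t.im) : ‖(green W t).trace‖ ≤ k / t.im := by
  refine (norm_sum_le_of_le _ fun j _ => norm_green_diag_le hW ht j).trans_eq ?_
  simp [div_eq_mul_inv]

lemma im_trace_green_nonneg {W : Matrix (Fin k) (Fin k) ℂ} (hW : W.IsHermitian) {t : ℂ}
    (ht : 0 < t.im) : 0 ≤ (green W t).trace.im := by
  rw [trace, Complex.im_sum]
  refine Finset.sum_nonneg fun j _ => ?_
  rw [diag_apply, ← quadForm_single (green W t) j, im_quadForm_green hW ht.ne']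
  exact mul_nonneg ht.le (normSqVec_nonneg _)

lemma im_mul_trace_green_nonneg {W : Matrix (Fin k) (Fin k) ℂ} (hW : W.PosSemidef) {t : ℂ}
    (ht : 0 < t.im) : 0 ≤ (t * (green W t).trace).im := by
  rw [trace, Finset.mul_sum, Complex.im_sum]
  refine Finset.sum_nonneg fun j _ => ?_
  rw [diag_apply, ← quadForm_single (green W t) j]
  exact im_mul_quadForm_green_nonneg hW ht _

/-- The matrix `∑ xⱼ xⱼ†` formed from the columns `xⱼ`. -/
def colGram {n : ℕ} (x : Fin n → Fin k → ℂ) : Matrix (Fin k) (Fin k) ℂ :=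
  ∑ j, vecMulVec (x j) (star (x j))

lemma posSemidef_colGram {n : ℕ} (x : Fin n → Fin k → ℂ) : (colGram x).PosSemidef :=
  posSemidef_sum _ fun j _ => posSemidef_vecMulVec_self_star (x j)

lemma mul_conjTranspose_eq_colGram {n : ℕ} (H : Matrix (Fin k) (Fin n) ℂ) :
    H * Hᴴ = colGram fun j i => H i j := by
  ext a b
  simp [colGram, mul_apply, Matrix.sum_apply, vecMulVec_apply]

lemma colGram_succAbove {n : ℕ} (x : Fin (n + 1) → Fin k → ℂ) (j : Fin (n + 1)) :
    colGram x = colGram (fun i => x (j.succAbove i)) + vecMulVec (x j) (star (x j)) := by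
  rw [colGram, Fin.sum_univ_succAbove _ j, add_comm, colGram]

/-- The trace of `WG = 1 + tG` with `W = ∑ x_j x_j†` is a sum of `x_j†G x_j`; removing column `j`
turns each term into `q_j/(1 + q_j)`, where `q_j` involves a resolvent not containing `x_j`. -/
lemma add_trace_green_colGram {n : ℕ} (x : Fin (n + 1) → Fin k → ℂ) {t : ℂ} (ht : 0 < t.im) :
    (k : ℂ) + t * (green (colGram x) t).trace =
      ∑ j, quadForm (green (colGram fun i => x (j.succAbove i)) t) (x j) /
        (1 + quadForm (green (colGram fun i => x (j.succAbove i)) t) (x j)) := by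
  have h1 := sub_mul_green (posSemidef_colGram x).isHermitian ht.ne'
  rw [sub_mul, smul_mul_assoc, one_mul, sub_eq_iff_eq_add] at h1
  have h2 := congrArg trace h1
  rw [trace_add, trace_one, trace_smul, smul_eq_mul, Fintype.card_fin] at h2
  rw [← h2]
  nth_rw 1 [colGram]
  rw [Finset.sum_mul, trace_sum]
  refine Finset.sum_congr rfl fun j _ => ?_
  rw [trace_vecMulVec_star_mul, colGram_succAbove x j,
    quadForm_green_add_vecMulVec (posSemidef_colGram _) ht]

/-- The normalized trace of the resolvent almost satisfies a quadratic equation; the error is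
controlled by the deviations of the leave-one-out quadratic forms. -/
lemma norm_quadratic_trace_green_le {n : ℕ} (hk : k ≠ 0) (x : Fin (n + 1) → Fin k → ℂ) {t : ℂ}
    (ht : 0 < t.im) {c m : ℂ} (hc : c = (k : ℂ) / (n + 1))
    (hm : m = (green (colGram x) t).trace / k) :
    ‖c * t * m ^ 2 + (t + c - 1) * m + 1‖ ≤ ‖t‖ / (t.im * k) *
      ∑ j, ‖quadForm (green (colGram fun i => x (j.succAbove i)) t) (x j) - c * m‖ := by
  have hk' : (k : ℂ) ≠ 0 := by exact_mod_cast hk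
  have hn : ((n : ℂ) + 1) ≠ 0 := by exact_mod_cast n.succ_ne_zero
  set q : Fin (n + 1) → ℂ :=
    fun j => quadForm (green (colGram fun i => x (j.succAbove i)) t) (x j) with hq
  have hq1 : ∀ j, 1 + q j ≠ 0 := fun j =>
    one_add_quadForm_green_ne_zero (posSemidef_colGram _) ht _
  have h1 : (k : ℂ) + t * (k * m) = ∑ j, q j / (1 + q j) := by
    rw [hm, mul_div_cancel₀ _ hk']
    exact add_trace_green_colGram x ht
  -- An exact identity: `(q - cm)/(1 + q) = (1 + cm) q/(1 + q) - cm`, and summing gives `k(1 + cm)(1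
  -- + tm) - km` because `(n + 1)c = k`.
  have h2 : c * t * m ^ 2 + (t + c - 1) * m + 1 = (∑ j, (q j - c * m) / (1 + q j)) / k := by
    have e : ∀ j, (q j - c * m) / (1 + q j) = (1 + c * m) * (q j / (1 + q j)) - c * m := by
      intro j
      have := hq1 j
      field_simp
      ring
    simp only [e]
    rw [Finset.sum_sub_distrib, ← Finset.mul_sum, ← h1, Finset.sum_const, Finset.card_univ,
      Fintype.card_fin, hc]
    simp only [nsmul_eq_mul]
    push_cast
    field_simp
    ring
  have h5 : ‖t‖ / (t.im * k) * ∑ j, ‖q j - c * m‖ = (∑ j, ‖t‖ / t.im * ‖q j - c * m‖) / k := by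
    rw [← Finset.mul_sum]
    field_simp
  rw [h2, norm_div, Complex.norm_natCast, h5]
  refine div_le_div_of_nonneg_right ?_ (Nat.cast_nonneg k)
  refine norm_sum_le_of_le _ fun j _ => ?_
  rw [norm_div, div_le_iff₀ (norm_pos_iff.2 (hq1 j))]
  have h3 := im_le_im_mul_one_add_quadForm (posSemidef_colGram fun i => x (j.succAbove i)) ht (x j)
  have h4 : 1 ≤ ‖t‖ / t.im * ‖1 + q j‖ := by
    rw [div_mul_eq_mul_div, le_div_iff₀ ht, one_mul]
    exact h3
  calc ‖q j - c * m‖ = 1 * ‖q j - c * m‖ := (one_mul _).symm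
    _ ≤ ‖t‖ / t.im * ‖1 + q j‖ * ‖q j - c * m‖ := by gcongr
    _ = _ := by ring

/-- The normalized trace of the resolvent is the Stieltjes transform of the spectral
distribution. -/
lemma trace_green_eq_sum {W : Matrix (Fin k) (Fin k) ℂ} (hW : W.IsHermitian) {t : ℂ}
    (ht : t.im ≠ 0) : (green W t).trace = ∑ i, 1 / ((hW.eigenvalues i : ℂ) - t) := by
  have hne : ∀ i, (hW.eigenvalues i : ℂ) - t ≠ 0 := fun i h0 => ht (by
    simpa using congrArg Complex.im h0)
  set D : Matrix (Fin k) (Fin k) ℂ :=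
    Matrix.diagonal (fun i => 1 / ((hW.eigenvalues i : ℂ) - t)) with hD
  have hB : green W t = Unitary.conjStarAlgAut ℂ _ hW.eigenvectorUnitary D := by
    apply Matrix.inv_eq_right_inv
    have e : W - t • 1 = Unitary.conjStarAlgAut ℂ _ hW.eigenvectorUnitary
        (Matrix.diagonal (fun i => (hW.eigenvalues i : ℂ) - t)) := by
      have : Matrix.diagonal (fun i => (hW.eigenvalues i : ℂ) - t) =
          Matrix.diagonal (RCLike.ofReal ∘ hW.eigenvalues) -
            t • (1 : Matrix (Fin k) (Fin k) ℂ) := by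
        rw [← Matrix.diagonal_one, ← Matrix.diagonal_smul, Matrix.diagonal_sub]
        congr 1
        funext i
        simp
      rw [this, map_sub, map_smul, map_one, ← hW.spectral_theorem]
    rw [e, ← map_mul, hD, Matrix.diagonal_mul_diagonal]
    have : (fun i => ((hW.eigenvalues i : ℂ) - t) * (1 / ((hW.eigenvalues i : ℂ) - t))) =
        fun _ => (1 : ℂ) := funext fun i => mul_one_div_cancel (hne i)
    rw [this, Matrix.diagonal_one, map_one]
  rw [hB, Unitary.conjStarAlgAut_apply, Matrix.trace_mul_comm, ← mul_assoc]
  simp [hD, Matrix.trace_diagonal]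

end MatrixResolvent

/-! ### The bounded difference inequality. -/

lemma integral_pi_succ {E : Type*} [MeasurableSpace E] (μ : Measure E) [IsProbabilityMeasure μ]
    {n : ℕ} (i : Fin (n + 1)) {F : Type*} [NormedAddCommGroup F] [NormedSpace ℝ F]
    (f : (Fin (n + 1) → E) → F) :
    ∫ x, f x ∂(Measure.pi fun _ => μ) =
      ∫ p, f (i.insertNth p.1 p.2) ∂(μ.prod (Measure.pi fun _ : Fin n => μ)) := by
  have h := (measurePreserving_piFinSuccAbove (fun _ : Fin (n + 1) => μ) i).symm
  rw [← h.integral_comp (MeasurableEquiv.measurableEmbedding _)]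
  rfl

lemma measurable_insertNth {E : Type*} [MeasurableSpace E] {n : ℕ} (i : Fin (n + 1)) :
    Measurable fun p : E × (Fin n → E) => (i.insertNth p.1 p.2 : Fin (n + 1) → E) :=
  (MeasurableEquiv.piFinSuccAbove (fun _ : Fin (n + 1) => E) i).symm.measurable

/-- Induction on the number of coordinates. Let `g(a)` be the mean of `f` with first coordinate
frozen at `a`; then `f - E f = (f - g) + (g - E g)`, where Hoeffding's lemma handles the second
summand and the induction hypothesis the first. -/
lemma integral_exp_le_of_bounded_differences {E : Type*} [MeasurableSpace E] (μ : Measure E)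
    [IsProbabilityMeasure μ] (c B : ℝ) (n : ℕ) (f : (Fin n → E) → ℝ) (hf : Measurable f)
    (hB : ∀ x, |f x| ≤ B)
    (hc : ∀ i x y, (∀ j ≠ i, x j = y j) → |f x - f y| ≤ c) (r : ℝ) :
    ∫ x, Real.exp (r * (f x - ∫ y, f y ∂(Measure.pi fun _ => μ))) ∂(Measure.pi fun _ => μ) ≤
      Real.exp (n * c ^ 2 * r ^ 2 / 2) := by
  induction n with
  | zero =>
    have : ∀ x, f x = f default := fun x => congrArg f (Subsingleton.elim _ _)
    simp [this]
  | succ n ih =>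
    set π := (Measure.pi fun _ : Fin n => μ) with hπ
    obtain ⟨a₀⟩ : Nonempty E := nonempty_of_isProbabilityMeasure μ
    set F : E × (Fin n → E) → ℝ := fun p => f ((0 : Fin (n + 1)).insertNth p.1 p.2) with hF
    have hFm : Measurable F := hf.comp (measurable_insertNth 0)
    have hFi : Integrable F (μ.prod π) :=
      Integrable.of_bound hFm.aestronglyMeasurable B (Eventually.of_forall fun p => hB _)
    have hFa : ∀ a, Integrable (fun y => F (a, y)) π := fun a =>
      Integrable.of_bound (hFm.comp measurable_prodMk_left).aestronglyMeasurable B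
        (Eventually.of_forall fun p => hB _)
    set g : E → ℝ := fun a => ∫ y, F (a, y) ∂π with hg
    have hgm : Measurable g := (hFm.stronglyMeasurable.integral_prod_right').measurable
    have hgB : ∀ a, |g a| ≤ B := fun a => by
      have := norm_integral_le_of_norm_le_const (μ := π) (f := fun y => F (a, y)) (C := B)
        (Eventually.of_forall fun y => hB ((0 : Fin (n + 1)).insertNth a y))
      simpa using this
    have hgc : ∀ a b, |g a - g b| ≤ c := fun a b => by
      rw [hg, ← integral_sub (hFa a) (hFa b)]
      have := norm_integral_le_of_norm_le_const (μ := π) (f := fun y => F (a, y) - F (b, y))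
        (C := c) (Eventually.of_forall fun y => hc 0 _ _ fun j hj => ?_)
      · simpa using this
      · obtain ⟨k, rfl⟩ := Fin.exists_succAbove_eq hj
        simp
    have hintg : ∫ x, f x ∂(Measure.pi fun _ => μ) = ∫ a, g a ∂μ := by
      rw [integral_pi_succ μ 0, integral_prod _ hFi]
    have hexp : ∀ x : ℝ, |x| ≤ 2 * B → Real.exp (r * x) ≤ Real.exp (|r| * (2 * B)) := fun x hx =>
      Real.exp_le_exp.2 ((le_abs_self _).trans (by rw [abs_mul]; gcongr))
    -- An interval of length `2c` around an arbitrary value of `g` suffices; it gives `c²` per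
    -- coordinate rather than the sharp `c²/4`.
    have hG := hasSubgaussianMGF_of_mem_Icc (X := g) (μ := μ) (a := g a₀ - c) (b := g a₀ + c)
      hgm.aemeasurable (Eventually.of_forall fun a => by
        have := abs_le.1 (hgc a a₀)
        exact ⟨by linarith, by linarith⟩)
    have hc0 : 0 ≤ c := (abs_nonneg _).trans (hgc a₀ a₀)
    have hG' : ∫ a, Real.exp (r * (g a - ∫ b, g b ∂μ)) ∂μ ≤ Real.exp (c ^ 2 * r ^ 2 / 2) := by
      have := hG.mgf_le r
      rw [mgf] at this
      refine this.trans_eq ?_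
      congr 3
      push_cast
      rw [show g a₀ + c - (g a₀ - c) = 2 * c by ring, Real.norm_of_nonneg (by linarith)]
      ring
    have hbF : ∀ a, ∫ y, Real.exp (r * (F (a, y) - g a)) ∂π ≤ Real.exp (n * c ^ 2 * r ^ 2 / 2) :=
      fun a => ih (fun y => F (a, y)) (hFm.comp measurable_prodMk_left) (fun y => hB _)
        fun i x y hxy => hc i.succ _ _ fun j hj => by
          refine Fin.cases ?_ (fun k hk => ?_) j hj
          · intro _; simp
          · have : k ≠ i := fun h => hk (h ▸ rfl)
            simp [hxy k this]
    have hsplit : ∀ a y, Real.exp (r * (F (a, y) - ∫ b, g b ∂μ)) =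
        Real.exp (r * (g a - ∫ b, g b ∂μ)) * Real.exp (r * (F (a, y) - g a)) := fun a y => by
      rw [← Real.exp_add]
      ring_nf
    have hgint : |∫ b, g b ∂μ| ≤ B := by
      have := norm_integral_le_of_norm_le_const (μ := μ) (f := g) (C := B)
        (Eventually.of_forall hgB)
      simpa using this
    rw [hintg, integral_pi_succ μ 0]
    change ∫ p, Real.exp (r * (F p - ∫ b, g b ∂μ)) ∂(μ.prod π) ≤ _
    rw [integral_prod]
    swap
    · refine Integrable.of_bound (by fun_prop) (Real.exp (|r| * (2 * B)))
        (Eventually.of_forall fun p => ?_)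
      rw [Real.norm_of_nonneg (Real.exp_nonneg _)]
      refine hexp _ ((abs_sub _ _).trans ?_)
      linarith [hB ((0 : Fin (n + 1)).insertNth p.1 p.2)]
    simp only [hsplit, integral_const_mul]
    calc ∫ a, Real.exp (r * (g a - ∫ b, g b ∂μ)) * ∫ y, Real.exp (r * (F (a, y) - g a)) ∂π ∂μ
        ≤ ∫ a, Real.exp (r * (g a - ∫ b, g b ∂μ)) * Real.exp (n * c ^ 2 * r ^ 2 / 2) ∂μ := by
          refine integral_mono_of_nonneg (Eventually.of_forall fun a => ?_)
            ((hG.integrable_exp_mul r).mul_const _) (Eventually.of_forall fun a => ?_)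
          · exact mul_nonneg (Real.exp_nonneg _) (integral_nonneg fun y => Real.exp_nonneg _)
          · exact mul_le_mul_of_nonneg_left (hbF a) (Real.exp_nonneg _)
      _ ≤ Real.exp (c ^ 2 * r ^ 2 / 2) * Real.exp (n * c ^ 2 * r ^ 2 / 2) := by
          rw [integral_mul_const]
          gcongr
      _ = _ := by
          rw [← Real.exp_add]
          push_cast
          ring_nf

/-- The bounded difference inequality. -/
theorem measureReal_abs_sub_integral_ge_le {E : Type*} [MeasurableSpace E] (μ : Measure E)
    [IsProbabilityMeasure μ] {c B : ℝ} {n : ℕ} {f : (Fin n → E) → ℝ} (hf : Measurable f)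
    (hB : ∀ x, |f x| ≤ B) (hc0 : 0 ≤ c)
    (hc : ∀ i x y, (∀ j ≠ i, x j = y j) → |f x - f y| ≤ c) {ε : ℝ} (hε : 0 ≤ ε) :
    (Measure.pi fun _ => μ).real {x | ε ≤ |f x - ∫ y, f y ∂(Measure.pi fun _ => μ)|} ≤
      2 * Real.exp (-ε ^ 2 / (2 * (n * c ^ 2))) := by
  set π := (Measure.pi fun _ : Fin n => μ)
  have hsub : HasSubgaussianMGF (fun x => f x - ∫ y, f y ∂π) (n * c.toNNReal ^ 2) π := by
    refine ⟨fun r => ?_, fun r => ?_⟩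
    · refine Integrable.of_bound (by fun_prop) (Real.exp (|r| * (B + |∫ y, f y ∂π|)))
        (Eventually.of_forall fun x => ?_)
      rw [Real.norm_of_nonneg (Real.exp_nonneg _)]
      refine Real.exp_le_exp.2 ((le_abs_self _).trans ?_)
      rw [abs_mul]
      gcongr
      exact (abs_sub _ _).trans (by gcongr; exact hB x)
    · refine (integral_exp_le_of_bounded_differences μ c B n f hf hB hc r).trans_eq ?_
      push_cast
      rw [Real.coe_toNNReal _ hc0]
  have h1 := hsub.measure_ge_le hε
  have h2 := hsub.neg.measure_ge_le hε
  push_cast at h1 h2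
  rw [Real.coe_toNNReal _ hc0] at h1 h2
  have hsubset : {x | ε ≤ |f x - ∫ y, f y ∂π|} ⊆ {x | ε ≤ f x - ∫ y, f y ∂π} ∪
      {x | ε ≤ (-fun x => f x - ∫ y, f y ∂π) x} := fun x hx => by
    rcases le_abs.1 (show ε ≤ |_| from hx) with h | h
    · exact Or.inl h
    · exact Or.inr h
  refine (measureReal_mono hsubset).trans ((measureReal_union_le _ _).trans ?_)
  linarith

/-! ### Moments and symmetry of the complex Gaussian. -/

lemma measurable_ofReal_add_mul_I :
    Measurable fun p : ℝ × ℝ => (p.1 : ℂ) + (p.2 : ℂ) * Complex.I := by fun_prop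

instance isProbabilityMeasure_complexGaussian (v : NNReal) :
    IsProbabilityMeasure (complexGaussian v) :=
  Measure.isProbabilityMeasure_map measurable_ofReal_add_mul_I.aemeasurable

lemma integral_complexGaussian {F : Type*} [NormedAddCommGroup F] [NormedSpace ℝ F] (v : NNReal)
    {f : ℂ → F} (hf : StronglyMeasurable f) :
    ∫ z, f z ∂(complexGaussian v) = ∫ p : ℝ × ℝ, f ((p.1 : ℂ) + (p.2 : ℂ) * Complex.I)
      ∂((gaussianReal 0 (v / 2)).prod (gaussianReal 0 (v / 2))) :=
  integral_map measurable_ofReal_add_mul_I.aemeasurable hf.aestronglyMeasurable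

/-- Quarter turns are the only part of circular symmetry used; they suffice to kill the mixed
moments below. -/
lemma measurePreserving_I_mul (v : NNReal) :
    MeasurePreserving (fun z => Complex.I * z) (complexGaussian v) (complexGaussian v) := by
  refine ⟨by fun_prop, ?_⟩
  set γ := gaussianReal 0 (v / 2)
  have hneg : γ.map (fun x => -x) = γ := by rw [gaussianReal_map_neg, neg_zero]
  have h2 : (γ.prod γ).map (fun p : ℝ × ℝ => (-p.2, p.1)) = γ.prod γ := by
    have e : (fun p : ℝ × ℝ => (-p.2, p.1)) = Prod.map (fun x => -x) id ∘ Prod.swap := rfl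
    rw [e, ← Measure.map_map (by fun_prop) measurable_swap, Measure.prod_swap,
      ← Measure.map_prod_map γ γ (by fun_prop) measurable_id, hneg, Measure.map_id]
  rw [complexGaussian, Measure.map_map (by fun_prop) measurable_ofReal_add_mul_I]
  conv_rhs => rw [← h2, Measure.map_map measurable_ofReal_add_mul_I (by fun_prop)]
  congr 1
  funext p
  simp only [Function.comp]
  push_cast
  linear_combination (p.2 : ℂ) * Complex.I_mul_I

lemma complexGaussian_eq_map_one (v : NNReal) :
    complexGaussian v = (complexGaussian 1).map (fun z => (Real.sqrt v : ℂ) * z) := by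
  have h1 : gaussianReal 0 (v / 2) = (gaussianReal 0 (1 / 2)).map (Real.sqrt v * ·) := by
    rw [gaussianReal_map_const_mul, mul_zero]
    congr 1
    ext
    push_cast
    rw [Real.sq_sqrt v.coe_nonneg]
    ring
  rw [complexGaussian, complexGaussian, Measure.map_map (by fun_prop) measurable_ofReal_add_mul_I,
    h1, Measure.map_prod_map _ _ (by fun_prop) (by fun_prop),
    Measure.map_map measurable_ofReal_add_mul_I (by fun_prop)]
  congr 1
  funext p
  simp only [Function.comp, Prod.map]
  push_cast
  ring

lemma memLp_id_complexGaussian (v : NNReal) : MemLp id 4 (complexGaussian v) := by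
  rw [complexGaussian, memLp_map_measure_iff aestronglyMeasurable_id
    measurable_ofReal_add_mul_I.aemeasurable]
  have h := memLp_id_gaussianReal' (μ := 0) (v := v / 2) 4 (by norm_num)
  have h1 : MemLp (fun p : ℝ × ℝ => (p.1 : ℂ)) 4
      ((gaussianReal 0 (v / 2)).prod (gaussianReal 0 (v / 2))) :=
    (h.comp_measurePreserving measurePreserving_fst).ofReal
  have h2 : MemLp (fun p : ℝ × ℝ => (p.2 : ℂ)) 4
      ((gaussianReal 0 (v / 2)).prod (gaussianReal 0 (v / 2))) :=
    (h.comp_measurePreserving measurePreserving_snd).ofReal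
  exact h1.add (h2.mul_const Complex.I)

lemma integral_norm_sq_complexGaussian (v : NNReal) :
    ∫ z, ‖z‖ ^ 2 ∂(complexGaussian v) = v := by
  have hx : ∫ x, x ^ 2 ∂(gaussianReal 0 (v / 2)) = v / 2 := by
    have := variance_fun_id_gaussianReal (μ := 0) (v := v / 2)
    rw [variance_of_integral_eq_zero aemeasurable_id' (by simp)] at this
    simpa using this
  have hi : Integrable (fun x : ℝ => x ^ 2) (gaussianReal 0 (v / 2)) :=
    (memLp_id_gaussianReal' (μ := 0) (v := v / 2) 2 (by norm_num)).integrable_sq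
  rw [integral_complexGaussian v (by fun_prop)]
  have : ∀ p : ℝ × ℝ, ‖(p.1 : ℂ) + (p.2 : ℂ) * Complex.I‖ ^ 2 = p.1 ^ 2 + p.2 ^ 2 := fun p => by
    rw [Complex.sq_norm, Complex.normSq_add_mul_I]
  simp only [this]
  rw [integral_add (hi.comp_fst _) (hi.comp_snd _), integral_fun_fst (fun x : ℝ => x ^ 2),
    integral_fun_snd (fun x : ℝ => x ^ 2), hx]
  simp

/-- The fourth absolute moment of a standard complex Gaussian. -/
def fourthMoment : ℝ := ∫ z, ‖z‖ ^ 4 ∂(complexGaussian 1)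

lemma fourthMoment_nonneg : 0 ≤ fourthMoment := integral_nonneg fun z => by positivity

/-- Only the scaling in `v` matters; the value of `fourthMoment` is never needed. -/
lemma integral_norm_pow_four_complexGaussian (v : NNReal) :
    ∫ z, ‖z‖ ^ 4 ∂(complexGaussian v) = v ^ 2 * fourthMoment := by
  rw [complexGaussian_eq_map_one, integral_map (by fun_prop) (by fun_prop), fourthMoment,
    ← integral_const_mul]
  congr 1
  funext z
  rw [norm_mul, mul_pow, Complex.norm_real, Real.norm_of_nonneg (Real.sqrt_nonneg _),
    show Real.sqrt v ^ 4 = (Real.sqrt v ^ 2) ^ 2 by ring, Real.sq_sqrt v.coe_nonneg]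

/-! ### Variance of Gaussian quadratic forms. -/

section QuadraticForm

variable {k : ℕ} (v : NNReal)

/-- The centred product `h̄ᵢ hⱼ - δᵢⱼ v`. -/
def centredProd (v : NNReal) (p : Fin k × Fin k) (h : Fin k → ℂ) : ℂ :=
  star (h p.1) * h p.2 - if p.1 = p.2 then (v : ℂ) else 0

lemma quadForm_sub_trace_eq_sum (A : Matrix (Fin k) (Fin k) ℂ) (h : Fin k → ℂ) :
    quadForm A h - v * A.trace = ∑ p : Fin k × Fin k, A p.1 p.2 * centredProd v p h := by
  simp only [centredProd, mul_sub, Finset.sum_sub_distrib, Fintype.sum_prod_type, mul_ite, mul_zero,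
    Finset.sum_ite_eq, Finset.mem_univ, if_true]
  rw [← Finset.sum_mul, quadForm, mul_comm (v : ℂ)]
  congr 1
  simp only [dotProduct, Matrix.mulVec, Finset.mul_sum, Pi.star_apply]
  exact Finset.sum_congr rfl fun i _ => Finset.sum_congr rfl fun j _ => by ring

lemma memLp_eval_four (i : Fin k) :
    MemLp (fun h : Fin k → ℂ => h i) 4 (Measure.pi fun _ => complexGaussian v) :=
  (memLp_id_complexGaussian v).comp_measurePreserving (measurePreserving_eval _ i)

lemma integrable_norm_pow_four_eval (i : Fin k) :
    Integrable (fun h : Fin k → ℂ => ‖h i‖ ^ 4) (Measure.pi fun _ => complexGaussian v) := by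
  have := (memLp_eval_four v i).integrable_norm_pow (p := 4) (by norm_num)
  simpa using this

lemma integral_norm_pow_four_eval (i : Fin k) :
    ∫ h : Fin k → ℂ, ‖h i‖ ^ 4 ∂(Measure.pi fun _ => complexGaussian v) = v ^ 2 * fourthMoment := by
  rw [← integral_norm_pow_four_complexGaussian]
  exact integral_comp_eval (μ := fun _ : Fin k => complexGaussian v) (i := i)
    (f := fun z : ℂ => ‖z‖ ^ 4) (by fun_prop)

lemma measurable_centredProd (p : Fin k × Fin k) : Measurable (centredProd v p) := by
  unfold centredProd
  fun_prop

lemma norm_centredProd_sq_le (p : Fin k × Fin k) (h : Fin k → ℂ) :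
    ‖centredProd v p h‖ ^ 2 ≤ ‖h p.1‖ ^ 4 + ‖h p.2‖ ^ 4 + 2 * (v : ℝ) ^ 2 := by
  have h1 : ‖centredProd v p h‖ ≤ ‖h p.1‖ * ‖h p.2‖ + v := by
    refine (norm_sub_le _ _).trans ?_
    rw [norm_mul, norm_star]
    gcongr
    split_ifs
    · simp
    · simp
  have h2 := pow_le_pow_left₀ (norm_nonneg _) h1 2
  nlinarith [sq_nonneg (‖h p.1‖ * ‖h p.2‖ - v), sq_nonneg (‖h p.1‖ ^ 2 - ‖h p.2‖ ^ 2)]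

lemma memLp_centredProd (p : Fin k × Fin k) :
    MemLp (centredProd v p) 2 (Measure.pi fun _ => complexGaussian v) := by
  rw [memLp_two_iff_integrable_sq_norm (measurable_centredProd v p).aestronglyMeasurable]
  refine (((integrable_norm_pow_four_eval v p.1).add (integrable_norm_pow_four_eval v p.2)).add
    (integrable_const (2 * (v : ℝ) ^ 2))).mono'
    ((measurable_centredProd v p).norm.pow_const 2).aestronglyMeasurable
    (Eventually.of_forall fun h => ?_)
  rw [Real.norm_of_nonneg (by positivity)]
  exact norm_centredProd_sq_le v p h

lemma integral_norm_sq_centredProd_le (p : Fin k × Fin k) :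
    ∫ h, ‖centredProd v p h‖ ^ 2 ∂(Measure.pi fun _ => complexGaussian v) ≤
      (2 * fourthMoment + 2) * (v : ℝ) ^ 2 := by
  have i1 := integrable_norm_pow_four_eval v p.1
  have i2 := integrable_norm_pow_four_eval v p.2
  refine (integral_mono (memLp_centredProd v p).integrable_norm_pow'
    ((i1.add i2).add (integrable_const (2 * (v : ℝ) ^ 2)))
    (fun h => norm_centredProd_sq_le v p h)).trans_eq ?_
  rw [integral_add' (i1.add i2) (integrable_const _), integral_add' i1 i2, integral_norm_pow_four_eval, integral_norm_pow_four_eval]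
  simp
  ring

/-- Rotating coordinate `m` contributes `I` through `h_j` and `-I` through the conjugate of `h_i`.
On the diagonal the phases cancel, so the centring term is compatible with the rule. -/
lemma centredProd_rotate (p : Fin k × Fin k) (m : Fin k) (h : Fin k → ℂ) :
    centredProd v p (fun l => if l = m then Complex.I * h l else h l) =
      ((if p.2 = m then Complex.I else 1) * (if p.1 = m then -Complex.I else 1)) *
        centredProd v p h := by
  obtain ⟨i, j⟩ := p
  simp only [centredProd]
  by_cases hi : i = m <;> by_cases hj : j = m <;> by_cases hij : i = j <;>
    simp_all <;> (ring_nf; try simp)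

lemma measurePreserving_rotate (m : Fin k) :
    MeasurePreserving (fun (h : Fin k → ℂ) l => if l = m then Complex.I * h l else h l)
      (Measure.pi fun _ => complexGaussian v) (Measure.pi fun _ => complexGaussian v) := by
  refine measurePreserving_pi (fun _ => complexGaussian v) (fun _ => complexGaussian v)
    (f := fun l z => if l = m then Complex.I * z else z) fun l => ?_
  by_cases hl : l = m
  · simpa [hl] using measurePreserving_I_mul v
  · simpa [hl] using! MeasurePreserving.id _

/-- If some rotation multiplies the integrand by a phase other than `1`, the integral vanishes by
invariance. Such a rotation exists unless both pairs are diagonal, and then independence and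
centring finish. -/
lemma integral_centredProd_mul_star_eq_zero {p p' : Fin k × Fin k} (hp : p ≠ p') :
    ∫ h, centredProd v p h * star (centredProd v p' h) ∂(Measure.pi fun _ => complexGaussian v) =
      0 := by
  set π := (Measure.pi fun _ : Fin k => complexGaussian v) with hπ
  set J := ∫ h, centredProd v p h * star (centredProd v p' h) ∂π with hJ
  have hrot : ∀ m, J = ((if p.2 = m then Complex.I else 1) * (if p.1 = m then -Complex.I else 1)) *
      star ((if p'.2 = m then Complex.I else 1) * (if p'.1 = m then -Complex.I else 1)) * J := by
    intro m
    have hmeas : Measurable fun h => centredProd v p h * star (centredProd v p' h) :=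
      (measurable_centredProd v p).mul (continuous_star.measurable.comp
        (measurable_centredProd v p'))
    conv_lhs => rw [hJ, hπ, ← (measurePreserving_rotate v m).map_eq]
    rw [integral_map (measurePreserving_rotate v m).measurable.aemeasurable
      hmeas.aestronglyMeasurable, hJ, ← integral_const_mul]
    congr 1
    funext h
    rw [centredProd_rotate, centredProd_rotate, star_mul']
    ring
  obtain ⟨i, j⟩ := p
  obtain ⟨a, b⟩ := p'
  have key : ∀ c : ℂ, c ≠ 1 → J = c * J → J = 0 := fun c hc h => by
    have : (1 - c) * J = 0 := by linear_combination h
    exact (mul_eq_zero.1 this).resolve_left (sub_ne_zero.2 hc.symm)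
  have hI : Complex.I ≠ 1 := fun h => by simpa using congrArg Complex.re h
  have hI' : -Complex.I ≠ 1 := fun h => by simpa using congrArg Complex.re h
  have hm1 : (-1 : ℂ) ≠ 1 := by norm_num
  by_cases hij : i = j
  · by_cases hab : a = b
    · subst hij hab
      have hia : i ≠ a := fun h => hp (by rw [h])
      have hind : IndepFun (fun h : Fin k → ℂ => star (h i) * h i - (v : ℂ))
          (fun h => star (star (h a) * h a - (v : ℂ))) π := by
        have := (iIndepFun_pi (μ := fun _ : Fin k => complexGaussian v)
          (X := fun _ z => z) (fun _ => aemeasurable_id)).indepFun hia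
        exact this.comp (φ := fun z : ℂ => star z * z - (v : ℂ))
          (ψ := fun z : ℂ => star (star z * z - (v : ℂ))) (by fun_prop) (by fun_prop)
      have h0 : ∫ h : Fin k → ℂ, (star (h i) * h i - (v : ℂ)) ∂π = 0 := by
        have e : ∀ z : ℂ, star z * z = ((‖z‖ ^ 2 : ℝ) : ℂ) := fun z => by
          rw [Complex.star_def, Complex.conj_mul', Complex.ofReal_pow]
        have e1 := integral_comp_eval (μ := fun _ : Fin k => complexGaussian v) (i := i)
          (f := fun z : ℂ => star z * z - (v : ℂ)) (by fun_prop)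
        rw [e1]
        simp only [e]
        have hi2 : Integrable (fun z : ℂ => ‖z‖ ^ 2) (complexGaussian v) :=
          ((memLp_id_complexGaussian v).mono_exponent (p := 2) (by norm_num)).integrable_norm_pow'
        rw [integral_sub hi2.ofReal (integrable_const _), integral_complex_ofReal,
          integral_norm_sq_complexGaussian]
        simp
      rw [hJ]
      simp only [centredProd, if_true]
      rw [hind.integral_fun_mul_eq_mul_integral (by fun_prop) (by fun_prop), h0, zero_mul]
    -- For `p` diagonal and `p' = (a, b)` off-diagonal, the rotation at `a` has phase `I`.
    · have := hrot a
      subst hij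
      simp only [if_true, Ne.symm hab, if_false] at this
      by_cases hia : i = a
      · simp [hia] at this
        exact key _ hI (by simpa using this)
      · simp [hia] at this
        exact key _ hI (by simpa using this)
  · by_cases hjb : j = b
    · have hia : i ≠ a := fun h => hp (by rw [h, hjb])
      have := hrot i
      have hji : j ≠ i := Ne.symm hij
      have hbi : b ≠ i := hjb ▸ hji
      simp [hji, hbi, Ne.symm hia] at this
      exact key _ hI' (by simpa using this)
    · have := hrot j
      -- The rotation at `j` gives phase `I`, or `I² = -1` if `j` also occurs as the conjugated
      -- index of `p'`.
      by_cases haj : a = j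
      · simp [hij, Ne.symm hjb, haj] at this
        exact key _ hm1 (by simpa using this)
      · simp [hij, Ne.symm hjb, haj] at this
        exact key _ hI (by simpa using this)

/-- The variance of a quadratic form in independent complex Gaussians. -/
theorem integral_norm_sq_quadForm_sub_le (A : Matrix (Fin k) (Fin k) ℂ) :
    ∫ h, ‖quadForm A h - v * A.trace‖ ^ 2 ∂(Measure.pi fun _ => complexGaussian v) ≤
      (2 * fourthMoment + 2) * (v : ℝ) ^ 2 * ∑ i, ∑ j, ‖A i j‖ ^ 2 := by
  set π := (Measure.pi fun _ : Fin k => complexGaussian v) with hπ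
  have hintg : ∀ p p' : Fin k × Fin k,
      Integrable (fun h => centredProd v p h * star (centredProd v p' h)) π := fun p p' =>
    (memLp_centredProd v p).integrable_mul (memLp_centredProd v p').star
  have h1 : ∫ h, ((‖quadForm A h - v * A.trace‖ ^ 2 : ℝ) : ℂ) ∂π =
      ∑ p : Fin k × Fin k, ((‖A p.1 p.2‖ ^ 2 * ∫ h, ‖centredProd v p h‖ ^ 2 ∂π : ℝ) : ℂ) := by
    have e : ∀ h, ((‖quadForm A h - v * A.trace‖ ^ 2 : ℝ) : ℂ) =
        ∑ p : Fin k × Fin k, ∑ p' : Fin k × Fin k, A p.1 p.2 * star (A p'.1 p'.2) *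
          (centredProd v p h * star (centredProd v p' h)) := fun h => by
      rw [Complex.ofReal_pow, ← Complex.mul_conj', quadForm_sub_trace_eq_sum, map_sum,
        Finset.sum_mul_sum]
      refine Finset.sum_congr rfl fun p _ => Finset.sum_congr rfl fun p' _ => ?_
      rw [map_mul]
      simp only [Complex.star_def]
      ring
    simp only [e]
    rw [integral_finsetSum _ fun p _ => integrable_finsetSum _ fun p' _ => (hintg p p').const_mul _]
    refine Finset.sum_congr rfl fun p _ => ?_
    rw [integral_finsetSum _ fun p' _ => (hintg p p').const_mul _, Finset.sum_eq_single p]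
    · rw [integral_const_mul, Complex.ofReal_mul, ← integral_complex_ofReal]
      simp only [Complex.star_def, Complex.mul_conj', Complex.ofReal_pow]
    · intro p' _ hp'
      rw [integral_const_mul, integral_centredProd_mul_star_eq_zero v hp'.symm, mul_zero]
    · simp
  rw [integral_complex_ofReal, ← Complex.ofReal_sum, Complex.ofReal_inj] at h1
  rw [h1, Fintype.sum_prod_type, Finset.mul_sum]
  refine Finset.sum_le_sum fun i _ => ?_
  rw [Finset.mul_sum]
  refine Finset.sum_le_sum fun j _ => ?_
  rw [mul_comm]
  exact mul_le_mul_of_nonneg_right (integral_norm_sq_centredProd_le v (i, j)) (by positivity)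

end QuadraticForm

/-! ### The normalized trace of the resolvent and its approximate quadratic equation. -/

section NormalizedTrace

open scoped ComplexOrder

lemma continuous_colGram {k n : ℕ} : Continuous (colGram : (Fin n → Fin k → ℂ) → _) := by
  unfold colGram
  refine continuous_finsetSum _ fun j _ => ?_
  exact Continuous.matrix_vecMulVec (continuous_apply j) (continuous_star.comp (continuous_apply j))

lemma continuous_green_colGram {k n : ℕ} {t : ℂ} (ht : t.im ≠ 0) :
    Continuous fun x : Fin n → Fin k → ℂ => green (colGram x) t := by
  have h : Continuous fun x : Fin n → Fin k → ℂ => colGram x - t • (1 : Matrix _ _ ℂ) :=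
    continuous_colGram.sub continuous_const
  simp only [green, Matrix.inv_def, Ring.inverse_eq_inv']
  exact (h.matrix_det.inv₀ fun x =>
    (isUnit_det_sub_smul_one (posSemidef_colGram x).isHermitian ht).ne_zero).smul h.matrix_adjugate

lemma continuous_quadForm {k : ℕ} {X : Type*} [TopologicalSpace X]
    {A : X → Matrix (Fin k) (Fin k) ℂ} {h : X → Fin k → ℂ} (hA : Continuous A)
    (hh : Continuous h) : Continuous fun x => quadForm (A x) (h x) :=
  (continuous_star.comp hh).dotProduct (hA.matrix_mulVec hh)

/-- The normalized trace of the resolvent of `∑ xⱼ xⱼ†`. -/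
def normTrace {k n : ℕ} (t : ℂ) (x : Fin n → Fin k → ℂ) : ℂ := (green (colGram x) t).trace / k

lemma continuous_normTrace {k n : ℕ} {t : ℂ} (ht : t.im ≠ 0) :
    Continuous (normTrace t : (Fin n → Fin k → ℂ) → ℂ) :=
  (continuous_green_colGram ht).matrix_trace.div_const _

lemma norm_normTrace_le {k n : ℕ} {t : ℂ} (ht : 0 < t.im) (x : Fin n → Fin k → ℂ) :
    ‖normTrace t x‖ ≤ 1 / t.im := by
  rcases Nat.eq_zero_or_pos k with rfl | hk
  · simp [normTrace, ht.le]
  · have hk' : (0 : ℝ) < k := by exact_mod_cast hk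
    rw [normTrace, norm_div, Complex.norm_natCast, div_le_iff₀ hk', one_div_mul_eq_div]
    exact norm_trace_green_le (posSemidef_colGram x).isHermitian ht

lemma im_normTrace_nonneg {k n : ℕ} {t : ℂ} (ht : 0 < t.im) (x : Fin n → Fin k → ℂ) :
    0 ≤ (normTrace t x).im := by
  rw [normTrace, Complex.div_natCast_im]
  exact div_nonneg (im_trace_green_nonneg (posSemidef_colGram x).isHermitian ht) (Nat.cast_nonneg k)

lemma im_mul_normTrace_nonneg {k n : ℕ} {t : ℂ} (ht : 0 < t.im) (x : Fin n → Fin k → ℂ) :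
    0 ≤ (t * normTrace t x).im := by
  rw [normTrace, ← mul_div_assoc, Complex.div_natCast_im]
  exact div_nonneg (im_mul_trace_green_nonneg (posSemidef_colGram x) ht) (Nat.cast_nonneg k)

/-- Replacing a column removes one rank one term and adds another, each changing the trace by at
most `1/Im t`. -/
lemma norm_normTrace_sub_le {k n : ℕ} {t : ℂ} (ht : 0 < t.im) (i : Fin n)
    (x y : Fin n → Fin k → ℂ) (hxy : ∀ j ≠ i, x j = y j) :
    ‖normTrace t x - normTrace t y‖ ≤ 2 / (k * t.im) := by
  obtain ⟨n, rfl⟩ : ∃ m, n = m + 1 := ⟨n - 1, by have := i.pos; omega⟩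
  have hz : (fun j => x (i.succAbove j)) = fun j => y (i.succAbove j) :=
    funext fun j => hxy _ (Fin.succAbove_ne i j)
  have h1 := norm_trace_green_add_vecMulVec_sub_le
    (posSemidef_colGram fun j => x (i.succAbove j)) ht (x i)
  have h2 := norm_trace_green_add_vecMulVec_sub_le
    (posSemidef_colGram fun j => y (i.succAbove j)) ht (y i)
  rw [← colGram_succAbove] at h1 h2
  rw [hz] at h1
  have h3 := (norm_sub_le_norm_sub_add_norm_sub (green (colGram x) t).trace
    (green (colGram fun j => y (i.succAbove j)) t).trace (green (colGram y) t).trace)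
  rw [norm_sub_rev (green (colGram fun j => y (i.succAbove j)) t).trace] at h3
  rw [normTrace, normTrace, ← sub_div, norm_div, Complex.norm_natCast, mul_comm, ← div_div]
  refine div_le_div_of_nonneg_right ?_ (Nat.cast_nonneg k)
  calc _ ≤ 1 / t.im + 1 / t.im := by linarith
    _ = 2 / t.im := by ring

/-- The joint law of the columns of a Gaussian `k × n` matrix with entries of variance `1 / n`. -/
def colLaw (k n : ℕ) : Measure (Fin n → Fin k → ℂ) :=
  Measure.pi fun _ => Measure.pi fun _ => complexGaussian (n : NNReal)⁻¹

instance (k n : ℕ) : IsProbabilityMeasure (colLaw k n) := by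
  unfold colLaw
  infer_instance

/-- The inequality `|X| ≤ (a + |X|²/a)/2` converts the variance bound into a first moment bound,
with `a` free to be optimized. -/
lemma integral_norm_quadForm_sub_le {k : ℕ} (v : NNReal) (A : Matrix (Fin k) (Fin k) ℂ) {a : ℝ}
    (ha : 0 < a) :
    Integrable (fun h => ‖quadForm A h - v * A.trace‖) (Measure.pi fun _ => complexGaussian v) ∧
    ∫ h, ‖quadForm A h - v * A.trace‖ ∂(Measure.pi fun _ => complexGaussian v) ≤
      (a + (2 * fourthMoment + 2) * (v : ℝ) ^ 2 * (∑ i, ∑ j, ‖A i j‖ ^ 2) / a) / 2 := by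
  have hL : MemLp (fun h => quadForm A h - v * A.trace) 2
      (Measure.pi fun _ => complexGaussian v) := by
    simp only [quadForm_sub_trace_eq_sum]
    exact memLp_finsetSum _ fun p _ => (memLp_centredProd v p).const_mul _
  have hi := (hL.integrable (by norm_num)).norm
  have hi2 : Integrable (fun h => ‖quadForm A h - v * A.trace‖ ^ 2)
      (Measure.pi fun _ => complexGaussian v) := hL.integrable_norm_pow'
  refine ⟨hi, ?_⟩
  have h1 : ∀ h, ‖quadForm A h - v * A.trace‖ ≤
      (a + ‖quadForm A h - v * A.trace‖ ^ 2 / a) / 2 := fun h => by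
    have : a + ‖quadForm A h - v * A.trace‖ ^ 2 / a =
        (a ^ 2 + ‖quadForm A h - v * A.trace‖ ^ 2) / a := by field_simp
    rw [this, div_div, le_div_iff₀ (by positivity)]
    nlinarith [sq_nonneg (a - ‖quadForm A h - v * A.trace‖)]
  refine (integral_mono hi (((integrable_const a).add (hi2.div_const a)).div_const 2)
    fun h => h1 h).trans ?_
  rw [integral_div]
  refine div_le_div_of_nonneg_right ?_ zero_le_two
  rw [integral_add' (integrable_const a) (hi2.div_const a), integral_div]
  have := integral_norm_sq_quadForm_sub_le v A
  simp only [integral_const, probReal_univ, one_smul]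
  gcongr

/-- Column `j` is independent of the others, so by Fubini the resolvent can be frozen; its
Hilbert–Schmidt norm is bounded uniformly in the frozen columns. -/
lemma integral_norm_leaveOneOut_le {k n : ℕ} {t : ℂ} (ht : 0 < t.im) (j : Fin (n + 1)) {a : ℝ}
    (ha : 0 < a) :
    Integrable (fun x => ‖quadForm (green (colGram fun i => x (j.succAbove i)) t) (x j) -
      ((n + 1 : ℕ) : ℂ)⁻¹ * (green (colGram fun i => x (j.succAbove i)) t).trace‖)
      (colLaw k (n + 1)) ∧
    ∫ x, ‖quadForm (green (colGram fun i => x (j.succAbove i)) t) (x j) -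
      ((n + 1 : ℕ) : ℂ)⁻¹ * (green (colGram fun i => x (j.succAbove i)) t).trace‖
        ∂(colLaw k (n + 1)) ≤
      (a + (2 * fourthMoment + 2) * (((n + 1 : ℕ) : ℝ)⁻¹) ^ 2 * (k / t.im ^ 2) / a) / 2 := by
  set v : NNReal := ((n + 1 : ℕ) : NNReal)⁻¹ with hv
  set γ : Measure (Fin k → ℂ) := Measure.pi fun _ => complexGaussian v with hγ
  set π : Measure (Fin n → Fin k → ℂ) := Measure.pi fun _ => γ with hπ
  set b := (a + (2 * fourthMoment + 2) * (((n + 1 : ℕ) : ℝ)⁻¹) ^ 2 * (k / t.im ^ 2) / a) / 2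
  set G : (Fin k → ℂ) × (Fin n → Fin k → ℂ) → ℝ := fun p =>
    ‖quadForm (green (colGram p.2) t) p.1 - (v : ℂ) * (green (colGram p.2) t).trace‖ with hG
  have hcont : Continuous G := by
    have h1 : Continuous fun p : (Fin k → ℂ) × (Fin n → Fin k → ℂ) => green (colGram p.2) t :=
      (continuous_green_colGram ht.ne').comp continuous_snd
    exact ((continuous_quadForm h1 continuous_fst).sub
      (continuous_const.mul h1.matrix_trace)).norm
  have hy : ∀ y, Integrable (fun h => G (h, y)) γ ∧ ∫ h, G (h, y) ∂γ ≤ b := fun y => by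
    obtain ⟨h1, h2⟩ := integral_norm_quadForm_sub_le v (green (colGram y) t) ha
    refine ⟨h1, h2.trans ?_⟩
    have h3 := sum_norm_sq_green_le (posSemidef_colGram y).isHermitian ht
    have h4 := fourthMoment_nonneg
    have h5 : ((v : NNReal) : ℝ) = ((n + 1 : ℕ) : ℝ)⁻¹ := by rw [hv]; push_cast; rfl
    rw [h5]
    change _ ≤ (a + (2 * fourthMoment + 2) * (((n + 1 : ℕ) : ℝ)⁻¹) ^ 2 * (k / t.im ^ 2) / a) / 2
    gcongr
  have hintg : Integrable G (γ.prod π) := by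
    rw [integrable_prod_iff' hcont.aestronglyMeasurable]
    refine ⟨Eventually.of_forall fun y => (hy y).1, ?_⟩
    refine Integrable.of_bound
      (hcont.norm.stronglyMeasurable.integral_prod_left').aestronglyMeasurable b
      (Eventually.of_forall fun y => ?_)
    simp only [hG, norm_norm]
    rw [Real.norm_of_nonneg (integral_nonneg fun h => norm_nonneg _)]
    exact (hy y).2
  have hmp := measurePreserving_piFinSuccAbove (fun _ : Fin (n + 1) => γ) j
  have he : ∀ x : Fin (n + 1) → Fin k → ℂ,
      ‖quadForm (green (colGram fun i => x (j.succAbove i)) t) (x j) -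
        ((n + 1 : ℕ) : ℂ)⁻¹ * (green (colGram fun i => x (j.succAbove i)) t).trace‖ =
      G (MeasurableEquiv.piFinSuccAbove (fun _ : Fin (n + 1) => Fin k → ℂ) j x) := fun x => by
    have : ((v : NNReal) : ℂ) = ((n + 1 : ℕ) : ℂ)⁻¹ := by rw [hv]; push_cast; rfl
    rw [← this]
    rfl
  simp only [he]
  have hlaw : colLaw k (n + 1) = Measure.pi fun _ => γ := rfl
  rw [hlaw]
  refine ⟨hmp.integrable_comp_of_integrable hintg, ?_⟩
  rw [hmp.integral_comp (MeasurableEquiv.measurableEmbedding _), integral_prod_symm _ hintg]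
  refine (integral_mono hintg.integral_prod_right (integrable_const b) fun y => (hy y).2).trans_eq ?_
  simp

/-- On average, the normalized trace of the resolvent almost satisfies a quadratic equation. -/
theorem integral_norm_quadratic_normTrace_le {k n : ℕ} (hk : k ≠ 0) {t : ℂ} (ht : 0 < t.im) {c : ℝ}
    (hc : c = (k : ℝ) / ((n + 1 : ℕ) : ℝ)) :
    ∫ x, ‖c * t * normTrace t x ^ 2 + (t + c - 1) * normTrace t x + 1‖ ∂(colLaw k (n + 1)) ≤
      ‖t‖ / (t.im * c) * ((1 + (2 * fourthMoment + 2) * c / t.im ^ 2) / 2 /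
        Real.sqrt ((n + 1 : ℕ) : ℝ) + 1 / t.im / ((n + 1 : ℕ) : ℝ)) := by
  set N : ℝ := ((n + 1 : ℕ) : ℝ) with hN
  have hN0 : 0 < N := by positivity
  have hk0 : (0 : ℝ) < k := by positivity
  have hsq : 0 < Real.sqrt N := Real.sqrt_pos.2 hN0
  set d : Fin (n + 1) → (Fin (n + 1) → Fin k → ℂ) → ℝ := fun j x =>
    ‖quadForm (green (colGram fun i => x (j.succAbove i)) t) (x j) -
      ((n + 1 : ℕ) : ℂ)⁻¹ * (green (colGram fun i => x (j.succAbove i)) t).trace‖ with hd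
  -- The choice `a = 1/√N` balances `a` against the variance term, which is of order `c/(N a)`.
  have hdi := fun j : Fin (n + 1) => integral_norm_leaveOneOut_le (k := k) ht j (one_div_pos.2 hsq)
  have hpt : ∀ x : Fin (n + 1) → Fin k → ℂ,
      ‖c * t * normTrace t x ^ 2 + (t + c - 1) * normTrace t x + 1‖ ≤
        ‖t‖ / (t.im * k) * ∑ j, (d j x + 1 / t.im / N) := fun x => by
    refine (norm_quadratic_trace_green_le hk x ht (c := c) (m := normTrace t x)
      (by rw [hc, hN]; push_cast; rfl) rfl).trans ?_
    gcongr with j _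
    have e : (c : ℂ) * normTrace t x = ((n + 1 : ℕ) : ℂ)⁻¹ * (green (colGram x) t).trace := by
      have hk' : (k : ℂ) ≠ 0 := by exact_mod_cast hk
      have hn' : ((n : ℂ) + 1) ≠ 0 := by exact_mod_cast n.succ_ne_zero
      rw [hc, hN, normTrace]
      push_cast
      field_simp
    rw [e]
    -- Passing from the full trace to the leave-one-out trace costs `1/(N Im t)` by the rank one
    -- bound.
    refine (norm_sub_le_norm_sub_add_norm_sub _ (((n + 1 : ℕ) : ℂ)⁻¹ *
      (green (colGram fun i => x (j.succAbove i)) t).trace) _).trans ?_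
    refine add_le_add le_rfl ?_
    rw [← mul_sub, norm_mul, norm_inv, Complex.norm_natCast, ← hN, inv_mul_eq_div]
    have h1 := norm_trace_green_add_vecMulVec_sub_le
      (posSemidef_colGram fun i => x (j.succAbove i)) ht (x j)
    rw [← colGram_succAbove, norm_sub_rev] at h1
    gcongr
  have hadd : ∀ j ∈ Finset.univ, Integrable (fun x => d j x + 1 / t.im / N) (colLaw k (n + 1)) :=
    fun j _ => (hdi j).1.add (integrable_const _)
  have hintg : Integrable (fun x => ‖t‖ / (t.im * k) * ∑ j, (d j x + 1 / t.im / N))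
      (colLaw k (n + 1)) :=
    (integrable_finsetSum _ hadd).const_mul _
  refine (integral_mono_of_nonneg (Eventually.of_forall fun x => norm_nonneg _) hintg
    (Eventually.of_forall hpt)).trans ?_
  rw [integral_const_mul, integral_finsetSum _ hadd]
  have hj : ∀ j, ∫ x, (d j x + 1 / t.im / N) ∂(colLaw k (n + 1)) ≤
      (1 + (2 * fourthMoment + 2) * c / t.im ^ 2) / 2 / Real.sqrt N + 1 / t.im / N := fun j => by
    rw [integral_add (hdi j).1 (integrable_const _)]
    simp only [integral_const, probReal_univ, one_smul]
    refine add_le_add ((hdi j).2.trans_eq ?_) le_rfl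
    rw [← hN, hc]
    have h2 : Real.sqrt N ^ 2 = N := Real.sq_sqrt hN0.le
    rw [← h2]
    field_simp
    rw [Real.sqrt_sq hsq.le]
    ring
  calc _ ≤ ‖t‖ / (t.im * k) * ∑ _j : Fin (n + 1),
        ((1 + (2 * fourthMoment + 2) * c / t.im ^ 2) / 2 / Real.sqrt N + 1 / t.im / N) := by
        gcongr with j _
        exact hj j
    _ = _ := by
        rw [Finset.sum_const, Finset.card_univ, Fintype.card_fin, nsmul_eq_mul, ← hN]
        rw [← mul_assoc]
        congr 1
        rw [hc]
        field_simp

end NormalizedTrace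

/-! ### The limiting quadratic equation and its distinguished root. -/

/-- The equation satisfied by the Stieltjes transform of the limiting spectral distribution,
together with the sign conditions that single out one of its roots. -/
structure IsLimitRoot (α : ℝ) (t m : ℂ) : Prop where
  quadratic : (α : ℂ) * t * m ^ 2 + (t + α - 1) * m + 1 = 0
  im_nonneg : 0 ≤ m.im
  im_mul_nonneg : 0 ≤ (t * m).im

/-- Distinct roots satisfy Vieta's relation `α t m₁ m₂ = 1`. Grouped as `m₁ · (t m₂)` and `(t m₁) ·
m₂`, it makes both `m₁` and `t m₁` real, and `t` is not real, so `m₁ = 0`: a contradiction. -/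
lemma IsLimitRoot.unique {α : ℝ} (hα : 0 < α) {t m₁ m₂ : ℂ} (ht : 0 < t.im)
    (h₁ : IsLimitRoot α t m₁) (h₂ : IsLimitRoot α t m₂) : m₁ = m₂ := by
  by_contra hne
  have hα' : (α : ℂ) ≠ 0 := by exact_mod_cast hα.ne'
  have hd : m₁ - m₂ ≠ 0 := sub_ne_zero.2 hne
  have hsum : (α : ℂ) * t * (m₁ + m₂) + (t + α - 1) = 0 := by
    refine (mul_eq_zero.1 (?_ : (m₁ - m₂) * _ = 0)).resolve_left hd
    linear_combination h₁.quadratic - h₂.quadratic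
  have hprod : (α : ℂ) * (m₁ * (t * m₂)) = 1 := by
    linear_combination m₁ * hsum - h₁.quadratic
  have hprod' : (α : ℂ) * (m₂ * (t * m₁)) = 1 := by linear_combination hprod
  -- If `ab > 0`, then `b` is a positive multiple of the conjugate of `a`, so the imaginary parts
  -- have opposite signs.
  have key : ∀ {a b : ℂ}, (α : ℂ) * (a * b) = 1 → 0 ≤ a.im → 0 ≤ b.im → a.im = 0 := by
    intro a b hab ha hb
    have him : a.re * b.im + a.im * b.re = 0 := by
      have := congrArg Complex.im hab
      simpa [hα.ne'] using this
    have hre : α * (a.re * b.re - a.im * b.im) = 1 := by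
      have := congrArg Complex.re hab
      simpa using this
    by_contra h0
    have ha' : 0 < a.im := lt_of_le_of_ne ha (Ne.symm h0)
    have h1 : α * (b.im * (a.re ^ 2 + a.im ^ 2)) = -a.im := by
      linear_combination α * a.re * him - a.im * hre
    nlinarith [mul_nonneg hα.le (mul_nonneg hb (add_nonneg (sq_nonneg a.re) (sq_nonneg a.im)))]
  have e1 := key hprod h₁.im_nonneg h₂.im_mul_nonneg
  have e2 := key (a := t * m₁) (b := m₂) (by linear_combination hprod) h₁.im_mul_nonneg h₂.im_nonneg
  have e3 : m₁.re = 0 := by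
    rw [Complex.mul_im, e1, mul_zero, zero_add] at e2
    exact (mul_eq_zero.1 e2).resolve_left ht.ne'
  have : m₁ = 0 := Complex.ext e3 e1
  rw [this, zero_mul, mul_zero] at hprod
  exact zero_ne_one hprod

/-- The sequence is bounded and every subsequential limit is a distinguished root, of which there is
only one. -/
lemma exists_tendsto_isLimitRoot {α : ℝ} (hα : 0 < α) {t : ℂ} (ht : 0 < t.im) {c : ℕ → ℝ}
    (hc : Tendsto c atTop (𝓝 α)) {x : ℕ → ℂ} {B : ℝ} (hB : ∀ n, ‖x n‖ ≤ B)
    (him : ∀ n, 0 ≤ (x n).im) (himt : ∀ n, 0 ≤ (t * x n).im)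
    (hF : Tendsto (fun n => (c n : ℂ) * t * x n ^ 2 + (t + c n - 1) * x n + 1) atTop (𝓝 0)) :
    ∃ m, IsLimitRoot α t m ∧ Tendsto x atTop (𝓝 m) := by
  have hlim : ∀ φ : ℕ → ℕ, StrictMono φ → ∀ m, Tendsto (x ∘ φ) atTop (𝓝 m) →
      IsLimitRoot α t m := by
    intro φ hφ m hm
    refine ⟨?_, ?_, ?_⟩
    · have hc' : Tendsto (fun n => (c (φ n) : ℂ)) atTop (𝓝 (α : ℂ)) :=
        (Complex.continuous_ofReal.tendsto α).comp (hc.comp hφ.tendsto_atTop)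
      have h1 : Tendsto (fun n => (c (φ n) : ℂ) * t * x (φ n) ^ 2 + (t + c (φ n) - 1) * x (φ n) + 1)
          atTop (𝓝 ((α : ℂ) * t * m ^ 2 + (t + α - 1) * m + 1)) :=
        (((hc'.mul_const t).mul (hm.pow 2)).add
          (((hc'.const_add t).sub_const 1).mul hm)).add_const 1
      exact tendsto_nhds_unique h1 (hF.comp hφ.tendsto_atTop)
    · exact ge_of_tendsto' ((Complex.continuous_im.tendsto m).comp hm) fun n => him _
    · exact ge_of_tendsto' ((Complex.continuous_im.tendsto _).comp (hm.const_mul t))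
        fun n => himt _
  have hcpt : IsCompact (Metric.closedBall (0 : ℂ) B) := isCompact_closedBall _ _
  have hmem : ∀ n, x n ∈ Metric.closedBall (0 : ℂ) B := fun n => by simpa using hB n
  obtain ⟨m, -, φ, hφ, hm⟩ := hcpt.tendsto_subseq hmem
  refine ⟨m, hlim φ hφ m hm, tendsto_of_subseq_tendsto fun ns hns => ?_⟩
  obtain ⟨ψ, hψ, hnsψ⟩ := strictMono_subseq_of_tendsto_atTop hns
  obtain ⟨m', -, χ, hχ, hm'⟩ := hcpt.tendsto_subseq fun n => hmem (ns (ψ n))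
  refine ⟨ψ ∘ χ, ?_⟩
  have := hlim _ (hnsψ.comp hχ) m' hm'
  rw [(hlim φ hφ m hm).unique hα ht this]
  exact hm'

/-! ### Concentration and almost sure convergence of the Stieltjes transforms. -/

/-- Concentration of the normalized trace of the resolvent. -/
lemma measureReal_normTrace_sub_ge_le {k n : ℕ} (hk : k ≠ 0) {t : ℂ} (ht : 0 < t.im) {ε : ℝ}
    (hε : 0 ≤ ε) :
    (colLaw k n).real {x | 2 * ε ≤ ‖normTrace t x - ∫ y, normTrace t y ∂(colLaw k n)‖} ≤
      4 * Real.exp (-(ε ^ 2 * t.im ^ 2 * k ^ 2 / (8 * n))) := by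
  have hcont := continuous_normTrace (k := k) (n := n) ht.ne'
  have hintg : Integrable (normTrace t) (colLaw k n) :=
    Integrable.of_bound hcont.aestronglyMeasurable (1 / t.im)
      (Eventually.of_forall fun x => norm_normTrace_le ht x)
  have hk0 : (0 : ℝ) < k := by positivity
  have e : -ε ^ 2 / (2 * (n * (2 / (k * t.im)) ^ 2)) = -(ε ^ 2 * t.im ^ 2 * k ^ 2 / (8 * n)) := by
    field_simp
    norm_num
  have hre := measureReal_abs_sub_integral_ge_le (n := n)
    (Measure.pi fun _ : Fin k => complexGaussian (n : NNReal)⁻¹)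
    (f := fun x => (normTrace t x).re) (Complex.measurable_re.comp hcont.measurable)
    (fun x => (Complex.abs_re_le_norm _).trans (norm_normTrace_le ht x))
    (c := 2 / (k * t.im)) (by positivity)
    (fun i x y hxy => by
      rw [← Complex.sub_re]
      exact (Complex.abs_re_le_norm _).trans (norm_normTrace_sub_le ht i x y hxy)) hε
  have him := measureReal_abs_sub_integral_ge_le (n := n)
    (Measure.pi fun _ : Fin k => complexGaussian (n : NNReal)⁻¹)
    (f := fun x => (normTrace t x).im) (Complex.measurable_im.comp hcont.measurable)
    (fun x => (Complex.abs_im_le_norm _).trans (norm_normTrace_le ht x))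
    (c := 2 / (k * t.im)) (by positivity)
    (fun i x y hxy => by
      rw [← Complex.sub_im]
      exact (Complex.abs_im_le_norm _).trans (norm_normTrace_sub_le ht i x y hxy)) hε
  rw [e] at hre him
  change (colLaw k n).real {x | ε ≤ |(normTrace t x).re - ∫ y, (normTrace t y).re ∂(colLaw k n)|}
    ≤ _ at hre
  change (colLaw k n).real {x | ε ≤ |(normTrace t x).im - ∫ y, (normTrace t y).im ∂(colLaw k n)|}
    ≤ _ at him
  have e1 : ∫ y, (normTrace t y).re ∂(colLaw k n) = (∫ y, normTrace t y ∂(colLaw k n)).re :=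
    integral_re hintg
  have e2 : ∫ y, (normTrace t y).im ∂(colLaw k n) = (∫ y, normTrace t y ∂(colLaw k n)).im :=
    integral_im hintg
  rw [e1] at hre
  rw [e2] at him
  have hsub : {x : Fin n → Fin k → ℂ | 2 * ε ≤ ‖normTrace t x - ∫ y, normTrace t y ∂(colLaw k n)‖} ⊆
      {x | ε ≤ |(normTrace t x).re - (∫ y, normTrace t y ∂(colLaw k n)).re|} ∪
      {x | ε ≤ |(normTrace t x).im - (∫ y, normTrace t y ∂(colLaw k n)).im|} := by
    intro x hx
    by_contra hcon
    simp only [Set.mem_union, Set.mem_ofPred_eq, not_or, not_le] at hcon hx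
    have := Complex.norm_le_abs_re_add_abs_im (normTrace t x - ∫ y, normTrace t y ∂(colLaw k n))
    rw [Complex.sub_re, Complex.sub_im] at this
    linarith [hcon.1, hcon.2]
  refine (measureReal_mono hsub).trans ((measureReal_union_le _ _).trans ?_)
  linarith

lemma eventually_pos_of_ratio {α : ℝ} (hα : 0 < α) {K : ℕ → ℕ}
    (hK : Tendsto (fun N : ℕ => (K N : ℝ) / (N : ℝ)) atTop (𝓝 α)) :
    ∀ᶠ N in atTop, 0 < N ∧ K N ≠ 0 ∧ α / 2 < (K N : ℝ) / N ∧ (K N : ℝ) / N < 2 * α := by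
  filter_upwards [hK.eventually (lt_mem_nhds (half_lt_self hα)),
    hK.eventually (gt_mem_nhds (show α < 2 * α by linarith)), eventually_gt_atTop 0] with N h1 h2 h3
  refine ⟨h3, fun h => ?_, h1, h2⟩
  rw [h, Nat.cast_zero, zero_div] at h1
  linarith

/-- The probability bounds of `measureReal_normTrace_sub_ge_le` are eventually exponentially
small. -/
lemma eventually_measureReal_normTrace_sub_ge_le {α : ℝ} (hα : 0 < α) {K : ℕ → ℕ}
    (hK : Tendsto (fun N : ℕ => (K N : ℝ) / (N : ℝ)) atTop (𝓝 α)) {t : ℂ} (ht : 0 < t.im) {ε : ℝ}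
    (hε : 0 ≤ ε) :
    ∀ᶠ N in atTop, (colLaw (K N) N).real
      {x | 2 * ε ≤ ‖normTrace t x - ∫ y, normTrace t y ∂(colLaw (K N) N)‖} ≤
        4 * Real.exp (-(ε ^ 2 * t.im ^ 2 * α ^ 2 / 32)) ^ N := by
  filter_upwards [eventually_pos_of_ratio hα hK] with N ⟨hN, hk, h1, _⟩
  refine (measureReal_normTrace_sub_ge_le hk ht hε).trans ?_
  rw [← Real.exp_nat_mul]
  gcongr
  have hN' : (0 : ℝ) < N := by exact_mod_cast hN
  rw [lt_div_iff₀ hN'] at h1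
  have h2 : (α / 2 * N) ^ 2 ≤ (K N : ℝ) ^ 2 := pow_le_pow_left₀ (by positivity) h1.le 2
  rw [mul_neg, neg_le_neg_iff, le_div_iff₀ (by positivity)]
  have h3 : 0 ≤ ε ^ 2 * t.im ^ 2 := by positivity
  calc _ = ε ^ 2 * t.im ^ 2 * (α / 2 * N) ^ 2 := by ring
    _ ≤ _ := by gcongr

lemma integral_normTrace_isBounded {k n : ℕ} {t : ℂ} (ht : 0 < t.im) :
    ‖∫ y, normTrace t y ∂(colLaw k n)‖ ≤ 1 / t.im ∧ 0 ≤ (∫ y, normTrace t y ∂(colLaw k n)).im ∧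
      0 ≤ (t * ∫ y, normTrace t y ∂(colLaw k n)).im := by
  have hintg : Integrable (normTrace t) (colLaw k n) :=
    Integrable.of_bound (continuous_normTrace ht.ne').aestronglyMeasurable (1 / t.im)
      (Eventually.of_forall fun x => norm_normTrace_le ht x)
  refine ⟨?_, ?_, ?_⟩
  · simpa using norm_integral_le_of_norm_le_const (μ := colLaw k n)
      (Eventually.of_forall fun x => norm_normTrace_le ht x)
  · have : ∫ y, (normTrace t y).im ∂(colLaw k n) = (∫ y, normTrace t y ∂(colLaw k n)).im :=
      integral_im hintg
    rw [← this]
    exact integral_nonneg fun x => im_normTrace_nonneg ht x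
  · rw [← integral_const_mul]
    have : ∫ y, (t * normTrace t y).im ∂(colLaw k n) = (∫ y, t * normTrace t y ∂(colLaw k n)).im :=
      integral_im (hintg.const_mul t)
    rw [← this]
    exact integral_nonneg fun x => im_mul_normTrace_nonneg ht x

/-- The quadratic holds approximately on average, but averaging does not commute with squaring.
Concentration repairs this: the mean is close to the value at one sample where the quadratic is
small. -/
lemma tendsto_quadratic_integral_normTrace {α : ℝ} (hα : 0 < α) {K : ℕ → ℕ}
    (hK : Tendsto (fun N : ℕ => (K N : ℝ) / (N : ℝ)) atTop (𝓝 α)) {t : ℂ} (ht : 0 < t.im) :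
    Tendsto (fun N : ℕ => (((K N : ℝ) / (N : ℝ) : ℝ) : ℂ) * t *
      (∫ y, normTrace t y ∂(colLaw (K N) N)) ^ 2 + (t + (((K N : ℝ) / (N : ℝ) : ℝ) : ℂ) - 1) *
        (∫ y, normTrace t y ∂(colLaw (K N) N)) + 1) atTop (𝓝 0) := by
  set c : ℕ → ℝ := fun N => (K N : ℝ) / (N : ℝ) with hc
  set M : ℕ → ℂ := fun N => ∫ y, normTrace t y ∂(colLaw (K N) N) with hM
  have hbound : Tendsto (fun N : ℕ => ‖t‖ / (t.im * c N) *
      ((1 + (2 * fourthMoment + 2) * c N / t.im ^ 2) / 2 / Real.sqrt (N : ℝ) +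
        1 / t.im / (N : ℝ))) atTop (𝓝 0) := by
    have h1 : Tendsto (fun N : ℕ => ‖t‖ / (t.im * c N)) atTop (𝓝 (‖t‖ / (t.im * α))) :=
      tendsto_const_nhds.div (hK.const_mul _) (by positivity)
    have h2 : Tendsto (fun N : ℕ => (1 + (2 * fourthMoment + 2) * c N / t.im ^ 2) / 2) atTop
        (𝓝 ((1 + (2 * fourthMoment + 2) * α / t.im ^ 2) / 2)) :=
      (((hK.const_mul _).div_const _).const_add 1).div_const 2
    have h3 := h2.div_atTop (Real.tendsto_sqrt_atTop.comp tendsto_natCast_atTop_atTop)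
    have h4 : Tendsto (fun N : ℕ => 1 / t.im / (N : ℝ)) atTop (𝓝 0) :=
      tendsto_const_nhds.div_atTop tendsto_natCast_atTop_atTop
    simpa using h1.mul (h3.add h4)
  -- A Lipschitz constant for the quadratic on the disc of radius `1/Im t`, valid as soon as `c N <
  -- 2α`.
  set L : ℝ := 2 * α * ‖t‖ * (2 / t.im) + (‖t‖ + 2 * α + 1) with hL
  have hL0 : 0 ≤ L := by positivity
  rw [Metric.tendsto_atTop']
  suffices h : ∀ ε > 0, ∀ᶠ N in atTop,
      ‖(c N : ℂ) * t * M N ^ 2 + (t + c N - 1) * M N + 1‖ < ε + L * (2 * ε) by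
    intro δ hδ
    have hε : 0 < δ / (1 + 2 * L) := by positivity
    obtain ⟨N₀, hN₀⟩ := eventually_atTop.1 (h _ hε)
    refine ⟨N₀, fun N hN => ?_⟩
    rw [dist_zero_right]
    refine (hN₀ N hN.le).trans_eq ?_
    field_simp
  intro ε hε
  have hexp : Real.exp (-(ε ^ 2 * t.im ^ 2 * α ^ 2 / 32)) < 1 := by
    rw [Real.exp_lt_one_iff]
    have : 0 < ε ^ 2 * t.im ^ 2 * α ^ 2 / 32 := by positivity
    linarith
  have hpow : Tendsto (fun N : ℕ => 4 * Real.exp (-(ε ^ 2 * t.im ^ 2 * α ^ 2 / 32)) ^ N) atTop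
      (𝓝 0) := by
    simpa using (tendsto_pow_atTop_nhds_zero_of_lt_one (Real.exp_nonneg _) hexp).const_mul 4
  filter_upwards [eventually_pos_of_ratio hα hK,
    eventually_measureReal_normTrace_sub_ge_le hα hK ht hε.le,
    hpow.eventually (gt_mem_nhds (show (0 : ℝ) < 1 / 2 by norm_num)),
    hbound.eventually (gt_mem_nhds (show (0 : ℝ) < ε / 2 by positivity))]
    with N ⟨hN, hk, _, hc2⟩ h1 h2 h3
  set F : ℂ → ℂ := fun m => (c N : ℂ) * t * m ^ 2 + (t + c N - 1) * m + 1 with hF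
  have hFint : Integrable (fun x => ‖F (normTrace t x)‖) (colLaw (K N) N) := by
    have hcont : Continuous fun x : Fin N → Fin (K N) → ℂ => ‖F (normTrace t x)‖ := by
      have := continuous_normTrace (k := K N) (n := N) ht.ne'
      simp only [hF]
      fun_prop
    refine Integrable.of_bound hcont.aestronglyMeasurable
      (‖(c N : ℂ) * t‖ * (1 / t.im) ^ 2 + ‖t + c N - 1‖ * (1 / t.im) + 1)
      (Eventually.of_forall fun x => ?_)
    have hx := norm_normTrace_le ht x
    rw [norm_norm]
    refine (norm_add_le _ _).trans (add_le_add ((norm_add_le _ _).trans (add_le_add ?_ ?_)) ?_)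
    · rw [norm_mul, norm_pow]; gcongr
    · rw [norm_mul]; gcongr
    · simp
  have hexpF : ∫ x, ‖F (normTrace t x)‖ ∂(colLaw (K N) N) < ε / 2 := by
    obtain ⟨n, rfl⟩ : ∃ n, N = n + 1 := ⟨N - 1, by omega⟩
    exact (integral_norm_quadratic_normTrace_le hk ht rfl).trans_lt h3
  have hmarkov : (colLaw (K N) N).real {x | ε ≤ ‖F (normTrace t x)‖} < 1 / 2 := by
    have := mul_meas_ge_le_integral_of_nonneg (Eventually.of_forall fun x => norm_nonneg _) hFint ε
    by_contra! hcon
    nlinarith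
  -- Both bad events have probability below `1/2`, by concentration and by Markov's inequality, so
  -- they do not cover the space.
  obtain ⟨x, hx1, hx2⟩ : ∃ x : Fin N → Fin (K N) → ℂ, ‖normTrace t x - M N‖ < 2 * ε ∧
      ‖F (normTrace t x)‖ < ε := by
    by_contra! hcon
    have hun : (Set.univ : Set (Fin N → Fin (K N) → ℂ)) ⊆
        {x | 2 * ε ≤ ‖normTrace t x - M N‖} ∪ {x | ε ≤ ‖F (normTrace t x)‖} := fun x _ => by
      by_cases hx : 2 * ε ≤ ‖normTrace t x - M N‖
      · exact Or.inl hx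
      · exact Or.inr (hcon x (not_le.1 hx))
    have := (measureReal_mono (μ := colLaw (K N) N) hun).trans (measureReal_union_le _ _)
    rw [probReal_univ] at this
    linarith
  have hx := norm_normTrace_le ht x
  have hMb := (integral_normTrace_isBounded (k := K N) (n := N) ht).1
  have hcN : ‖(c N : ℂ)‖ ≤ 2 * α := by
    rw [Complex.norm_real, Real.norm_of_nonneg (by positivity)]
    exact hc2.le
  have hdiff : F (M N) = F (normTrace t x) -
      ((c N : ℂ) * t * (normTrace t x + M N) + (t + c N - 1)) * (normTrace t x - M N) := by
    simp only [hF]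
    ring
  change ‖F (M N)‖ < _
  rw [hdiff]
  refine (norm_sub_le _ _).trans_lt (add_lt_add_of_lt_of_le hx2 ?_)
  rw [norm_mul]
  refine mul_le_mul ?_ hx1.le (norm_nonneg _) hL0
  refine (norm_add_le _ _).trans (add_le_add ?_ ?_)
  · rw [norm_mul, norm_mul]
    have : ‖normTrace t x + M N‖ ≤ 2 / t.im := by
      refine (norm_add_le _ _).trans ((add_le_add hx hMb).trans_eq ?_)
      ring
    gcongr
  · refine (norm_sub_le _ _).trans ?_
    rw [norm_one]
    have := norm_add_le t (c N : ℂ)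
    linarith

lemma hasLaw_columns {Ω : Type*} [MeasurableSpace Ω] {P : Measure Ω} [IsProbabilityMeasure P]
    {K : ℕ → ℕ} {H : ∀ N : ℕ, Ω → Matrix (Fin (K N)) (Fin N) ℂ} (hH : IsGaussianEnsemble P K H)
    (N : ℕ) : HasLaw (fun ω (j : Fin N) (i : Fin (K N)) => H N ω i j) (colLaw (K N) N) P := by
  obtain ⟨hlaw, hind⟩ := hH N
  have hind' : iIndepFun (fun (p : Fin N × Fin (K N)) (ω : Ω) => H N ω p.2 p.1) P :=
    hind.precomp (g := Prod.swap) Prod.swap_injective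
  have h1 := hind'.hasLaw_infinitePi (μ := fun _ => complexGaussian ((N : NNReal)⁻¹))
    (fun p : Fin N × Fin (K N) => hlaw p.2 p.1)
    (aemeasurable_pi_lambda _ fun p : Fin N × Fin (K N) => (hlaw p.2 p.1).aemeasurable)
  have h2 : HasLaw (MeasurableEquiv.curry (Fin N) (Fin (K N)) ℂ) (colLaw (K N) N)
      (Measure.infinitePi fun _ : Fin N × Fin (K N) => complexGaussian ((N : NNReal)⁻¹)) := by
    refine ⟨(MeasurableEquiv.measurable _).aemeasurable, ?_⟩
    rw [Measure.infinitePi_map_curry (fun _ _ => complexGaussian ((N : NNReal)⁻¹)),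
      Measure.infinitePi_eq_pi, colLaw]
    congr 1
    funext j
    rw [Measure.infinitePi_eq_pi]
  exact h2.comp h1

/-- The first Borel–Cantelli lemma, which needs no independence; hence the joint law of the matrices
for different `N` is irrelevant. -/
lemma ae_tendsto_zero_of_summable {Ω : Type*} [MeasurableSpace Ω] {P : Measure Ω}
    [IsFiniteMeasure P] {E : Type*} [NormedAddCommGroup E] {X : ℕ → Ω → E}
    (h : ∀ ε > 0, ∃ b : ℕ → ℝ, Summable b ∧ ∀ᶠ n in atTop, P.real {ω | ε ≤ ‖X n ω‖} ≤ b n) :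
    ∀ᵐ ω ∂P, Tendsto (fun n => X n ω) atTop (𝓝 0) := by
  have key : ∀ ε > 0, ∀ᵐ ω ∂P, ∀ᶠ n in atTop, ‖X n ω‖ < ε := by
    intro ε hε
    obtain ⟨b, hb, hle⟩ := h ε hε
    obtain ⟨n₀, hn₀⟩ := eventually_atTop.1 hle
    have hsum : Summable fun n => P.real {ω | ε ≤ ‖X (n + n₀) ω‖} :=
      Summable.of_nonneg_of_le (fun n => measureReal_nonneg) (fun n => hn₀ _ (by omega))
        ((summable_nat_add_iff n₀).2 hb)
    have hne : ∑' n, P {ω | ε ≤ ‖X (n + n₀) ω‖} ≠ ⊤ := by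
      have e : ∀ n, P {ω | ε ≤ ‖X (n + n₀) ω‖} =
          ENNReal.ofReal (P.real {ω | ε ≤ ‖X (n + n₀) ω‖}) := fun n => by
        rw [ofReal_measureReal]
      simp only [e]
      rw [← ENNReal.ofReal_tsum_of_nonneg (fun n => measureReal_nonneg) hsum]
      exact ENNReal.ofReal_ne_top
    filter_upwards [ae_eventually_notMem hne] with ω hω
    have hω' : ∀ᶠ n in atTop, ‖X (n + n₀) ω‖ < ε := hω.mono fun n hn => not_le.1 hn
    obtain ⟨n₁, hn₁⟩ := eventually_atTop.1 hω'
    filter_upwards [eventually_ge_atTop (n₁ + n₀)] with n hn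
    have := hn₁ (n - n₀) (by omega)
    rwa [Nat.sub_add_cancel (by omega)] at this
  have hall : ∀ᵐ ω ∂P, ∀ k : ℕ, ∀ᶠ n in atTop, ‖X n ω‖ < 1 / ((k : ℝ) + 1) :=
    ae_all_iff.2 fun k => key _ Nat.one_div_pos_of_nat
  filter_upwards [hall] with ω hω
  rw [Metric.tendsto_nhds]
  intro ε hε
  obtain ⟨k, hk⟩ := exists_nat_one_div_lt hε
  filter_upwards [hω k] with n hn
  rw [dist_zero_right]
  exact hn.trans hk

lemma stieltjes_toExt (ν : Measure ℝ) (t : ℂ) :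
    stieltjes (toExt ν) t = ∫ x : ℝ, 1 / ((x : ℂ) - t) ∂ν := by
  rw [stieltjes, toExt, integral_map OnePoint.continuous_coe.measurable.aemeasurable
    (measurable_stieltjesKernel t).aestronglyMeasurable]
  rfl

lemma integral_spectralDist {k : ℕ} {A : Matrix (Fin k) (Fin k) ℂ} (hA : A.IsHermitian)
    {F : Type*} [NormedAddCommGroup F] [NormedSpace ℝ F] [CompleteSpace F] (f : ℝ → F) :
    ∫ x, f x ∂(spectralDist hA) = (k : ℝ)⁻¹ • ∑ i, f (hA.eigenvalues i) := by
  rw [spectralDist, integral_smul_measure, integral_finsetSum_measure fun i _ =>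
    integrable_dirac (by simp)]
  simp [integral_dirac]

lemma stieltjes_spectralDist {k n : ℕ} (B : Matrix (Fin k) (Fin n) ℂ) {t : ℂ} (ht : t.im ≠ 0) :
    stieltjes (toExt (spectralDist (Matrix.isHermitian_mul_conjTranspose_self B))) t =
      normTrace t fun j i => B i j := by
  rw [stieltjes_toExt, integral_spectralDist, normTrace, ← mul_conjTranspose_eq_colGram,
    trace_green_eq_sum (Matrix.isHermitian_mul_conjTranspose_self B) ht, div_eq_inv_mul,
    Complex.real_smul]
  push_cast
  rfl

/-- Almost sure convergence of the Stieltjes transforms of the spectral distributions. -/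
theorem ae_tendsto_stieltjes_spectralDist {α : ℝ} (hα : 0 < α) {t : ℂ} (ht : 0 < t.im)
    {Ω : Type*} [MeasurableSpace Ω] {P : Measure Ω} [IsProbabilityMeasure P]
    {K : ℕ → ℕ} {H : ∀ N : ℕ, Ω → Matrix (Fin (K N)) (Fin N) ℂ}
    (hK : Tendsto (fun N : ℕ => (K N : ℝ) / (N : ℝ)) atTop (𝓝 α))
    (hH : IsGaussianEnsemble P K H) :
    ∃ m, IsLimitRoot α t m ∧ ∀ᵐ ω ∂P, Tendsto (fun N => stieltjes (toExt (spectralDist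
      (Matrix.isHermitian_mul_conjTranspose_self (H N ω)))) t) atTop (𝓝 m) := by
  obtain ⟨m, hm, hlim⟩ := exists_tendsto_isLimitRoot hα ht hK
    (x := fun N => ∫ y, normTrace t y ∂(colLaw (K N) N))
    (fun N => (integral_normTrace_isBounded ht).1) (fun N => (integral_normTrace_isBounded ht).2.1)
    (fun N => (integral_normTrace_isBounded ht).2.2)
    (tendsto_quadratic_integral_normTrace hα hK ht)
  refine ⟨m, hm, ?_⟩
  simp only [stieltjes_spectralDist _ ht.ne']
  have hdiff : ∀ᵐ ω ∂P, Tendsto (fun N => normTrace t (fun j i => H N ω i j) -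
      ∫ y, normTrace t y ∂(colLaw (K N) N)) atTop (𝓝 0) := by
    refine ae_tendsto_zero_of_summable fun ε hε => ?_
    refine ⟨fun N => 4 * Real.exp (-((ε / 2) ^ 2 * t.im ^ 2 * α ^ 2 / 32)) ^ N, ?_, ?_⟩
    · refine (summable_geometric_of_lt_one (Real.exp_nonneg _) ?_).mul_left 4
      rw [Real.exp_lt_one_iff]
      have : 0 < (ε / 2) ^ 2 * t.im ^ 2 * α ^ 2 / 32 := by positivity
      linarith
    · filter_upwards [eventually_measureReal_normTrace_sub_ge_le hα hK ht (half_pos hε).le]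
        with N hN
      refine le_trans (le_of_eq ?_) hN
      rw [mul_div_cancel₀ _ two_ne_zero]
      have hlaw := hasLaw_columns hH N
      have hmeas : MeasurableSet {x : Fin N → Fin (K N) → ℂ |
          ε ≤ ‖normTrace t x - ∫ y, normTrace t y ∂(colLaw (K N) N)‖} :=
        measurableSet_le measurable_const
          ((continuous_normTrace ht.ne').measurable.sub_const _).norm
      have hpre := map_measureReal_apply_of_aemeasurable hlaw.aemeasurable hmeas
      rw [hlaw.map_eq] at hpre
      exact hpre.symm
  filter_upwards [hdiff] with ω hω
  simpa using hω.add hlim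

/-! ### From convergence of Stieltjes transforms to weak convergence. -/

lemma norm_stieltjesKernel_le_of_im {t : ℂ} (ht : t.im ≠ 0) (x : OnePoint ℝ) :
    ‖stieltjesKernel t x‖ ≤ 1 / |t.im| :=
  norm_stieltjesKernel_le (abs_pos.2 ht) fun y _ => by
    simpa using Complex.abs_im_le_norm ((y : ℂ) - t)

lemma continuous_stieltjesKernel {t : ℂ} (ht : t.im ≠ 0) : Continuous (stieltjesKernel t) := by
  have hne : ∀ x : ℝ, (x : ℂ) - t ≠ 0 := fun x h => ht (by simpa using congrArg Complex.im h)
  rw [OnePoint.continuous_iff]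
  constructor
  · rw [coclosedCompact_eq_cocompact, ← Metric.cobounded_eq_cocompact, stieltjesKernel_infty]
    simp only [stieltjesKernel_coe, one_div]
    refine tendsto_inv₀_cobounded.comp ?_
    rw [← tendsto_norm_atTop_iff_cobounded]
    refine tendsto_atTop_mono (f := fun x : ℝ => ‖x‖ - ‖t‖) (fun x => ?_)
      (tendsto_atTop_add_const_right _ _ tendsto_norm_cobounded_atTop)
    rw [← Complex.norm_real]
    exact norm_sub_norm_le _ _
  · simp only [stieltjesKernel_coe]
    exact continuous_const.div (by fun_prop) hne

open Classical in
/-- The Stieltjes kernel as a continuous function on `ℝ ∪ {∞}`, for non-real `t`. -/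
def kernelMap (t : ℂ) : C(OnePoint ℝ, ℂ) :=
  if h : t.im ≠ 0 then ⟨stieltjesKernel t, continuous_stieltjesKernel h⟩ else 0

lemma kernelMap_apply {t : ℂ} (ht : t.im ≠ 0) (x : OnePoint ℝ) :
    kernelMap t x = stieltjesKernel t x := by
  rw [kernelMap, dif_pos ht]
  rfl

/-- The resolvent identity: it puts products of distinct kernels into the linear span of kernels,
and gives continuity in the parameter. -/
lemma kernelMap_sub {s t : ℂ} (hs : s.im ≠ 0) (ht : t.im ≠ 0) :
    kernelMap s - kernelMap t = (s - t) • (kernelMap s * kernelMap t) := by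
  ext x
  simp only [ContinuousMap.sub_apply, ContinuousMap.smul_apply, ContinuousMap.mul_apply,
    kernelMap_apply hs, kernelMap_apply ht, smul_eq_mul]
  induction x using OnePoint.rec with
  | infty => simp [stieltjesKernel_infty]
  | coe x =>
    have h1 : (x : ℂ) - s ≠ 0 := fun h => hs (by simpa using congrArg Complex.im h)
    have h2 : (x : ℂ) - t ≠ 0 := fun h => ht (by simpa using congrArg Complex.im h)
    rw [stieltjesKernel_coe, stieltjesKernel_coe]
    field_simp
    ring

lemma norm_kernelMap_le {t : ℂ} (ht : t.im ≠ 0) : ‖kernelMap t‖ ≤ 1 / |t.im| := by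
  rw [ContinuousMap.norm_le _ (by positivity)]
  intro x
  rw [kernelMap_apply ht]
  exact norm_stieltjesKernel_le_of_im ht x

lemma star_kernelMap {t : ℂ} (ht : t.im ≠ 0) : star (kernelMap t) = kernelMap (star t) := by
  have ht' : (star t).im ≠ 0 := by simpa using ht
  ext x
  rw [ContinuousMap.star_apply, kernelMap_apply ht, kernelMap_apply ht']
  induction x using OnePoint.rec with
  | infty => simp [stieltjesKernel_infty]
  | coe x =>
    rw [stieltjesKernel_coe, stieltjesKernel_coe]
    simp

lemma continuousAt_kernelMap {t : ℂ} (ht : t.im ≠ 0) : ContinuousAt kernelMap t := by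
  have hpos : 0 < |t.im| := abs_pos.2 ht
  have h1 : Tendsto (fun s : ℂ => ‖s - t‖ * (1 / |s.im| * (1 / |t.im|))) (𝓝 t) (𝓝 0) := by
    have : ContinuousAt (fun s : ℂ => ‖s - t‖ * (1 / |s.im| * (1 / |t.im|))) t := by
      refine ContinuousAt.mul (by fun_prop) (ContinuousAt.mul (ContinuousAt.div (by fun_prop) ?_
        hpos.ne') (by fun_prop))
      exact Complex.continuous_im.continuousAt.abs
    simpa [ContinuousAt] using this
  rw [ContinuousAt, tendsto_iff_norm_sub_tendsto_zero]
  refine squeeze_zero' (Eventually.of_forall fun s => norm_nonneg _) ?_ h1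
  filter_upwards [Complex.continuous_im.continuousAt.eventually_ne ht] with s hs
  rw [kernelMap_sub hs ht, norm_smul]
  gcongr
  exact (norm_mul_le _ _).trans (mul_le_mul (norm_kernelMap_le hs) (norm_kernelMap_le ht)
    (norm_nonneg _) (by positivity))

/-- The closed linear span of the constants and the Stieltjes kernels is all of
`C(ℝ ∪ {∞}, ℂ)`. -/
lemma topologicalClosure_span_kernelMap :
    (Submodule.span ℂ (insert 1 (kernelMap '' {t | t.im ≠ 0}))).topologicalClosure = ⊤ := by
  set G : Set C(OnePoint ℝ, ℂ) := insert 1 (kernelMap '' {t | t.im ≠ 0}) with hG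
  set T := (Submodule.span ℂ G).topologicalClosure with hT
  have hle : Submodule.span ℂ G ≤ T := Submodule.le_topologicalClosure _
  have hGT : ∀ g ∈ G, g ∈ T := fun g hg => hle (Submodule.subset_span hg)
  have hTc : IsClosed (T : Set C(OnePoint ℝ, ℂ)) := Submodule.isClosed_topologicalClosure _
  have hker : ∀ {t : ℂ}, t.im ≠ 0 → kernelMap t ∈ T := fun ht =>
    hGT _ (Set.mem_insert_of_mem _ ⟨_, ht, rfl⟩)
  have hmulne : ∀ {s t : ℂ}, s.im ≠ 0 → t.im ≠ 0 → s ≠ t → kernelMap s * kernelMap t ∈ T := by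
    intro s t hs ht hst
    have h1 : s - t ≠ 0 := sub_ne_zero.2 hst
    have h2 : kernelMap s * kernelMap t = (s - t)⁻¹ • (kernelMap s - kernelMap t) := by
      rw [kernelMap_sub hs ht, smul_smul, inv_mul_cancel₀ h1, one_smul]
    rw [h2]
    exact T.smul_mem _ (T.sub_mem (hker hs) (hker ht))
  have hmulker : ∀ {s t : ℂ}, s.im ≠ 0 → t.im ≠ 0 → kernelMap s * kernelMap t ∈ T := by
    intro s t hs ht
    by_cases hst : s = t
    · subst hst
      -- The square of a kernel is not covered by the resolvent identity and is obtained as a limit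
      -- of products with distinct parameters.
      have hlim : Tendsto (fun r => kernelMap r * kernelMap s) (𝓝[≠] s)
          (𝓝 (kernelMap s * kernelMap s)) :=
        ((continuousAt_kernelMap hs).mul continuousAt_const).tendsto.mono_left nhdsWithin_le_nhds
      refine hTc.mem_of_tendsto hlim ?_
      filter_upwards [self_mem_nhdsWithin, nhdsWithin_le_nhds
        (Complex.continuous_im.continuousAt.eventually_ne hs)] with r hr hr'
      exact hmulne hr' hs hr
    · exact hmulne hs ht hst
  have hmulG : ∀ f ∈ G, ∀ g ∈ G, f * g ∈ T := by
    rintro f (rfl | ⟨s, hs, rfl⟩) g hg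
    · rw [one_mul]
      exact hGT g hg
    · rcases hg with rfl | ⟨t, ht, rfl⟩
      · rw [mul_one]
        exact hker hs
      · exact hmulker hs ht
  have hmulspan : ∀ f ∈ Submodule.span ℂ G, ∀ g ∈ Submodule.span ℂ G, f * g ∈ T := by
    intro f hf g hg
    have h1 : Submodule.span ℂ G * Submodule.span ℂ G ≤ T := by
      rw [Submodule.span_mul_span, Submodule.span_le]
      rintro _ ⟨f, hf, g, hg, rfl⟩
      exact hmulG f hf g hg
    exact h1 (Submodule.mul_mem_mul hf hg)
  have hmul : ∀ {f g}, f ∈ T → g ∈ T → f * g ∈ T := by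
    intro f g hf hg
    have := map_mem_closure₂ (f := fun a b : C(OnePoint ℝ, ℂ) => a * b) continuous_mul
      (u := (T : Set C(OnePoint ℝ, ℂ))) (s := (Submodule.span ℂ G : Set C(OnePoint ℝ, ℂ)))
      (t := (Submodule.span ℂ G : Set C(OnePoint ℝ, ℂ))) hf hg
      (fun a ha b hb => hmulspan a ha b hb)
    rwa [hTc.closure_eq] at this
  have hone : (1 : C(OnePoint ℝ, ℂ)) ∈ T := hGT _ (Set.mem_insert _ _)
  have hstarspan : ∀ f ∈ Submodule.span ℂ G, star f ∈ T := by
    intro f hf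
    induction hf using Submodule.span_induction with
    | mem f hf =>
      rcases hf with rfl | ⟨s, hs, rfl⟩
      · rw [star_one]
        exact hone
      · rw [star_kernelMap hs]
        exact hker (by simpa using hs)
    | zero => rw [star_zero]; exact T.zero_mem
    | add f g _ _ hf hg => rw [star_add]; exact T.add_mem hf hg
    | smul c f _ hf => rw [star_smul]; exact T.smul_mem _ hf
  have hstar : ∀ {f}, f ∈ T → star f ∈ T := by
    intro f hf
    have := map_mem_closure (f := fun a : C(OnePoint ℝ, ℂ) => star a) continuous_star
      (t := (T : Set C(OnePoint ℝ, ℂ))) (s := (Submodule.span ℂ G : Set C(OnePoint ℝ, ℂ))) hf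
      (fun a ha => hstarspan a ha)
    rwa [hTc.closure_eq] at this
  -- The closed span is thus a star subalgebra, and Stone–Weierstrass applies; the single kernel at
  -- `I` already separates points.
  let S : StarSubalgebra ℂ C(OnePoint ℝ, ℂ) :=
    { carrier := T
      mul_mem' := hmul
      add_mem' := T.add_mem
      algebraMap_mem' := fun c => by
        rw [Algebra.algebraMap_eq_smul_one]
        exact T.smul_mem c hone
      star_mem' := hstar }
  have hsep : S.SeparatesPoints := by
    intro x y hxy
    refine ⟨kernelMap Complex.I, ⟨kernelMap Complex.I, hker (by simp), rfl⟩, ?_⟩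
    have hI : Complex.I.im ≠ 0 := by simp
    rw [kernelMap_apply hI, kernelMap_apply hI]
    have hne : ∀ x : ℝ, (x : ℂ) - Complex.I ≠ 0 := fun x h => by
      simpa using congrArg Complex.im h
    induction x using OnePoint.rec with
    | infty =>
      induction y using OnePoint.rec with
      | infty => exact absurd rfl hxy
      | coe y =>
        rw [stieltjesKernel_infty, stieltjesKernel_coe]
        exact (one_div_ne_zero (hne y)).symm
    | coe x =>
      induction y using OnePoint.rec with
      | infty =>
        rw [stieltjesKernel_infty, stieltjesKernel_coe]
        exact one_div_ne_zero (hne x)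
      | coe y =>
        rw [stieltjesKernel_coe, stieltjesKernel_coe]
        intro h
        rw [one_div, one_div, inv_inj, sub_left_inj, Complex.ofReal_inj] at h
        exact hxy (by rw [h])
  have htop := ContinuousMap.starSubalgebra_topologicalClosure_eq_top_of_separatesPoints S hsep
  rw [eq_top_iff]
  intro f _
  have hf : f ∈ S.topologicalClosure := by rw [htop]; trivial
  have hf' : f ∈ closure (T : Set C(OnePoint ℝ, ℂ)) := hf
  rwa [hTc.closure_eq] at hf'

lemma integrable_continuousMap {F : Type*} [NormedAddCommGroup F] [SecondCountableTopology F]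
    [MeasurableSpace F] [BorelSpace F] (μ : Measure (OnePoint ℝ)) [IsFiniteMeasure μ]
    (f : C(OnePoint ℝ, F)) : Integrable f μ :=
  Integrable.of_bound f.continuous.measurable.aestronglyMeasurable ‖f‖
    (Eventually.of_forall fun x => f.norm_coe_le_norm x)

/-- The continuous functions whose integrals converge form a closed subspace. -/
def convergenceSubmodule {ι : Type*} (l : Filter ι) (μ : ι → Measure (OnePoint ℝ))
    [∀ n, IsFiniteMeasure (μ n)] (ν : Measure (OnePoint ℝ)) [IsFiniteMeasure ν] :
    Submodule ℂ C(OnePoint ℝ, ℂ) where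
  carrier := {f | Tendsto (fun n => ∫ x, f x ∂(μ n)) l (𝓝 (∫ x, f x ∂ν))}
  add_mem' {f g} hf hg := by
    have h := Tendsto.add (show Tendsto _ _ _ from hf) (show Tendsto _ _ _ from hg)
    change Tendsto (fun n => ∫ x, (f x + g x) ∂(μ n)) l (𝓝 (∫ x, (f x + g x) ∂ν))
    rw [integral_add (integrable_continuousMap ν f) (integrable_continuousMap ν g)]
    refine h.congr fun n => ?_
    rw [integral_add (integrable_continuousMap _ f) (integrable_continuousMap _ g)]
  zero_mem' := by simpa using tendsto_const_nhds
  smul_mem' c f hf := by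
    have h := Tendsto.const_mul c (show Tendsto _ _ _ from hf)
    change Tendsto (fun n => ∫ x, c * f x ∂(μ n)) l (𝓝 (∫ x, c * f x ∂ν))
    simpa only [integral_const_mul] using h

/-- With total masses at most `1` all integrals are contractions for the supremum norm, which is
what a three-epsilon argument needs. -/
lemma isClosed_convergenceSubmodule {ι : Type*} (l : Filter ι) (μ : ι → Measure (OnePoint ℝ))
    [∀ n, IsFiniteMeasure (μ n)] (hμ : ∀ n, (μ n).real Set.univ ≤ 1) (ν : Measure (OnePoint ℝ))
    [IsFiniteMeasure ν] (hν : ν.real Set.univ ≤ 1) :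
    IsClosed (convergenceSubmodule l μ ν : Set C(OnePoint ℝ, ℂ)) := by
  have hbd : ∀ (ρ : Measure (OnePoint ℝ)) [IsFiniteMeasure ρ], ρ.real Set.univ ≤ 1 →
      ∀ f g : C(OnePoint ℝ, ℂ), ‖∫ x, f x ∂ρ - ∫ x, g x ∂ρ‖ ≤ ‖f - g‖ := by
    intro ρ _ hρ f g
    rw [← integral_sub (integrable_continuousMap ρ f) (integrable_continuousMap ρ g)]
    refine (norm_integral_le_of_norm_le_const (C := ‖f - g‖)
      (Eventually.of_forall fun x => (f - g).norm_coe_le_norm x)).trans ?_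
    exact mul_le_of_le_one_right (norm_nonneg _) hρ
  refine isClosed_of_closure_subset fun f hf => ?_
  change Tendsto _ _ _
  rw [Metric.tendsto_nhds]
  intro ε hε
  obtain ⟨g, hg, hfg⟩ := Metric.mem_closure_iff.1 hf (ε / 3) (by positivity)
  rw [dist_eq_norm] at hfg
  have hg' := Metric.tendsto_nhds.1 (show Tendsto _ _ _ from hg) (ε / 3) (by positivity)
  filter_upwards [hg'] with n hn
  rw [dist_eq_norm] at hn ⊢
  have h1 := hbd (μ n) (hμ n) f g
  have h2 := hbd ν hν g f
  rw [norm_sub_rev g f] at h2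
  have h3 : ∫ x, f x ∂(μ n) - ∫ x, f x ∂ν = (∫ x, f x ∂(μ n) - ∫ x, g x ∂(μ n)) +
      (∫ x, g x ∂(μ n) - ∫ x, g x ∂ν) + (∫ x, g x ∂ν - ∫ x, f x ∂ν) := by ring
  rw [h3]
  refine (norm_add₃_le).trans_lt ?_
  linarith

lemma subset_closure_of_dense {Q : Set ℂ} (hQ : Dense Q) :
    {t : ℂ | 0 < t.im} ⊆ closure ({t : ℂ | 0 < t.im} ∩ Q) :=
  hQ.open_subset_closure_inter (isOpen_lt continuous_const Complex.continuous_im)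

/-- Convergence of Stieltjes transforms on a dense set implies weak convergence on `ℝ ∪ {∞}`. -/
theorem weaklyTendsto_of_tendsto_stieltjes {μ : ℕ → Measure (OnePoint ℝ)}
    [∀ n, IsFiniteMeasure (μ n)] (hμ : ∀ n, (μ n).real Set.univ ≤ 1)
    (hμ1 : ∀ᶠ n in atTop, (μ n).real Set.univ = 1) {ν : Measure (OnePoint ℝ)}
    [IsProbabilityMeasure ν] {Q : Set ℂ} (hQ : Dense Q)
    (h : ∀ t ∈ Q, 0 < t.im → Tendsto (fun n => stieltjes (μ n) t) atTop (𝓝 (stieltjes ν t))) :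
    WeaklyTendsto μ ν := by
  set A := convergenceSubmodule atTop μ ν with hA
  have hAc : IsClosed (A : Set C(OnePoint ℝ, ℂ)) :=
    isClosed_convergenceSubmodule atTop μ hμ ν (by simp)
  have hpos : ∀ {t : ℂ}, 0 < t.im → kernelMap t ∈ A := by
    intro t ht
    have hcl := subset_closure_of_dense hQ ht
    have hQA : Set.MapsTo kernelMap ({t : ℂ | 0 < t.im} ∩ Q) A := by
      rintro s ⟨hs, hsQ⟩
      change Tendsto _ _ _
      have hs' : s.im ≠ 0 := (show 0 < s.im from hs).ne'
      simp only [kernelMap_apply hs']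
      exact h s hsQ hs
    have := (continuousAt_kernelMap ht.ne').continuousWithinAt.mem_closure hcl hQA
    rwa [hAc.closure_eq] at this
  -- Conjugation carries the hypothesis from the upper to the lower half-plane.
  have hstar : ∀ {f}, f ∈ A → star f ∈ A := by
    intro f hf
    have h1 := (Complex.continuous_conj.tendsto _).comp (show Tendsto _ _ _ from hf)
    change Tendsto (fun n => ∫ x, star (f x) ∂(μ n)) atTop (𝓝 (∫ x, star (f x) ∂ν))
    simp only [Complex.star_def, integral_conj]
    exact h1
  have hone : (1 : C(OnePoint ℝ, ℂ)) ∈ A := by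
    change Tendsto (fun n => ∫ x, (1 : ℂ) ∂(μ n)) atTop (𝓝 (∫ x, (1 : ℂ) ∂ν))
    refine tendsto_const_nhds.congr' ?_
    filter_upwards [hμ1] with n hn
    simp [hn]
  have htop : A = ⊤ := by
    rw [eq_top_iff, ← topologicalClosure_span_kernelMap]
    refine Submodule.topologicalClosure_minimal _ (Submodule.span_le.2 ?_) hAc
    rintro f (rfl | ⟨t, ht, rfl⟩)
    · exact hone
    · rcases lt_or_gt_of_ne (show t.im ≠ 0 from ht) with h0 | h0
      · have := hstar (hpos (t := star t) (by simpa using h0))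
        rwa [star_kernelMap (by simpa using ht), star_star] at this
      · exact hpos h0
  intro f
  have hf : (⟨fun x => (f x : ℂ), by fun_prop⟩ : C(OnePoint ℝ, ℂ)) ∈ A := by rw [htop]; trivial
  have h1 := (Complex.continuous_re.tendsto _).comp (show Tendsto _ _ _ from hf)
  refine Tendsto.congr (fun n => ?_) (h1.trans (le_of_eq ?_))
  · simp only [Function.comp, ContinuousMap.coe_mk]
    rw [integral_complex_ofReal, Complex.ofReal_re]
  · simp only [ContinuousMap.coe_mk]
    rw [integral_complex_ofReal, Complex.ofReal_re]

lemma measurableEmbedding_coe : MeasurableEmbedding (fun x : ℝ => (x : OnePoint ℝ)) :=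
  OnePoint.isOpenEmbedding_coe.measurableEmbedding

lemma integral_toExt {F : Type*} [NormedAddCommGroup F] [NormedSpace ℝ F] (ν : Measure ℝ)
    (f : OnePoint ℝ → F) : ∫ x, f x ∂(toExt ν) = ∫ x : ℝ, f (x : OnePoint ℝ) ∂ν :=
  measurableEmbedding_coe.integral_map f

instance isProbabilityMeasure_toExt (ν : Measure ℝ) [IsProbabilityMeasure ν] :
    IsProbabilityMeasure (toExt ν) :=
  Measure.isProbabilityMeasure_map OnePoint.continuous_coe.measurable.aemeasurable

instance isFiniteMeasure_toExt (ν : Measure ℝ) [IsFiniteMeasure ν] :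
    IsFiniteMeasure (toExt ν) := by
  unfold toExt
  infer_instance

lemma toExt_real_univ (ν : Measure ℝ) : (toExt ν).real Set.univ = ν.real Set.univ := by
  rw [toExt, map_measureReal_apply OnePoint.continuous_coe.measurable MeasurableSet.univ,
    Set.preimage_univ]

/-- A function on `ℝ` vanishing at infinity, extended to `ℝ ∪ {∞}`. -/
lemma continuous_elim_of_tendsto_zero {f : ℝ → ℝ} (hf : Continuous f)
    (h0 : Tendsto f (Bornology.cobounded ℝ) (𝓝 0)) :
    Continuous fun x : OnePoint ℝ => x.elim (0 : ℝ) f := by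
  rw [OnePoint.continuous_iff]
  refine ⟨?_, by simpa using hf⟩
  rw [coclosedCompact_eq_cocompact, ← Metric.cobounded_eq_cocompact]
  simpa using h0

/-- Weak convergence on `ℝ ∪ {∞}` to a limit without mass at `∞` implies weak convergence
on `ℝ`. -/
theorem weaklyTendsto_of_toExt {μ : ℕ → Measure ℝ} [∀ n, IsFiniteMeasure (μ n)]
    {ν : Measure ℝ} [IsFiniteMeasure ν]
    (h : WeaklyTendsto (fun n => toExt (μ n)) (toExt ν)) : WeaklyTendsto μ ν := by
  intro f
  -- Cutoffs vanishing at infinity and tending to `1` pointwise: `f χ_k` extends continuously to `∞`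
  -- although `f` itself need not.
  set χ : ℕ → ℝ → ℝ := fun k x => 1 / (1 + x ^ 2 / (k + 1)) with hχ
  have hχ0 : ∀ k x, 0 ≤ χ k x := fun k x => by positivity
  have hχ1 : ∀ k x, χ k x ≤ 1 := fun k x => by
    rw [hχ]
    refine div_le_one_of_le₀ ?_ (by positivity)
    have : 0 ≤ x ^ 2 / ((k : ℝ) + 1) := by positivity
    linarith
  have hχc : ∀ k, Continuous (χ k) := fun k => by
    refine continuous_const.div (by fun_prop) fun x => ?_
    positivity
  have hχlim : ∀ k, Tendsto (χ k) (Bornology.cobounded ℝ) (𝓝 0) := fun k => by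
    refine tendsto_const_nhds.div_atTop (tendsto_atTop_add_const_left _ _ ?_)
    refine Tendsto.atTop_div_const (by positivity) ?_
    have : (fun x : ℝ => x ^ 2) = fun x : ℝ => ‖x‖ ^ 2 := by
      funext x
      rw [Real.norm_eq_abs, sq_abs]
    rw [this]
    exact (tendsto_pow_atTop two_ne_zero).comp tendsto_norm_cobounded_atTop
  have hconv : ∀ g : ℝ → ℝ, Continuous g → Tendsto g (Bornology.cobounded ℝ) (𝓝 0) →
      Tendsto (fun n => ∫ x, g x ∂(μ n)) atTop (𝓝 (∫ x, g x ∂ν)) := by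
    intro g hg hg0
    have := h (BoundedContinuousFunction.mkOfCompact ⟨_, continuous_elim_of_tendsto_zero hg hg0⟩)
    simpa [integral_toExt] using this
  have hone : Tendsto (fun n => ∫ _, (1 : ℝ) ∂(μ n)) atTop (𝓝 (∫ _, (1 : ℝ) ∂ν)) := by
    have := h (BoundedContinuousFunction.const _ 1)
    simpa [toExt_real_univ] using this
  have hχi : ∀ k (ρ : Measure ℝ) [IsFiniteMeasure ρ], Integrable (χ k) ρ := fun k ρ _ =>
    Integrable.of_bound (hχc k).aestronglyMeasurable 1 (Eventually.of_forall fun x => by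
      rw [Real.norm_of_nonneg (hχ0 k x)]
      exact hχ1 k x)
  have hfi : ∀ (ρ : Measure ℝ) [IsFiniteMeasure ρ], Integrable f ρ := fun ρ _ =>
    f.integrable ρ
  have hfχi : ∀ k (ρ : Measure ℝ) [IsFiniteMeasure ρ], Integrable (fun x => f x * χ k x) ρ :=
    fun k ρ _ => (hχi k ρ).bdd_mul (c := ‖f‖) f.continuous.aestronglyMeasurable
      (Eventually.of_forall fun x => f.norm_coe_le_norm x)
  -- The cutoff error is controlled by the lost mass, whose integral converges along the sequence;
  -- this replaces a separate tightness argument.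
  have htail : ∀ k (ρ : Measure ℝ) [IsFiniteMeasure ρ],
      ‖∫ x, f x ∂ρ - ∫ x, f x * χ k x ∂ρ‖ ≤ ‖f‖ * (∫ _, (1 : ℝ) ∂ρ - ∫ x, χ k x ∂ρ) := by
    intro k ρ _
    rw [← integral_sub (hfi ρ) (hfχi k ρ), ← integral_sub (integrable_const _) (hχi k ρ),
      ← integral_const_mul]
    refine norm_integral_le_of_norm_le (((integrable_const _).sub (hχi k ρ)).const_mul _)
      (Eventually.of_forall fun x => ?_)
    have e : f x - f x * χ k x = f x * (1 - χ k x) := by ring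
    rw [e, norm_mul, Real.norm_of_nonneg (sub_nonneg.2 (hχ1 k x))]
    exact mul_le_mul_of_nonneg_right (f.norm_coe_le_norm x) (sub_nonneg.2 (hχ1 k x))
  have hlimχ : Tendsto (fun k => ‖f‖ * (∫ _, (1 : ℝ) ∂ν - ∫ x, χ k x ∂ν)) atTop (𝓝 0) := by
    have h1 : Tendsto (fun k => ∫ x, χ k x ∂ν) atTop (𝓝 (∫ _, (1 : ℝ) ∂ν)) := by
      refine tendsto_integral_of_dominated_convergence (fun _ => 1)
        (fun k => (hχc k).aestronglyMeasurable) (integrable_const _)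
        (fun k => Eventually.of_forall fun x => ?_) (Eventually.of_forall fun x => ?_)
      · rw [Real.norm_of_nonneg (hχ0 k x)]
        exact hχ1 k x
      · have h2 : Tendsto (fun k : ℕ => x ^ 2 / ((k : ℝ) + 1)) atTop (𝓝 0) :=
          tendsto_const_nhds.div_atTop
            (tendsto_atTop_add_const_right _ _ tendsto_natCast_atTop_atTop)
        have h3 : Tendsto (fun k : ℕ => 1 / (1 + x ^ 2 / ((k : ℝ) + 1))) atTop (𝓝 (1 / (1 + 0))) :=
          tendsto_const_nhds.div (h2.const_add 1) (by norm_num)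
        rw [add_zero, div_one] at h3
        exact h3
    simpa using ((tendsto_const_nhds (x := ∫ _, (1 : ℝ) ∂ν)).sub h1).const_mul ‖f‖
  rw [Metric.tendsto_nhds]
  intro ε hε
  obtain ⟨k, hk⟩ := (hlimχ.eventually (gt_mem_nhds (show (0 : ℝ) < ε / 4 by positivity))).exists
  have hfχlim : Tendsto (fun x => f x * χ k x) (Bornology.cobounded ℝ) (𝓝 0) := by
    refine squeeze_zero_norm (a := fun x => ‖f‖ * χ k x) (fun x => ?_)
      (by simpa using (hχlim k).const_mul ‖f‖)
    rw [norm_mul, Real.norm_of_nonneg (hχ0 k x)]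
    exact mul_le_mul_of_nonneg_right (f.norm_coe_le_norm x) (hχ0 k x)
  have hA := hconv (fun x => f x * χ k x) (f.continuous.mul (hχc k)) hfχlim
  have hB : Tendsto (fun n => ‖f‖ * (∫ _, (1 : ℝ) ∂(μ n) - ∫ x, χ k x ∂(μ n))) atTop
      (𝓝 (‖f‖ * (∫ _, (1 : ℝ) ∂ν - ∫ x, χ k x ∂ν))) :=
    (hone.sub (hconv _ (hχc k) (hχlim k))).const_mul _
  filter_upwards [Metric.tendsto_nhds.1 hA (ε / 4) (by positivity),
    hB.eventually (gt_mem_nhds hk)] with n h1 h2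
  rw [dist_eq_norm] at h1 ⊢
  have h3 := htail k (μ n)
  have h4 := htail k ν
  rw [norm_sub_rev] at h4
  have e : ∫ x, f x ∂(μ n) - ∫ x, f x ∂ν =
      (∫ x, f x ∂(μ n) - ∫ x, f x * χ k x ∂(μ n)) +
      (∫ x, f x * χ k x ∂(μ n) - ∫ x, f x * χ k x ∂ν) +
      (∫ x, f x * χ k x ∂ν - ∫ x, f x ∂ν) := by ring
  rw [e]
  refine (norm_add₃_le).trans_lt ?_
  linarith

lemma WeaklyTendsto.map_invPt {μ : ℕ → Measure (OnePoint ℝ)} {ν : Measure (OnePoint ℝ)}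
    (h : WeaklyTendsto μ ν) : WeaklyTendsto (fun n => invLaw (μ n)) (invLaw ν) := by
  intro f
  have := h (f.compContinuous ⟨invPt, continuous_invPt⟩)
  simp only [invLaw]
  simp_rw [integral_map continuous_invPt.measurable.aemeasurable
    f.continuous.measurable.aestronglyMeasurable]
  exact this

lemma invSpectralDist_eq_invLaw {k : ℕ} {A : Matrix (Fin k) (Fin k) ℂ} (hA : A.IsHermitian) :
    invSpectralDist hA = invLaw (toExt (spectralDist hA)) := by
  have hm : Measurable fun x : ℝ => (x : OnePoint ℝ) := OnePoint.continuous_coe.measurable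
  rw [invLaw, toExt, Measure.map_map continuous_invPt.measurable hm, spectralDist,
    Measure.map_smul, ← Measure.mapₗ_apply_of_measurable (continuous_invPt.measurable.comp hm),
    map_sum, invSpectralDist]
  simp only [Measure.mapₗ_apply_of_measurable (continuous_invPt.measurable.comp hm),
    Measure.map_dirac' (continuous_invPt.measurable.comp hm), Function.comp]

lemma spectralDist_univ {k : ℕ} {A : Matrix (Fin k) (Fin k) ℂ} (hA : A.IsHermitian) :
    spectralDist hA Set.univ = (k : ENNReal)⁻¹ * k := by
  simp [spectralDist]

instance isFiniteMeasure_spectralDist {k : ℕ} {A : Matrix (Fin k) (Fin k) ℂ}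
    (hA : A.IsHermitian) : IsFiniteMeasure (spectralDist hA) := by
  refine ⟨?_⟩
  rw [spectralDist_univ]
  rcases Nat.eq_zero_or_pos k with rfl | hk
  · simp
  · exact ENNReal.mul_lt_top (by simp [hk]) (by simp)

lemma isProbabilityMeasure_spectralDist {k : ℕ} (hk : k ≠ 0) {A : Matrix (Fin k) (Fin k) ℂ}
    (hA : A.IsHermitian) : IsProbabilityMeasure (spectralDist hA) := by
  refine ⟨?_⟩
  rw [spectralDist_univ, ENNReal.inv_mul_cancel (by exact_mod_cast hk) (by simp)]

/-- For `k = 0` the spectral distribution is the zero measure, so the mass is `1` only eventually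
along the sequence. -/
lemma toExt_spectralDist_real_univ_le {k : ℕ} {A : Matrix (Fin k) (Fin k) ℂ}
    (hA : A.IsHermitian) : (toExt (spectralDist hA)).real Set.univ ≤ 1 := by
  rw [toExt_real_univ]
  by_cases hk : k = 0
  · subst hk
    simp [Measure.real, spectralDist_univ]
  · have := isProbabilityMeasure_spectralDist hk hA
    simp

/-- If the Stieltjes transform of `ν` is the distinguished root, the spectral distributions
converge to `ν`. -/
theorem ae_weaklyTendsto_spectralDist {α : ℝ} (hα : 0 < α) {ν : Measure ℝ} [IsProbabilityMeasure ν]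
    (hν : ∀ t : ℂ, 0 < t.im → IsLimitRoot α t (stieltjes (toExt ν) t))
    {Ω : Type*} [MeasurableSpace Ω] {P : Measure Ω} [IsProbabilityMeasure P]
    {K : ℕ → ℕ} {H : ∀ N : ℕ, Ω → Matrix (Fin (K N)) (Fin N) ℂ}
    (hK : Tendsto (fun N : ℕ => (K N : ℝ) / (N : ℝ)) atTop (𝓝 α))
    (hH : IsGaussianEnsemble P K H) :
    ∀ᵐ ω ∂P,
      WeaklyTendsto (fun N => spectralDist (Matrix.isHermitian_mul_conjTranspose_self (H N ω))) ν ∧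
      WeaklyTendsto (fun N => invSpectralDist
        (Matrix.isHermitian_mul_conjTranspose_self (H N ω))) (invLaw (toExt ν)) := by
  -- Countably many parameters allow one exceptional null set for all of them; density suffices for
  -- weak convergence.
  obtain ⟨Q, hQc, hQd⟩ := TopologicalSpace.exists_countable_dense ℂ
  have hQ : ∀ᵐ ω ∂P, ∀ t ∈ Q, 0 < t.im → Tendsto (fun N => stieltjes (toExt (spectralDist
      (Matrix.isHermitian_mul_conjTranspose_self (H N ω)))) t) atTop
        (𝓝 (stieltjes (toExt ν) t)) := by
    rw [ae_ball_iff hQc]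
    intro t _
    by_cases ht : 0 < t.im
    · obtain ⟨m, hm, hlim⟩ := ae_tendsto_stieltjes_spectralDist hα ht hK hH
      rw [hm.unique hα ht (hν t ht)] at hlim
      filter_upwards [hlim] with ω hω _ using hω
    · exact Eventually.of_forall fun ω h => absurd h ht
  filter_upwards [hQ] with ω hω
  have hext : WeaklyTendsto (fun N => toExt (spectralDist
      (Matrix.isHermitian_mul_conjTranspose_self (H N ω)))) (toExt ν) := by
    refine weaklyTendsto_of_tendsto_stieltjes (fun N => toExt_spectralDist_real_univ_le _) ?_ hQd hω
    filter_upwards [eventually_pos_of_ratio hα hK] with N hN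
    have := isProbabilityMeasure_spectralDist hN.2.1
      (Matrix.isHermitian_mul_conjTranspose_self (H N ω))
    simp
  refine ⟨weaklyTendsto_of_toExt hext, ?_⟩
  simp only [invSpectralDist_eq_invLaw]
  exact hext.map_invPt

/-! ### Existence of the limit law. -/

/-- Gaussian ensembles exist. -/
lemma exists_isGaussianEnsemble (K : ℕ → ℕ) :
    ∃ (P : Measure (ℕ × ℕ × ℕ → ℂ)) (H : ∀ N : ℕ, (ℕ × ℕ × ℕ → ℂ) → Matrix (Fin (K N)) (Fin N) ℂ),
      IsProbabilityMeasure P ∧ IsGaussianEnsemble P K H := by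
  refine ⟨Measure.infinitePi fun p => complexGaussian ((p.1 : NNReal)⁻¹),
    fun N ω => Matrix.of fun i j => ω (N, i, j), inferInstance, fun N => ⟨fun i j => ?_, ?_⟩⟩
  · exact (measurePreserving_eval_infinitePi
      (fun p : ℕ × ℕ × ℕ => complexGaussian ((p.1 : NNReal)⁻¹)) (N, (i : ℕ), (j : ℕ))).hasLaw
  · have h := iIndepFun_infinitePi
      (P := fun p : ℕ × ℕ × ℕ => complexGaussian ((p.1 : NNReal)⁻¹)) (X := fun _ z => z)
      (fun _ => measurable_id)
    refine h.precomp (g := fun p : Fin (K N) × Fin N => (N, (p.1 : ℕ), (p.2 : ℕ))) ?_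
    rintro ⟨i, j⟩ ⟨i', j'⟩ hij
    simp only [Prod.mk.injEq, Fin.val_inj] at hij
    exact Prod.ext hij.2.1 hij.2.2

lemma tendsto_stieltjes_of_tendsto_probabilityMeasure {ι : Type*} {l : Filter ι}
    {p : ι → ProbabilityMeasure (OnePoint ℝ)} {μ : ProbabilityMeasure (OnePoint ℝ)}
    (h : Tendsto p l (𝓝 μ)) {t : ℂ} (ht : t.im ≠ 0) :
    Tendsto (fun n => stieltjes (p n) t) l (𝓝 (stieltjes μ t)) := by
  rw [ProbabilityMeasure.tendsto_iff_forall_integral_tendsto] at h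
  have hc := continuous_stieltjesKernel ht
  have hre := h (BoundedContinuousFunction.mkOfCompact
    ⟨fun x => (stieltjesKernel t x).re, Complex.continuous_re.comp hc⟩)
  have him := h (BoundedContinuousFunction.mkOfCompact
    ⟨fun x => (stieltjesKernel t x).im, Complex.continuous_im.comp hc⟩)
  simp only [BoundedContinuousFunction.mkOfCompact_apply, ContinuousMap.coe_mk] at hre him
  have e : ∀ q : ProbabilityMeasure (OnePoint ℝ), stieltjes q t =
      ((∫ x, (stieltjesKernel t x).re ∂(q : Measure (OnePoint ℝ)) : ℝ) : ℂ) +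
      ((∫ x, (stieltjesKernel t x).im ∂(q : Measure (OnePoint ℝ)) : ℝ) : ℂ) * Complex.I := by
    intro q
    have hi := integrable_stieltjesKernel (μ := (q : Measure (OnePoint ℝ)))
      (mem_stieltjesDomain_of_im_ne_zero _ ht)
    have h1 : ∫ x, (stieltjesKernel t x).re ∂(q : Measure (OnePoint ℝ)) = (stieltjes q t).re :=
      integral_re hi
    have h2 : ∫ x, (stieltjesKernel t x).im ∂(q : Measure (OnePoint ℝ)) = (stieltjes q t).im :=
      integral_im hi
    rw [h1, h2, Complex.re_add_im]
  simp only [e]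
  exact ((Complex.continuous_ofReal.tendsto _).comp hre).add
    (((Complex.continuous_ofReal.tendsto _).comp him).mul_const _)

lemma isLimitRoot_of_dense {α : ℝ} {μ : Measure (OnePoint ℝ)} [IsProbabilityMeasure μ] {Q : Set ℂ}
    (hQ : Dense Q) (h : ∀ t ∈ Q, 0 < t.im → IsLimitRoot α t (stieltjes μ t)) {t : ℂ}
    (ht : 0 < t.im) : IsLimitRoot α t (stieltjes μ t) := by
  have hcl := subset_closure_of_dense hQ ht
  have hc : ContinuousAt (stieltjes μ) t :=
    (hasDerivAt_stieltjes (mem_stieltjesDomain_of_im_ne_zero μ ht.ne')).continuousAt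
  refine ⟨?_, ?_, ?_⟩
  · have h1 : ContinuousAt (fun t => (α : ℂ) * t * stieltjes μ t ^ 2 +
        (t + α - 1) * stieltjes μ t + 1) t := by fun_prop
    exact isClosed_singleton.closure_subset (h1.continuousWithinAt.mem_closure hcl
      (show Set.MapsTo _ _ {0} from fun s hs => (h s hs.2 hs.1).quadratic))
  · have h1 : ContinuousAt (fun t => (stieltjes μ t).im) t :=
      Complex.continuous_im.continuousAt.comp hc
    exact isClosed_Ici.closure_subset (h1.continuousWithinAt.mem_closure hcl
      (show Set.MapsTo _ _ (Set.Ici 0) from fun s hs => (h s hs.2 hs.1).im_nonneg))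
  · have h1 : ContinuousAt (fun t => (t * stieltjes μ t).im) t :=
      Complex.continuous_im.continuousAt.comp (continuousAt_id.mul hc)
    exact isClosed_Ici.closure_subset (h1.continuousWithinAt.mem_closure hcl
      (show Set.MapsTo _ _ (Set.Ici 0) from fun s hs => (h s hs.2 hs.1).im_mul_nonneg))

/-- The mass on `ℝ` can be read off from the Stieltjes transform at infinity. -/
lemma tendsto_mul_stieltjes (μ : Measure (OnePoint ℝ)) [IsProbabilityMeasure μ] {σ : ℝ}
    (hσ : σ ≠ 0) :
    Tendsto (fun y : ℝ => (σ * y * Complex.I) * stieltjes μ (σ * y * Complex.I)) atTop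
      (𝓝 (-((μ.real {OnePoint.infty}ᶜ : ℝ) : ℂ))) := by
  have him : ∀ y : ℝ, (σ * y * Complex.I : ℂ).im = σ * y := fun y => by simp
  have hintg : ∫ x, Set.indicator {OnePoint.infty}ᶜ (fun _ => (-1 : ℂ)) x ∂μ =
      -((μ.real {OnePoint.infty}ᶜ : ℝ) : ℂ) := by
    rw [integral_indicator (measurableSet_singleton _).compl, integral_const]
    simp
  rw [← hintg]
  simp only [stieltjes, ← integral_const_mul]
  refine tendsto_integral_filter_of_dominated_convergence (fun _ => 1)
    (Eventually.of_forall fun y => ((measurable_stieltjesKernel _).const_mul _).aestronglyMeasurable)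
    ?_ (integrable_const _) (Eventually.of_forall fun x => ?_)
  · filter_upwards [eventually_gt_atTop 0] with y hy
    refine Eventually.of_forall fun x => ?_
    have hne : (σ * y * Complex.I : ℂ).im ≠ 0 := by rw [him]; exact mul_ne_zero hσ hy.ne'
    rw [norm_mul]
    have h1 := norm_stieltjesKernel_le_of_im hne x
    have h2 : ‖(σ * y * Complex.I : ℂ)‖ = |(σ * y * Complex.I : ℂ).im| := by
      rw [him]
      simp [abs_mul]
    rw [h2]
    calc _ ≤ |(σ * y * Complex.I : ℂ).im| * (1 / |(σ * y * Complex.I : ℂ).im|) := by gcongr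
      _ = 1 := mul_one_div_cancel (abs_pos.2 hne).ne'
  · induction x using OnePoint.rec with
    | infty => simp [stieltjesKernel_infty]
    | coe x =>
      simp only [stieltjesKernel_coe]
      rw [Set.indicator_of_mem (by simp)]
      have h1 : Tendsto (fun y : ℝ => (x : ℂ) / (σ * y * Complex.I)) atTop (𝓝 0) := by
        rw [tendsto_zero_iff_norm_tendsto_zero]
        have h2 : Tendsto (fun y : ℝ => |x| / (|σ| * y)) atTop (𝓝 0) :=
          tendsto_const_nhds.div_atTop (tendsto_id.const_mul_atTop (abs_pos.2 hσ))
        refine h2.congr' ?_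
        filter_upwards [eventually_gt_atTop 0] with y hy
        simp [abs_of_pos hy]
      have h2 : Tendsto (fun y : ℝ => 1 / ((x : ℂ) / (σ * y * Complex.I) - 1)) atTop
          (𝓝 (1 / (0 - 1))) :=
        tendsto_const_nhds.div (h1.sub_const 1) (by norm_num)
      rw [zero_sub, div_neg, div_one] at h2
      refine h2.congr' ?_
      filter_upwards [eventually_gt_atTop 0] with y hy
      have hσ' : (σ : ℂ) ≠ 0 := by exact_mod_cast hσ
      have hy' : (y : ℂ) ≠ 0 := by exact_mod_cast hy.ne'
      have hI := Complex.I_ne_zero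
      have h3 : (σ * y * Complex.I : ℂ) ≠ 0 := mul_ne_zero (mul_ne_zero hσ' hy') hI
      have h4 : (x : ℂ) / (σ * y * Complex.I) - 1 =
          ((x : ℂ) - σ * y * Complex.I) / (σ * y * Complex.I) := by
        rw [sub_div, div_self h3]
      rw [h4, one_div_div, mul_one_div]

/-- The quadratic reads `t m + 1 = -(α t m + α - 1) m`, where on the imaginary axis `t m` stays
bounded and `m → 0`. -/
lemma tendsto_mul_of_isLimitRoot {α : ℝ} {m : ℂ → ℂ}
    (h : ∀ t : ℂ, 0 < t.im → IsLimitRoot α t (m t)) (hb : ∀ t : ℂ, 0 < t.im → ‖m t‖ ≤ 1 / t.im) :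
    Tendsto (fun y : ℝ => (y * Complex.I) * m (y * Complex.I)) atTop (𝓝 (-1)) := by
  rw [tendsto_iff_norm_sub_tendsto_zero]
  have hlim : Tendsto (fun y : ℝ => (|α| + |α - 1|) / y) atTop (𝓝 0) :=
    tendsto_const_nhds.div_atTop tendsto_id
  refine squeeze_zero' (Eventually.of_forall fun y => norm_nonneg _) ?_ hlim
  filter_upwards [eventually_gt_atTop 0] with y hy
  have ht : 0 < (y * Complex.I : ℂ).im := by simpa using hy
  have h1 := (h _ ht).quadratic
  have h2 := hb _ ht
  have h3 : ‖(y * Complex.I : ℂ)‖ = y := by simp [abs_of_pos hy]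
  have h4 : (y * Complex.I : ℂ).im = y := by simp
  rw [h4] at h2
  set t : ℂ := y * Complex.I
  have h5 : t * m t - -1 = -((α : ℂ) * (t * m t) * m t + ((α - 1 : ℝ) : ℂ) * m t) := by
    push_cast
    linear_combination h1
  have h6 : ‖t * m t‖ ≤ 1 := by
    rw [norm_mul, h3]
    calc y * ‖m t‖ ≤ y * (1 / y) := by gcongr
      _ = 1 := mul_one_div_cancel hy.ne'
  rw [h5, norm_neg]
  refine (norm_add_le _ _).trans ?_
  rw [norm_mul, norm_mul (α : ℂ), norm_mul ((α - 1 : ℝ) : ℂ), Complex.norm_real,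
    Complex.norm_real, Real.norm_eq_abs, Real.norm_eq_abs]
  calc |α| * ‖t * m t‖ * ‖m t‖ + |α - 1| * ‖m t‖ ≤ |α| * 1 * (1 / y) + |α - 1| * (1 / y) := by
        gcongr
    _ = _ := by ring

/-- The limiting spectral distribution exists. -/
theorem exists_limit_law {α : ℝ} (hα : 0 < α) :
    ∃ ν : Measure ℝ, IsProbabilityMeasure ν ∧
      ∀ t : ℂ, 0 < t.im → IsLimitRoot α t (stieltjes (toExt ν) t) := by
  -- Any sizes with ratio tending to `α` would do: a single outcome of one such ensemble produces
  -- the law.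
  set K : ℕ → ℕ := fun N => ⌈α * N⌉₊ with hKdef
  have hK : Tendsto (fun N : ℕ => (K N : ℝ) / (N : ℝ)) atTop (𝓝 α) :=
    (tendsto_nat_ceil_mul_div_atTop hα.le).comp tendsto_natCast_atTop_atTop
  obtain ⟨P, H, hP, hH⟩ := exists_isGaussianEnsemble K
  obtain ⟨Q, hQc, hQd⟩ := TopologicalSpace.exists_countable_dense ℂ
  have hQ : ∀ᵐ ω ∂P, ∀ t ∈ Q, 0 < t.im → ∃ m, IsLimitRoot α t m ∧
      Tendsto (fun N => stieltjes (toExt (spectralDist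
        (Matrix.isHermitian_mul_conjTranspose_self (H N ω)))) t) atTop (𝓝 m) := by
    rw [ae_ball_iff hQc]
    intro t _
    by_cases ht : 0 < t.im
    · obtain ⟨m, hm, hlim⟩ := ae_tendsto_stieltjes_spectralDist hα ht hK hH
      filter_upwards [hlim] with ω hω _ using ⟨m, hm, hω⟩
    · exact Eventually.of_forall fun ω h => absurd h ht
  obtain ⟨ω, hω⟩ := hQ.exists
  classical
  set p : ℕ → ProbabilityMeasure (OnePoint ℝ) := fun N =>
    if hN : K N ≠ 0 then
      ⟨toExt (spectralDist (Matrix.isHermitian_mul_conjTranspose_self (H N ω))), by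
        have := isProbabilityMeasure_spectralDist hN
          (Matrix.isHermitian_mul_conjTranspose_self (H N ω))
        infer_instance⟩
    else ⟨Measure.dirac OnePoint.infty, inferInstance⟩ with hp
  -- Probability measures on the compact space `ℝ ∪ {∞}` form a compact space, so an ultrafilter
  -- limit exists.
  obtain ⟨μ, -, hμ⟩ := isCompact_univ.ultrafilter_le_nhds
    ((hyperfilter ℕ).map p) (by simp)
  have hroot : ∀ t ∈ Q, 0 < t.im → IsLimitRoot α t (stieltjes μ t) := by
    intro t htQ ht
    obtain ⟨m, hm, hlim⟩ := hω t htQ ht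
    have h1 : Tendsto (fun N => stieltjes (p N) t) (hyperfilter ℕ) (𝓝 (stieltjes μ t)) :=
      tendsto_stieltjes_of_tendsto_probabilityMeasure hμ ht.ne'
    have h2 : Tendsto (fun N => stieltjes (p N) t) (hyperfilter ℕ) (𝓝 m) := by
      refine Tendsto.mono_left ?_ Nat.hyperfilter_le_atTop
      refine hlim.congr' ?_
      filter_upwards [eventually_pos_of_ratio hα hK] with N hN
      have e : p N = ⟨toExt (spectralDist
          (Matrix.isHermitian_mul_conjTranspose_self (H N ω))), _⟩ := dif_pos hN.2.1
      rw [e]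
      rfl
    rw [tendsto_nhds_unique h1 h2]
    exact hm
  have hroot' : ∀ t : ℂ, 0 < t.im → IsLimitRoot α t (stieltjes μ t) := fun t ht =>
    isLimitRoot_of_dense hQd hroot ht
  -- Along the imaginary axis `t m(t)` tends to minus the mass on `ℝ`, and to `-1` by the quadratic;
  -- hence nothing escapes to `∞`.
  have hmass : (μ : Measure (OnePoint ℝ)).real {OnePoint.infty}ᶜ = 1 := by
    have h1 := tendsto_mul_stieltjes (μ : Measure (OnePoint ℝ)) one_ne_zero
    have h2 := tendsto_mul_of_isLimitRoot hroot' fun t ht => by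
      simpa [abs_of_pos ht] using norm_stieltjes_le (μ : Measure (OnePoint ℝ)) ht.ne'
    simp only [Complex.ofReal_one, one_mul] at h1
    have := tendsto_nhds_unique h1 h2
    rw [neg_inj] at this
    exact_mod_cast this
  have hmass' : (μ : Measure (OnePoint ℝ)) {OnePoint.infty} = 0 := by
    rw [← compl_compl ({OnePoint.infty} : Set (OnePoint ℝ)),
      prob_compl_eq_zero_iff (measurableSet_singleton _).compl]
    rw [← ofReal_measureReal, hmass, ENNReal.ofReal_one]
  have hext : toExt ((μ : Measure (OnePoint ℝ)).comap fun x : ℝ => (x : OnePoint ℝ)) = μ := by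
    rw [toExt, measurableEmbedding_coe.map_comap]
    refine Measure.restrict_eq_self_of_ae_mem ?_
    have : ∀ᵐ x ∂(μ : Measure (OnePoint ℝ)), x ≠ OnePoint.infty := by
      rw [ae_iff]
      simpa using hmass'
    filter_upwards [this] with x hx
    exact OnePoint.ne_infty_iff_exists.1 hx
  refine ⟨(μ : Measure (OnePoint ℝ)).comap fun x : ℝ => (x : OnePoint ℝ), ⟨?_⟩, ?_⟩
  · have h1 : toExt ((μ : Measure (OnePoint ℝ)).comap fun x : ℝ => (x : OnePoint ℝ)) Set.univ
        = 1 := by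
      rw [hext]
      exact measure_univ
    rwa [toExt, Measure.map_apply OnePoint.continuous_coe.measurable MeasurableSet.univ,
      Set.preimage_univ] at h1
  · rw [hext]
    exact hroot'

/-! ### The R-transform of the limit law. -/

lemma stieltjesKernel_conj (s : ℂ) (x : OnePoint ℝ) :
    stieltjesKernel (starRingEnd ℂ s) x = starRingEnd ℂ (stieltjesKernel s x) := by
  induction x using OnePoint.rec with
  | infty => simp [stieltjesKernel_infty]
  | coe x => simp [stieltjesKernel_coe]

lemma stieltjes_conj (μ : Measure (OnePoint ℝ)) (s : ℂ) :
    stieltjes μ (starRingEnd ℂ s) = starRingEnd ℂ (stieltjes μ s) := by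
  rw [stieltjes, stieltjes, ← integral_conj]
  simp only [stieltjesKernel_conj]

lemma continuousAt_stieltjes {μ : Measure (OnePoint ℝ)} [IsFiniteMeasure μ] {s : ℂ}
    (hs : s ∈ stieltjesDomain μ) : ContinuousAt (stieltjes μ) s :=
  (hasDerivAt_stieltjes hs).continuousAt

/-- A closed condition on the upper half-plane extends to the boundary. -/
lemma mem_of_mem_upperHalfPlane {E : Type*} [TopologicalSpace E] {F : ℂ → E} {C : Set E}
    (hC : IsClosed C) {s : ℂ} (hs : 0 ≤ s.im) (hF : ContinuousAt F s)
    (h : ∀ z : ℂ, 0 < z.im → F z ∈ C) : F s ∈ C := by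
  have hcl : s ∈ closure {z : ℂ | 0 < z.im} := by
    rw [Complex.closure_setOfPred_lt_im]
    exact hs
  exact hC.closure_subset (hF.continuousWithinAt.mem_closure hcl fun z hz => h z hz)

/-- Real points off the support are reached by continuity from above, the lower half-plane by
conjugation. -/
lemma quadratic_of_mem_stieltjesDomain {α : ℝ} {μ : Measure (OnePoint ℝ)} [IsProbabilityMeasure μ]
    (hμ : ∀ t : ℂ, 0 < t.im → IsLimitRoot α t (stieltjes μ t)) {t : ℂ}
    (ht : t ∈ stieltjesDomain μ) :
    (α : ℂ) * t * stieltjes μ t ^ 2 + (t + α - 1) * stieltjes μ t + 1 = 0 := by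
  rcases le_or_gt 0 t.im with him | him
  · have hc := continuousAt_stieltjes ht
    exact mem_of_mem_upperHalfPlane isClosed_singleton him
      (F := fun t => (α : ℂ) * t * stieltjes μ t ^ 2 + (t + α - 1) * stieltjes μ t + 1)
      (by fun_prop) fun z hz => (hμ z hz).quadratic
  · have h := congrArg (starRingEnd ℂ) (hμ (starRingEnd ℂ t) (by simpa using him)).quadratic
    simpa [stieltjes_conj] using h

/-- The R-transform of the limiting spectral distribution. -/
theorem isBranch_limit {α : ℝ} {μ : Measure (OnePoint ℝ)} [IsProbabilityMeasure μ]
    (hμ : ∀ t : ℂ, 0 < t.im → IsLimitRoot α t (stieltjes μ t)) :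
    IsBranch μ (stieltjesDomain μ) ∧
      ∀ w ∈ rDomain μ (stieltjesDomain μ), w ≠ 0 ∧ 1 - (α : ℂ) * w ≠ 0 ∧
        fullRTransform μ w = 1 / (1 - (α : ℂ) * w) := by
  have hm0 : ∀ {t}, t ∈ stieltjesDomain μ → stieltjes μ t ≠ 0 := fun ht h0 => by
    simpa [h0] using quadratic_of_mem_stieltjesDomain hμ ht
  -- The quadratic is `(t m + 1)(1 + α m) - m`, so `1 + α m = 0` would give `m = 0`.
  have hm1 : ∀ {t}, t ∈ stieltjesDomain μ → 1 + α * stieltjes μ t ≠ 0 := fun {t} ht h1 => by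
    have h := quadratic_of_mem_stieltjesDomain hμ ht
    exact hm0 ht (by linear_combination (t * stieltjes μ t + 1) * h1 - h)
  have hR : ∀ {t}, t ∈ stieltjesDomain μ →
      t + 1 / stieltjes μ t = 1 / (1 + α * stieltjes μ t) := fun {t} ht => by
    have h := quadratic_of_mem_stieltjesDomain hμ ht
    have h0 := hm0 ht
    have h1 := hm1 ht
    rw [eq_div_iff h1]
    field_simp
    linear_combination h
  -- The equation is linear in `t`, so `t` is recovered from `m` as `1/(1 + α m) - 1/m`.
  have hinj : Set.InjOn (stieltjes μ) (stieltjesDomain μ) := fun s hs t ht hst => by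
    have h1 := hR hs
    rw [hst, ← hR ht] at h1
    exact add_right_cancel h1
  refine ⟨⟨subset_rfl, hinj⟩, ?_⟩
  rintro w ⟨t, ht, hw⟩
  obtain rfl : w = -stieltjes μ t := by rw [hw, neg_neg]
  rw [fullRTransform, rTransform_of_mem ⟨subset_rfl, hinj⟩ ht, hR ht]
  have e : 1 - (α : ℂ) * -stieltjes μ t = 1 + α * stieltjes μ t := by ring
  rw [e]
  exact ⟨neg_ne_zero.2 (hm0 ht), hm1 ht, rfl⟩

lemma ne_dirac_zero_of_isLimitRoot {α : ℝ} {μ : Measure (OnePoint ℝ)}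
    (hμ : ∀ t : ℂ, 0 < t.im → IsLimitRoot α t (stieltjes μ t)) :
    μ ≠ Measure.dirac ((0 : ℝ) : OnePoint ℝ) := by
  rintro rfl
  have h := (hμ Complex.I (by simp)).quadratic
  have e : stieltjes (Measure.dirac ((0 : ℝ) : OnePoint ℝ)) Complex.I = Complex.I := by
    rw [stieltjes, integral_dirac' _ _ (measurable_stieltjesKernel _).stronglyMeasurable,
      stieltjesKernel_coe]
    simp
  rw [e] at h
  have h2 := Complex.I_sq
  exact Complex.I_ne_zero (by linear_combination (α * Complex.I + 1) * h2 - h)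

/-! ### The inverse law: choice of the square root, R-transform and derivative. -/

/-- The real part of the square root of the discriminant does not change sign. -/
lemma re_discrRoot_pos {α : ℝ} (hα : 0 < α) {μ : Measure (OnePoint ℝ)} [IsProbabilityMeasure μ]
    (hμ : ∀ t : ℂ, 0 < t.im → IsLimitRoot α t (stieltjes μ t)) {t : ℂ} (ht : 0 < t.im) :
    0 < (1 - (α : ℂ) - 2 * α * (t * stieltjes μ t)).re := by
  set E : ℂ → ℂ := fun t => 1 - (α : ℂ) - 2 * α * (t * stieltjes μ t) with hE
  have hinf := invLaw_ne_dirac_infty (ne_dirac_zero_of_isLimitRoot hμ)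
  have hne : ∀ t : ℂ, 0 < t.im → (E t).re ≠ 0 := by
    intro t ht h0
    have ht0 : t ≠ 0 := by rintro rfl; simp at ht
    have htd := mem_stieltjesDomain_of_im_ne_zero μ ht.ne'
    -- If `Re E = 0` then `E²` is real, yet the right side is nonreal because a nondegenerate
    -- Stieltjes transform is nonreal off the real axis.
    have h1 : E t ^ 2 = (1 - (α : ℂ)) ^ 2 + 4 * α * stieltjes (invLaw μ) t⁻¹ := by
      rw [stieltjes_invLaw_inv μ ht0 htd, hE]
      linear_combination 4 * α * t * (hμ t ht).quadratic
    have h2 : (E t ^ 2).im = 0 := by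
      rw [sq, Complex.mul_im, h0]
      ring
    have hinv : t⁻¹.im ≠ 0 := by
      rw [Complex.inv_im]
      exact div_ne_zero (neg_ne_zero.2 ht.ne') (Complex.normSq_pos.2 ht0).ne'
    have hid := mem_stieltjesDomain_of_im_ne_zero (invLaw μ) hinv
    have h3 : (stieltjes (invLaw μ) t⁻¹).im ≠ 0 := by
      rw [im_stieltjes hid]
      exact mul_ne_zero hinv (integral_norm_sq_stieltjesKernel_pos hinf hid).ne'
    have h4 : ((1 - (α : ℂ)) ^ 2 + 4 * α * stieltjes (invLaw μ) t⁻¹).im =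
        4 * α * (stieltjes (invLaw μ) t⁻¹).im := by
      have e1 : (1 - (α : ℂ)) ^ 2 = (((1 - α) ^ 2 : ℝ) : ℂ) := by push_cast; ring
      have e2 : (4 * α : ℂ) = ((4 * α : ℝ) : ℂ) := by push_cast; ring
      rw [e1, e2, Complex.add_im, Complex.ofReal_im, zero_add, Complex.im_ofReal_mul]
    rw [h1, h4] at h2
    exact mul_ne_zero (by positivity) h3 h2
  -- The sign is fixed at infinity, where `t m → -1`, and is propagated by connectedness of the
  -- half-plane.
  have hlim : Tendsto (fun y : ℝ => (E (y * Complex.I)).re) atTop (𝓝 (1 + α)) := by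
    have h1 := tendsto_mul_of_isLimitRoot hμ fun t ht => by
      simpa [abs_of_pos ht] using norm_stieltjes_le μ ht.ne'
    have h2 := (Complex.continuous_re.tendsto _).comp
      ((h1.const_mul (2 * (α : ℂ))).const_sub (1 - (α : ℂ)))
    have e : (1 - (α : ℂ) - 2 * α * -1).re = 1 + α := by
      have : (1 - (α : ℂ) - 2 * α * -1) = ((1 + α : ℝ) : ℂ) := by push_cast; ring
      rw [this, Complex.ofReal_re]
    rw [e] at h2
    exact h2
  obtain ⟨y, hy, hpos⟩ := ((eventually_gt_atTop 0).and
    (hlim.eventually (lt_mem_nhds (show 0 < 1 + α by linarith)))).exists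
  by_contra hcon
  have hconn : IsPreconnected {z : ℂ | 0 < z.im} :=
    (convex_halfSpace_im_gt 0).isPreconnected
  have hcont : ContinuousOn (fun z => (E z).re) {z : ℂ | 0 < z.im} := fun z hz => by
    have := continuousAt_stieltjes (mem_stieltjesDomain_of_im_ne_zero μ (ne_of_gt hz))
    exact (Complex.continuous_re.continuousAt.comp
      (by fun_prop : ContinuousAt E z)).continuousWithinAt
  obtain ⟨z, hz, hz0⟩ := hconn.intermediate_value (show t ∈ {z : ℂ | 0 < z.im} from ht)
    (show (y * Complex.I : ℂ) ∈ {z : ℂ | 0 < z.im} by simpa using hy) hcont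
    ⟨not_lt.1 hcon, hpos.le⟩
  exact hne z hz hz0

/-- The square root of the discriminant, in terms of the Stieltjes transform of the inverse. -/
def invDiscrRoot (α : ℝ) (μ : Measure (OnePoint ℝ)) (s : ℂ) : ℂ :=
  1 + α + 2 * α * (s * stieltjes (invLaw μ) s)

lemma invDiscrRoot_conj (α : ℝ) (μ : Measure (OnePoint ℝ)) (s : ℂ) :
    invDiscrRoot α μ (starRingEnd ℂ s) = starRingEnd ℂ (invDiscrRoot α μ s) := by
  simp [invDiscrRoot, stieltjes_conj, Complex.conj_ofNat]

lemma invDiscrRoot_inv (α : ℝ) (μ : Measure (OnePoint ℝ)) [IsProbabilityMeasure μ] {t : ℂ}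
    (h0 : t ≠ 0) (ht : t ∈ stieltjesDomain μ) :
    invDiscrRoot α μ t⁻¹ = 1 - (α : ℂ) - 2 * α * (t * stieltjes μ t) := by
  rw [invDiscrRoot, stieltjes_invLaw_inv μ h0 ht]
  field_simp
  ring

lemma continuousAt_invDiscrRoot (α : ℝ) {μ : Measure (OnePoint ℝ)} [IsProbabilityMeasure μ] {s : ℂ}
    (hs : s ∈ stieltjesDomain (invLaw μ)) : ContinuousAt (invDiscrRoot α μ) s := by
  have := continuousAt_stieltjes hs
  unfold invDiscrRoot
  fun_prop

/-- Away from `0` this is the quadratic at `1/s`. The point `0`, if it lies in the domain, is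
reached by continuity from the upper half-plane. -/
lemma invDiscrRoot_sq {α : ℝ} {μ : Measure (OnePoint ℝ)} [IsProbabilityMeasure μ]
    (hμ : ∀ t : ℂ, 0 < t.im → IsLimitRoot α t (stieltjes μ t)) {s : ℂ}
    (hs : s ∈ stieltjesDomain (invLaw μ)) :
    invDiscrRoot α μ s ^ 2 = (1 - (α : ℂ)) ^ 2 + 4 * α * stieltjes (invLaw μ) s := by
  have key : ∀ {s : ℂ}, s ≠ 0 → s ∈ stieltjesDomain (invLaw μ) →
      invDiscrRoot α μ s ^ 2 - ((1 - (α : ℂ)) ^ 2 + 4 * α * stieltjes (invLaw μ) s) = 0 := by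
    intro s h0 hs
    have ht : s⁻¹ ∈ stieltjesDomain μ := by
      have := inv_mem_stieltjesDomain_invLaw h0 hs
      rwa [invLaw_invLaw] at this
    have h1 := invDiscrRoot_inv α μ (inv_ne_zero h0) ht
    have h2 := stieltjes_invLaw_inv μ (inv_ne_zero h0) ht
    rw [inv_inv] at h1 h2
    rw [h1, h2]
    linear_combination 4 * α * s⁻¹ * quadratic_of_mem_stieltjesDomain hμ ht
  rw [← sub_eq_zero]
  by_cases h0 : s = 0
  · subst h0
    have hc1 := continuousAt_stieltjes hs
    have hc2 := continuousAt_invDiscrRoot α hs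
    refine mem_of_mem_upperHalfPlane isClosed_singleton (le_of_eq (by simp))
      (F := fun s => invDiscrRoot α μ s ^ 2 -
        ((1 - (α : ℂ)) ^ 2 + 4 * α * stieltjes (invLaw μ) s)) (by fun_prop) fun z hz => ?_
    exact key (by rintro rfl; simp at hz) (mem_stieltjesDomain_of_im_ne_zero _ hz.ne')
  · exact key h0 hs

/-- At a real point the kernel is real, so its square is its squared modulus. The integral is the
derivative of the Stieltjes transform. -/
lemma integral_stieltjesKernel_sq_ne_zero {μ : Measure (OnePoint ℝ)} [IsProbabilityMeasure μ]
    (hμ : μ ≠ Measure.dirac OnePoint.infty) {s : ℂ} (hs : s ∈ stieltjesDomain μ) (him : s.im = 0) :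
    ∫ x, stieltjesKernel s x ^ 2 ∂μ ≠ 0 := by
  have h : ∀ x, stieltjesKernel s x ^ 2 = ((‖stieltjesKernel s x‖ ^ 2 : ℝ) : ℂ) := fun x => by
    have h1 := stieltjesKernel_conj s x
    rw [Complex.conj_eq_iff_im.2 him] at h1
    rw [← Complex.normSq_eq_norm_sq, ← Complex.mul_conj, ← h1, sq]
  simp only [h]
  rw [integral_complex_ofReal]
  exact_mod_cast (integral_norm_sq_stieltjesKernel_pos hμ hs).ne'

/-- Off the real axis this is `re_discrRoot_pos` after inversion and conjugation. At a real point
continuity gives only `≥ 0`. There the root `D` is real, and `D = 0` is excluded by differentiating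
`D² = (1 - α)² + 4α m`: the left side would have derivative `0`, the right side `4α m' ≠ 0`. -/
lemma invDiscrRoot_re_pos {α : ℝ} (hα : 0 < α) {μ : Measure (OnePoint ℝ)} [IsProbabilityMeasure μ]
    (hμ : ∀ t : ℂ, 0 < t.im → IsLimitRoot α t (stieltjes μ t)) {s : ℂ}
    (hs : s ∈ stieltjesDomain (invLaw μ)) : 0 < (invDiscrRoot α μ s).re := by
  have hneg : ∀ {s : ℂ}, s.im < 0 → 0 < (invDiscrRoot α μ s).re := by
    intro s him
    have h0 : s ≠ 0 := by rintro rfl; simp at him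
    have hinv : 0 < s⁻¹.im := by
      rw [Complex.inv_im]
      exact div_pos (neg_pos.2 him) (Complex.normSq_pos.2 h0)
    have h1 := invDiscrRoot_inv α μ (inv_ne_zero h0)
      (mem_stieltjesDomain_of_im_ne_zero μ hinv.ne')
    rw [inv_inv] at h1
    rw [h1]
    exact re_discrRoot_pos hα hμ hinv
  have hpos : ∀ {s : ℂ}, 0 < s.im → 0 < (invDiscrRoot α μ s).re := by
    intro s him
    have := hneg (s := starRingEnd ℂ s) (by simpa using him)
    rwa [invDiscrRoot_conj, Complex.conj_re] at this
  rcases lt_trichotomy s.im 0 with him | him | him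
  · exact hneg him
  · have hge : 0 ≤ (invDiscrRoot α μ s).re :=
      mem_of_mem_upperHalfPlane isClosed_Ici (F := fun s => (invDiscrRoot α μ s).re) him.ge
        (Complex.continuous_re.continuousAt.comp (continuousAt_invDiscrRoot α hs))
        fun z hz => (hpos hz).le
    refine lt_of_le_of_ne hge fun h0 => ?_
    have hreal : (invDiscrRoot α μ s).im = 0 := by
      rw [← Complex.conj_eq_iff_im, ← invDiscrRoot_conj, Complex.conj_eq_iff_im.2 him]
    have hzero : invDiscrRoot α μ s = 0 := Complex.ext h0.symm hreal
    have hm := hasDerivAt_stieltjes hs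
    have hD : HasDerivAt (invDiscrRoot α μ) _ s :=
      (((hasDerivAt_id s).mul hm).const_mul (2 * (α : ℂ))).const_add (1 + (α : ℂ))
    have h1 := hD.pow 2
    have h2 := (hm.const_mul (4 * (α : ℂ))).const_add ((1 - (α : ℂ)) ^ 2)
    have h3 : (invDiscrRoot α μ ^ 2) =ᶠ[𝓝 s]
        fun s => (1 - (α : ℂ)) ^ 2 + 4 * α * stieltjes (invLaw μ) s := by
      filter_upwards [(isOpen_stieltjesDomain (invLaw μ)).mem_nhds hs] with z hz
      exact invDiscrRoot_sq hμ hz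
    have h4 := h1.unique (h2.congr_of_eventuallyEq h3)
    rw [hzero] at h4
    simp only [Nat.add_one_sub_one, pow_one, mul_zero, zero_mul] at h4
    have hinf := invLaw_ne_dirac_infty (ne_dirac_zero_of_isLimitRoot hμ)
    have hα' : (α : ℂ) ≠ 0 := by exact_mod_cast hα.ne'
    exact mul_ne_zero (mul_ne_zero (by norm_num) hα')
      (integral_stieltjesKernel_sq_ne_zero hinf hs him) h4.symm
  · exact hpos him

lemma csqrt_sq {z : ℂ} (hz : 0 < z.re) : csqrt (z ^ 2) = z := by
  rw [csqrt, one_div]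
  exact Complex.sq_cpow_two_inv hz

lemma sq_mem_slitPlane {z : ℂ} (hz : 0 < z.re) : z ^ 2 ∈ Complex.slitPlane := by
  rw [Complex.mem_slitPlane_iff, sq, Complex.mul_re, Complex.mul_im]
  by_cases h : z.im = 0
  · left
    rw [h]
    nlinarith
  · right
    have := mul_ne_zero hz.ne' h
    intro h'
    apply this
    linarith [mul_comm z.re z.im]

lemma csqrt_pow_two (z : ℂ) : csqrt z ^ 2 = z := by
  rw [csqrt, one_div]
  exact Complex.cpow_ofNat_inv_pow z 2

lemma hasDerivAt_csqrt {z : ℂ} (hz : z ∈ Complex.slitPlane) :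
    HasDerivAt csqrt (1 / (2 * csqrt z)) z := by
  have h := (hasDerivAt_id z).cpow_const (c := (1 / 2 : ℂ)) hz
  have hz0 := Complex.slitPlane_ne_zero hz
  have h2 := csqrt_pow_two z
  have h0 : csqrt z ≠ 0 := by
    intro h0
    rw [h0] at h2
    exact hz0 (by simpa using h2.symm)
  refine h.congr_deriv ?_
  rw [id_eq, Complex.cpow_sub _ _ hz0, Complex.cpow_one, ← csqrt]
  field_simp
  linear_combination h2

/-- The injective analytic map `stieltjes μ` has an open range. -/
lemma rDomain_mem_nhds {μ : Measure (OnePoint ℝ)} [IsFiniteMeasure μ]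
    (hμ : IsBranch μ (stieltjesDomain μ)) {w : ℂ} (hw : w ∈ rDomain μ (stieltjesDomain μ)) :
    rDomain μ (stieltjesDomain μ) ∈ 𝓝 w := by
  obtain ⟨s, hs, hsw⟩ := hw
  have hnhds := (isOpen_stieltjesDomain μ).mem_nhds hs
  -- The open mapping theorem; local constancy would contradict injectivity.
  rcases (analyticOnNhd_stieltjes μ s hs).eventually_constant_or_nhds_le_map_nhds with h | h
  · have h1 : ∀ᶠ z in 𝓝[≠] s, z = s := by
      filter_upwards [nhdsWithin_le_nhds h, nhdsWithin_le_nhds hnhds] with z hz hzd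
      exact hμ.2 hzd hs hz
    obtain ⟨z, hz, hz'⟩ := (h1.and self_mem_nhdsWithin).exists
    exact absurd hz hz'
  · rw [hsw] at h
    exact (continuous_neg.tendsto w).eventually (h (image_mem_map hnhds))

lemma hasDerivAt_invRTransform_formula {α : ℝ} (hα : 0 < α) {w : ℂ} (hw : w ≠ 0)
    (hmem : (1 - (α : ℂ)) ^ 2 - 4 * (α : ℂ) * w ∈ Complex.slitPlane) :
    HasDerivAt (fun w => (1 - (α : ℂ) - csqrt ((1 - (α : ℂ)) ^ 2 - 4 * (α : ℂ) * w)) /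
        (2 * (α : ℂ) * w))
      ((1 - (α : ℂ) - csqrt ((1 - (α : ℂ)) ^ 2 - 4 * (α : ℂ) * w)) ^ 2 /
        (4 * (α : ℂ) * w ^ 2 * csqrt ((1 - (α : ℂ)) ^ 2 - 4 * (α : ℂ) * w))) w := by
  have hα' : (α : ℂ) ≠ 0 := by exact_mod_cast hα.ne'
  have h1 : HasDerivAt (fun w : ℂ => (1 - (α : ℂ)) ^ 2 - 4 * (α : ℂ) * w) (-(4 * (α : ℂ))) w := by
    simpa using ((hasDerivAt_id w).const_mul (4 * (α : ℂ))).const_sub ((1 - (α : ℂ)) ^ 2)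
  have h2 := (HasDerivAt.comp w (hasDerivAt_csqrt hmem) h1).const_sub (1 - (α : ℂ))
  have h3 : HasDerivAt (fun w : ℂ => 2 * (α : ℂ) * w) (2 * α) w := by
    simpa using (hasDerivAt_id w).const_mul (2 * (α : ℂ))
  have hne : 2 * (α : ℂ) * w ≠ 0 := mul_ne_zero (mul_ne_zero two_ne_zero hα') hw
  have h4 := h2.div h3 hne
  refine h4.congr_deriv ?_
  have hsq := csqrt_pow_two ((1 - (α : ℂ)) ^ 2 - 4 * (α : ℂ) * w)
  simp only [Function.comp_apply]
  generalize csqrt ((1 - (α : ℂ)) ^ 2 - 4 * (α : ℂ) * w) = S at hsq ⊢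
  have hS : S ≠ 0 := by
    rintro rfl
    exact Complex.slitPlane_ne_zero hmem (by simpa using hsq.symm)
  field_simp
  linear_combination 4 * hsq

/-- The R-transform of the inverse of the limiting spectral distribution. -/
theorem isBranch_invLaw_limit {α : ℝ} (hα : 0 < α) {μ : Measure (OnePoint ℝ)}
    [IsProbabilityMeasure μ] (hμ : ∀ t : ℂ, 0 < t.im → IsLimitRoot α t (stieltjes μ t)) :
    IsBranch (invLaw μ) (stieltjesDomain (invLaw μ)) ∧
      ∀ w ∈ rDomain (invLaw μ) (stieltjesDomain (invLaw μ)),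
        w ≠ 0 ∧ (1 - (α : ℂ)) ^ 2 - 4 * (α : ℂ) * w ∈ Complex.slitPlane ∧
        fullRTransform (invLaw μ) w =
          1 + (α : ℂ) * fullRTransform (invLaw μ) w * (1 + w * fullRTransform (invLaw μ) w) ∧
        fullRTransform (invLaw μ) w =
          (1 - (α : ℂ) - csqrt ((1 - (α : ℂ)) ^ 2 - 4 * (α : ℂ) * w)) / (2 * (α : ℂ) * w) ∧
        HasDerivAt (fullRTransform (invLaw μ))
          ((1 - (α : ℂ) - csqrt ((1 - (α : ℂ)) ^ 2 - 4 * (α : ℂ) * w)) ^ 2 /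
            (4 * (α : ℂ) * w ^ 2 * csqrt ((1 - (α : ℂ)) ^ 2 - 4 * (α : ℂ) * w))) w := by
  have hα' : (α : ℂ) ≠ 0 := by exact_mod_cast hα.ne'
  have hroot : ∀ {s : ℂ}, s ∈ stieltjesDomain (invLaw μ) →
      csqrt ((1 - (α : ℂ)) ^ 2 + 4 * α * stieltjes (invLaw μ) s) = invDiscrRoot α μ s :=
    fun hs => by rw [← invDiscrRoot_sq hμ hs, csqrt_sq (invDiscrRoot_re_pos hα hμ hs)]
  -- A zero of `m` would give `(1 + α)² = (1 - α)²`, that is `α = 0`.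
  have hm0 : ∀ {s : ℂ}, s ∈ stieltjesDomain (invLaw μ) → stieltjes (invLaw μ) s ≠ 0 := by
    intro s hs h0
    have h := invDiscrRoot_sq hμ hs
    rw [invDiscrRoot, h0] at h
    apply hα'
    linear_combination h / 4
  have hinj : Set.InjOn (stieltjes (invLaw μ)) (stieltjesDomain (invLaw μ)) := by
    intro s hs t ht hst
    have h1 := hroot hs
    rw [hst, hroot ht, invDiscrRoot, invDiscrRoot, hst] at h1
    -- The principal root depends on `m` alone, whereas `invDiscrRoot` is affine in `s` with slope
    -- `2α m ≠ 0`; so `m` determines `s`.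
    have h2 : 2 * (α : ℂ) * stieltjes (invLaw μ) t * (t - s) = 0 := by linear_combination h1
    have h3 := (mul_eq_zero.1 h2).resolve_left
      (mul_ne_zero (mul_ne_zero two_ne_zero hα') (hm0 ht))
    exact (sub_eq_zero.1 h3).symm
  have hbranch : IsBranch (invLaw μ) (stieltjesDomain (invLaw μ)) := ⟨subset_rfl, hinj⟩
  have hformula : ∀ w ∈ rDomain (invLaw μ) (stieltjesDomain (invLaw μ)),
      fullRTransform (invLaw μ) w =
        (1 - (α : ℂ) - csqrt ((1 - (α : ℂ)) ^ 2 - 4 * (α : ℂ) * w)) / (2 * (α : ℂ) * w) := by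
    rintro w ⟨s, hs, hw⟩
    obtain rfl : w = -stieltjes (invLaw μ) s := by rw [hw, neg_neg]
    have e : (1 - (α : ℂ)) ^ 2 - 4 * (α : ℂ) * -stieltjes (invLaw μ) s =
      (1 - (α : ℂ)) ^ 2 + 4 * α * stieltjes (invLaw μ) s := by ring
    have h0 := hm0 hs
    rw [fullRTransform, rTransform_of_mem hbranch hs, e, hroot hs, invDiscrRoot]
    field_simp
    ring
  refine ⟨hbranch, fun w hwd => ?_⟩
  have hw : w ≠ 0 ∧ (1 - (α : ℂ)) ^ 2 - 4 * (α : ℂ) * w ∈ Complex.slitPlane := by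
    obtain ⟨s, hs, hw⟩ := hwd
    obtain rfl : w = -stieltjes (invLaw μ) s := by rw [hw, neg_neg]
    refine ⟨neg_ne_zero.2 (hm0 hs), ?_⟩
    have h := sq_mem_slitPlane (invDiscrRoot_re_pos hα hμ hs)
    rw [invDiscrRoot_sq hμ hs] at h
    convert h using 1
    ring
  refine ⟨hw.1, hw.2, ?_, hformula w hwd, ?_⟩
  · have hsq := csqrt_pow_two ((1 - (α : ℂ)) ^ 2 - 4 * (α : ℂ) * w)
    have hw0 := hw.1
    rw [hformula w hwd]
    generalize csqrt ((1 - (α : ℂ)) ^ 2 - 4 * (α : ℂ) * w) = S at hsq ⊢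
    field_simp
    linear_combination -hsq
  · refine (hasDerivAt_invRTransform_formula hα hw.1 hw.2).congr_of_eventuallyEq ?_
    -- Because the set of admissible `w` is open, the closed formula holds in a neighbourhood and
    -- can be differentiated.
    filter_upwards [rDomain_mem_nhds hbranch hwd] with z hz using hformula z hz

end RInv

end

theorem mainTheorem2 :
    -- the R-transform of the inverse, for a general distribution on `ℝ ∪ {∞}`
    (∀ μ : Measure (OnePoint ℝ), IsProbabilityMeasure μ →
      (∀ U V : Set ℂ, RInv.IsBranch μ U → RInv.IsBranch (RInv.invLaw μ) V →
        ∀ w ∈ RInv.rDomain μ U, w ≠ 0 →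
          RInv.rTransform μ U w ≠ 0 → 1 + w * RInv.rTransform μ U w ≠ 0 →
          (RInv.rTransform μ U w + 1 / w)⁻¹ ∈ V →
          1 / RInv.rTransform μ U w =
            RInv.rTransform (RInv.invLaw μ) V
              (-RInv.rTransform μ U w * (1 + w * RInv.rTransform μ U w))) ∧
      -- the transforms involved exist on some open subset of the upper half-plane
      (μ ≠ Measure.dirac ((0 : ℝ) : OnePoint ℝ) → μ ≠ Measure.dirac (OnePoint.infty) →
        ∃ U : Set ℂ, IsOpen U ∧ U.Nonempty ∧ U ⊆ {s : ℂ | 0 < s.im} ∧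
          RInv.IsBranch μ U ∧ RInv.IsBranch (RInv.invLaw μ) ((fun s : ℂ => s⁻¹) '' U) ∧
          ∀ w ∈ RInv.rDomain μ U, w ≠ 0 ∧ RInv.rTransform μ U w ≠ 0 ∧
            1 + w * RInv.rTransform μ U w ≠ 0 ∧
            (RInv.rTransform μ U w + 1 / w)⁻¹ ∈ (fun s : ℂ => s⁻¹) '' U)) ∧
    -- the limiting spectra of `H Hᴴ` and of its inverse
    (∀ α : ℝ, 0 < α →
      ∃ ν : Measure ℝ, IsProbabilityMeasure ν ∧
        (∀ (Ω : Type*) (_ : MeasurableSpace Ω) (P : Measure Ω), IsProbabilityMeasure P →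
          ∀ (K : ℕ → ℕ) (H : ∀ N : ℕ, Ω → Matrix (Fin (K N)) (Fin N) ℂ),
            Tendsto (fun N : ℕ => (K N : ℝ) / (N : ℝ)) atTop (𝓝 α) →
            RInv.IsGaussianEnsemble P K H →
            ∀ᵐ ω ∂P,
              RInv.WeaklyTendsto (fun N => RInv.spectralDist
                (Matrix.isHermitian_mul_conjTranspose_self (H N ω))) ν ∧
              RInv.WeaklyTendsto (fun N => RInv.invSpectralDist
                (Matrix.isHermitian_mul_conjTranspose_self (H N ω)))
                (RInv.invLaw (RInv.toExt ν))) ∧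
        -- the R-transform of the limiting spectrum of `H Hᴴ`
        (RInv.IsBranch (RInv.toExt ν) (RInv.stieltjesDomain (RInv.toExt ν)) ∧
          ∀ w ∈ RInv.rDomain (RInv.toExt ν) (RInv.stieltjesDomain (RInv.toExt ν)),
            w ≠ 0 ∧ 1 - (α : ℂ) * w ≠ 0 ∧
            RInv.fullRTransform (RInv.toExt ν) w = 1 / (1 - (α : ℂ) * w)) ∧
        -- the R-transform of the limiting spectrum of `(H Hᴴ)⁻¹` and its derivative
        (RInv.IsBranch (RInv.invLaw (RInv.toExt ν))
            (RInv.stieltjesDomain (RInv.invLaw (RInv.toExt ν))) ∧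
          ∀ w ∈ RInv.rDomain (RInv.invLaw (RInv.toExt ν))
              (RInv.stieltjesDomain (RInv.invLaw (RInv.toExt ν))),
            w ≠ 0 ∧
            (1 - (α : ℂ)) ^ 2 - 4 * (α : ℂ) * w ∈ Complex.slitPlane ∧
            RInv.fullRTransform (RInv.invLaw (RInv.toExt ν)) w =
              1 + (α : ℂ) * RInv.fullRTransform (RInv.invLaw (RInv.toExt ν)) w *
                (1 + w * RInv.fullRTransform (RInv.invLaw (RInv.toExt ν)) w) ∧
            RInv.fullRTransform (RInv.invLaw (RInv.toExt ν)) w =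
              (1 - (α : ℂ) - RInv.csqrt ((1 - (α : ℂ)) ^ 2 - 4 * (α : ℂ) * w)) /
                (2 * (α : ℂ) * w) ∧
            HasDerivAt (RInv.fullRTransform (RInv.invLaw (RInv.toExt ν)))
              ((1 - (α : ℂ) - RInv.csqrt ((1 - (α : ℂ)) ^ 2 - 4 * (α : ℂ) * w)) ^ 2 /
                (4 * (α : ℂ) * w ^ 2 *
                  RInv.csqrt ((1 - (α : ℂ)) ^ 2 - 4 * (α : ℂ) * w))) w)) := by
  refine ⟨fun μ _ => ⟨fun U V hU hV w hw hw0 hR hR1 hmem =>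
    RInv.one_div_rTransform μ hU hV hw hw0 hR hR1 hmem, RInv.exists_isBranch μ⟩, fun α hα => ?_⟩
  obtain ⟨ν, hprob, hν⟩ := RInv.exists_limit_law hα
  exact ⟨ν, hprob, fun Ω _ P _ K H hK hH => RInv.ae_weaklyTendsto_spectralDist hα hν hK hH,
    RInv.isBranch_limit hν, RInv.isBranch_invLaw_limit hα hν⟩
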